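/- Let $M$ be an $n$-dimensional smooth manifold, with local coordinates $(x^\mu,y^a)$ on $TM$, and let $(TM,\lambda)$ be an extended absolute parallelism space: a smooth nonlinear connection $N^a_\mu(x,y)$ together with $n$ smooth vector fields $\lambda_i$ on $TM$ (or on an open part of it, such as $TM$ without the null section) whose horizontal parts $\lambda_i^\alpha$ and vertical parts $\lambda_i^a$ are each linearly independent. Repeated indices, including $i,j$, are summed. Notation. Write $\dot\partial_a=\partial/\partial y^a$, $\delta_\mu=\partial_\mu-N^a_\mu\dot\partial_a$, $R^a_{\mu\nu}=\delta_\nu N^a_\mu-\delta_\mu N^a_\nu$, $N_\beta=\dot\partial_aN^a_\beta$. Let $(\lambda_{i\alpha})$ be defined by $\lambda_i^\alpha\lambda_{i\beta}=\delta^\alpha_\beta$, and put $g_{\alpha\beta}=\lambda_{i\alpha}\lambda_{i\beta}$, $g^{\alpha\beta}=\lambda_i^\alpha\lambda_i^\beta$; indices are raised and lowered with $g$. The canonical connection has horizontal coefficients $\Gamma^\alpha_{\mu\nu}=\lambda_i^\alpha\delta_\nu\lambda_{i\mu}$, $C^\alpha_{\mu c}=\lambda_i^\alpha\dot\partial_c\lambda_{i\mu}$,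 and its horizontal derivative is denoted by $|$. The natural metric connection has coefficients $\mathring\Gamma^\alpha_{\mu\nu}=\frac12g^{\alpha\epsilon}(\delta_\mu g_{\epsilon\nu}+\delta_\nu g_{\epsilon\mu}-\delta_\epsilon g_{\mu\nu})$, $\mathring C^\alpha_{\mu c}=\frac12g^{\alpha\epsilon}\dot\partial_cg_{\mu\epsilon}$, and its horizontal and vertical derivatives are denoted by $\overset{o}{|}$ and $\overset{o}{\|}$; its horizontal curvature $\mathring R^\alpha_{\beta\mu\nu}$ is given by $\mathring{\mathbf R}(\delta_\mu,\delta_\nu)\delta_\beta=\mathring R^\alpha_{\beta\mu\nu}\delta_\alpha$, where $\mathbf R(X,Y)=D_XD_Y-D_YD_X-D_{[X,Y]}$, and $\mathring R_{\beta\nu}=\mathring R^\alpha_{\beta\nu\alpha}$. Put $$\Lambda^\alpha_{\mu\nu}=\Gamma^\alpha_{\mu\nu}-\Gamma^\alpha_{\nu\mu},\quad \gamma^\alpha_{\mu\nu}=\Gamma^\alpha_{\mu\nu}-\mathring\Gamma^\alpha_{\mu\nu},\quad \Lambda_{\alpha\mu\nu}=g_{\alpha\epsilon}\Lambda^\epsilon_{\mu\nu},\quad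 \gamma_{\alpha\mu\nu}=g_{\alpha\epsilon}\gamma^\epsilon_{\mu\nu},\quad C_\mu=\Lambda^\alpha_{\mu\alpha},$$ $$\gamma_{\mu\nu}{}^\alpha=g^{\alpha\beta}\gamma_{\mu\nu\beta},\quad \gamma_{\mu\nu}=C_\alpha\gamma_{\mu\nu}{}^\alpha,\quad \xi_{\mu\nu}=\gamma_{\mu\nu}{}^\alpha{}_{|\alpha},\quad \eta_{\mu\nu}=C_\beta\Lambda^\beta_{\mu\nu},\quad M_{\mu\nu}=N^\beta\Lambda_{\mu\nu\beta},\quad Z_{\mu\nu}=C_\mu N_\nu,$$ and $T_{[\mu\nu]}=\frac12(T_{\mu\nu}-T_{\nu\mu})$. Let $W_{\mu\nu}=\mathfrak S_{\mu,\nu,\epsilon}\,C^\epsilon_{\nu a}R^a_{\epsilon\mu}=C^\epsilon_{\nu a}R^a_{\epsilon\mu}+C^\epsilon_{\epsilon a}R^a_{\mu\nu}+C^\epsilon_{\mu a}R^a_{\nu\epsilon}$. Field equations. Let $\mathcal H=|\lambda|\,g^{\mu\nu}(\Lambda^\alpha_{\epsilon\mu}\Lambda^\epsilon_{\alpha\nu}-C_\mu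 C_\nu)$ with $|\lambda|=\det(\lambda_{i\beta})$, regarded as a function of $\lambda_{i\beta}$, $\partial_\gamma\lambda_{i\beta}$, $\dot\partial_a\lambda_{i\beta}$, the nonlinear connection being kept fixed (it does not depend on the horizontal fundamental vector fields). Let $$\frac{\delta\mathcal H}{\delta\lambda_{j\beta}}=\frac{\partial\mathcal H}{\partial\lambda_{j\beta}}-\frac{\partial}{\partial x^\gamma}\frac{\partial\mathcal H}{\partial(\partial_\gamma\lambda_{j\beta})}-\frac{\partial}{\partial y^a}\frac{\partial\mathcal H}{\partial(\dot\partial_a\lambda_{j\beta})},\qquad E^\beta{}_\sigma=\frac1{|\lambda|}\frac{\delta\mathcal H}{\delta\lambda_{j\beta}}\lambda_{j\sigma},\qquad E_{\mu\nu}=g_{\mu\beta}E^\beta{}_\nu .$$ The horizontal field equations are $E_{\mu\nu}=0$. Electromagnetic field. Define $$F_{\mu\nu}:=(\gamma_{\mu\nu}-\xi_{\mu\nu}+\eta_{\mu\nu}+N_\beta\Lambda^\beta_{\mu\nu})+(M_{[\mu\nu]}-Z_{[\mu\nu]})+\tfrac32W_{\mu\nu},\qquad J^\mu:=F^{\mu\nu}{}_{\overset{o}{|}\nu}.$$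 Then, in every chart: 1. $F_{\mu\nu}=(\gamma_{\mu\nu}-\xi_{\mu\nu}+\eta_{\mu\nu})+N^\beta(\gamma_{\mu\nu\beta}+\Lambda_{\beta\mu\nu})+(\frac12N^\beta\Lambda_{\beta\mu\nu}-Z_{[\mu\nu]})+\frac32W_{\mu\nu}$, and $F_{\mu\nu}=-F_{\nu\mu}$. 2. At each point and for all $\mu,\nu$, the skew part $E_{[\mu\nu]}=0$ of the horizontal field equations holds if and only if $$F_{\mu\nu}=\delta_\nu C_\mu-\delta_\mu C_\nu .$$ 3. If $E_{[\mu\nu]}=0$ for all $\mu,\nu$ throughout the domain of the chart, then, with $\mathfrak S$ the cyclic sum over $\mu,\nu,\sigma$, $$\mathfrak S_{\mu,\nu,\sigma}\,F_{\mu\nu\overset{o}{|}\sigma}=-\,\mathfrak S_{\mu,\nu,\sigma}\,R^a_{\mu\nu}\,\dot\partial_aC_\sigma .$$ 4. The current satisfies $$J^\mu{}_{\overset{o}{|}\mu}=\tfrac12\left\{F^{\epsilon\mu}(\mathring R_{\mu\epsilon}-\mathring R_{\epsilon\mu})+R^a_{\mu\nu}F^{\mu\nu}{}_{\overset{o}{\|}a}\right\}.$$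 (Only part 3 uses the field equations.) -/

import Mathlib

open scoped ContDiff

noncomputable section

namespace EAP

/-- Coordinate space of an `n`-dimensional manifold. -/
abbrev Coord (n : ℕ) := Fin n → ℝ

/-- Local coordinates `(x, y)` on the tangent bundle. -/
abbrev Phase (n : ℕ) := Coord n × Coord n

section Change

variable {n : ℕ} {M : Type*} [TopologicalSpace M]

/-- Jacobian of the coordinate change from `e` to `e'`:
`jac e e' x a' a = ∂x^{a'}/∂x^a` at the point with `e`-coordinates `x`. -/
def jac (e e' : OpenPartialHomeomorph M (Coord n)) (x : Coord n) (a' a : Fin n) : ℝ :=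
  fderiv ℝ (fun z => e' (e.symm z)) x (Pi.single a 1) a'

/-- The induced coordinate change `(x, y) ↦ (x', y')`, `y^{a'} = (∂x^{a'}/∂x^a) y^a`, on `TM`. -/
def change (e e' : OpenPartialHomeomorph M (Coord n)) (p : Phase n) : Phase n :=
  (e' (e.symm p.1), fun a' => ∑ a, jac e e' p.1 a' a * p.2 a)

end Change

/-- An extended absolute parallelism space over the `n`-manifold `M`: a nonlinear connection and
`n` vector fields `λ_i` on (an open part of) `TM`, whose horizontal and vertical parts are each
linearly independent.  The data are given by their components in every chart `e` of the maximal
smooth atlas, which change by the usual laws.  The open part `dom` of `TM` on which the data live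
is given by its image in the coordinates of each chart; it may be all of `TM`, or `TM` without the
null section. -/
structure EAPSpace (n : ℕ) (M : Type*) [TopologicalSpace M] [ChartedSpace (Coord n) M] where
  /-- the domain, in the bundle coordinates of the chart `e` -/
  dom : OpenPartialHomeomorph M (Coord n) → Set (Phase n)
  /-- `N e p a α = N^a_α`, coefficients of the nonlinear connection -/
  N : OpenPartialHomeomorph M (Coord n) → Phase n → Fin n → Fin n → ℝ
  /-- `lamH e p i α = λ_i^α`, the horizontal parts -/
  lamH : OpenPartialHomeomorph M (Coord n) → Phase n → Fin n → Fin n → ℝ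
  /-- `lamV e p i a = λ_i^a`, the vertical parts -/
  lamV : OpenPartialHomeomorph M (Coord n) → Phase n → Fin n → Fin n → ℝ
  isOpen_dom : ∀ e ∈ IsManifold.maximalAtlas (modelWithCornersSelf ℝ (Coord n)) ∞ M,
    IsOpen (dom e)
  dom_subset : ∀ e ∈ IsManifold.maximalAtlas (modelWithCornersSelf ℝ (Coord n)) ∞ M,
    ∀ p ∈ dom e, p.1 ∈ e.target
  dom_change : ∀ e ∈ IsManifold.maximalAtlas (modelWithCornersSelf ℝ (Coord n)) ∞ M,
    ∀ e' ∈ IsManifold.maximalAtlas (modelWithCornersSelf ℝ (Coord n)) ∞ M,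
    ∀ p : Phase n, p.1 ∈ e.target → e.symm p.1 ∈ e'.source →
      (p ∈ dom e ↔ change e e' p ∈ dom e')
  smooth_N : ∀ e ∈ IsManifold.maximalAtlas (modelWithCornersSelf ℝ (Coord n)) ∞ M,
    ContDiffOn ℝ ∞ (N e) (dom e)
  smooth_lamH : ∀ e ∈ IsManifold.maximalAtlas (modelWithCornersSelf ℝ (Coord n)) ∞ M,
    ContDiffOn ℝ ∞ (lamH e) (dom e)
  smooth_lamV : ∀ e ∈ IsManifold.maximalAtlas (modelWithCornersSelf ℝ (Coord n)) ∞ M,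
    ContDiffOn ℝ ∞ (lamV e) (dom e)
  det_lamH : ∀ e ∈ IsManifold.maximalAtlas (modelWithCornersSelf ℝ (Coord n)) ∞ M,
    ∀ p ∈ dom e, (Matrix.of (lamH e p)).det ≠ 0
  det_lamV : ∀ e ∈ IsManifold.maximalAtlas (modelWithCornersSelf ℝ (Coord n)) ∞ M,
    ∀ p ∈ dom e, (Matrix.of (lamV e p)).det ≠ 0
  /-- `N^{a'}_{α'} = p^{a'}_a p^α_{α'} N^a_α + p^{a'}_a (∂p^a_{c'}/∂x^{α'}) y^{c'}` -/
  N_change : ∀ e ∈ IsManifold.maximalAtlas (modelWithCornersSelf ℝ (Coord n)) ∞ M,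
    ∀ e' ∈ IsManifold.maximalAtlas (modelWithCornersSelf ℝ (Coord n)) ∞ M,
    ∀ p ∈ dom e, e.symm p.1 ∈ e'.source → ∀ a' α' : Fin n,
      N e' (change e e' p) a' α' =
        ∑ a, ∑ α, jac e e' p.1 a' a * jac e' e (change e e' p).1 α α' * N e p a α
        + ∑ a, ∑ c, jac e e' p.1 a' a
            * fderiv ℝ (fun z => jac e' e z a c) (change e e' p).1 (Pi.single α' 1)
            * (change e e' p).2 c
  lamH_change : ∀ e ∈ IsManifold.maximalAtlas (modelWithCornersSelf ℝ (Coord n)) ∞ M,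
    ∀ e' ∈ IsManifold.maximalAtlas (modelWithCornersSelf ℝ (Coord n)) ∞ M,
    ∀ p ∈ dom e, e.symm p.1 ∈ e'.source → ∀ i α' : Fin n,
      lamH e' (change e e' p) i α' = ∑ α, jac e e' p.1 α' α * lamH e p i α
  lamV_change : ∀ e ∈ IsManifold.maximalAtlas (modelWithCornersSelf ℝ (Coord n)) ∞ M,
    ∀ e' ∈ IsManifold.maximalAtlas (modelWithCornersSelf ℝ (Coord n)) ∞ M,
    ∀ p ∈ dom e, e.symm p.1 ∈ e'.source → ∀ i a' : Fin n,
      lamV e' (change e e' p) i a' = ∑ a, jac e e' p.1 a' a * lamV e p i a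

section Local

/-! The objects below are computed in one chart, from the functions
`N p a α = N^a_α(p)` and `lam p i α = λ_i^α(p)` of `p = (x, y)`.
Every array of components lists its indices from left to right, upper ones first. -/

variable {n : ℕ}

/-- `∂f/∂x^μ` -/
def dx (μ : Fin n) (f : Phase n → ℝ) (p : Phase n) : ℝ := fderiv ℝ f p (Pi.single μ 1, 0)

/-- `∂f/∂y^a` -/
def dy (a : Fin n) (f : Phase n → ℝ) (p : Phase n) : ℝ := fderiv ℝ f p (0, Pi.single a 1)

variable (N lam : Phase n → Fin n → Fin n → ℝ)

/-- `δ_μ f = ∂_μ f - N^a_μ ∂̇_a f` -/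
def delta (μ : Fin n) (f : Phase n → ℝ) (p : Phase n) : ℝ :=
  dx μ f p - ∑ a, N p a μ * dy a f p

/-- `R^a_{μν} = δ_ν N^a_μ - δ_μ N^a_ν`, the curvature of the nonlinear connection -/
def nlCurv (p : Phase n) (a μ ν : Fin n) : ℝ :=
  delta N ν (fun q => N q a μ) p - delta N μ (fun q => N q a ν) p

/-- `N_β = ∂̇_a N^a_β` -/
def nlTrace (p : Phase n) (β : Fin n) : ℝ := ∑ a, dy a (fun q => N q a β) p

/-- Inverse transpose of a square array; it turns `λ_i^α` into `λ_{iα}` and conversely. -/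
def dual (l : Fin n → Fin n → ℝ) (i α : Fin n) : ℝ := (Matrix.of l).transpose⁻¹ i α

/-- `λ_{iα}` -/
def colam (p : Phase n) : Fin n → Fin n → ℝ := dual (lam p)

/-- `g_{αβ} = λ_{iα} λ_{iβ}` -/
def gLow (p : Phase n) (α β : Fin n) : ℝ := ∑ i, colam lam p i α * colam lam p i β

/-- `g^{αβ} = λ_i^α λ_i^β` -/
def gUp (p : Phase n) (α β : Fin n) : ℝ := ∑ i, lam p i α * lam p i β

/-- `Γ^α_{μν} = λ_i^α δ_ν λ_{iμ}`, canonical `d`-connection -/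
def Gam (p : Phase n) (α μ ν : Fin n) : ℝ :=
  ∑ i, lam p i α * delta N ν (fun q => colam lam q i μ) p

/-- `C^α_{μc} = λ_i^α ∂̇_c λ_{iμ}`, canonical `d`-connection -/
def Cv (p : Phase n) (α μ c : Fin n) : ℝ :=
  ∑ i, lam p i α * dy c (fun q => colam lam q i μ) p

/-- `Γ°^α_{μν} = ½ g^{αε} (δ_μ g_{εν} + δ_ν g_{εμ} - δ_ε g_{μν})`, natural metric
`d`-connection -/
def GamO (p : Phase n) (α μ ν : Fin n) : ℝ :=
  (1 / 2) * ∑ ε, gUp lam p α ε *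
    (delta N μ (fun q => gLow lam q ε ν) p + delta N ν (fun q => gLow lam q ε μ) p
      - delta N ε (fun q => gLow lam q μ ν) p)

/-- `C°^α_{μc} = ½ g^{αε} ∂̇_c g_{με}`, natural metric `d`-connection -/
def CvO (p : Phase n) (α μ c : Fin n) : ℝ :=
  (1 / 2) * ∑ ε, gUp lam p α ε * dy c (fun q => gLow lam q μ ε) p

/-- Torsion `Λ^α_{μν} = Γ^α_{μν} - Γ^α_{νμ}` -/
def Tor (p : Phase n) (α μ ν : Fin n) : ℝ := Gam N lam p α μ ν - Gam N lam p α ν μ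

/-- `Λ_{αμν} = g_{αε} Λ^ε_{μν}` -/
def TorLow (p : Phase n) (α μ ν : Fin n) : ℝ := ∑ ε, gLow lam p α ε * Tor N lam p ε μ ν

/-- Contortion `γ^α_{μν} = Γ^α_{μν} - Γ°^α_{μν}` -/
def con (p : Phase n) (α μ ν : Fin n) : ℝ := Gam N lam p α μ ν - GamO N lam p α μ ν

/-- `γ_{αμν} = g_{αε} γ^ε_{μν}` -/
def conLow (p : Phase n) (α μ ν : Fin n) : ℝ := ∑ ε, gLow lam p α ε * con N lam p ε μ ν

/-- `γ_{μν}^α = g^{αβ} γ_{μνβ}`, stored with the upper index first -/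
def conUp (p : Phase n) (α μ ν : Fin n) : ℝ := ∑ β, gUp lam p α β * conLow N lam p μ ν β

/-- The basic form `C_μ = Λ^α_{μα}` -/
def basic (p : Phase n) (μ : Fin n) : ℝ := ∑ α, Tor N lam p α μ α

/-! Covariant derivatives.  `G` stands for the horizontal and `K` for the vertical coefficients of
a `d`-connection acting on horizontal indices; the index of differentiation comes last. -/

/-- `V^α_{|σ}` -/
def hcovV (G : Phase n → Fin n → Fin n → Fin n → ℝ) (V : Phase n → Fin n → ℝ)
    (p : Phase n) (α σ : Fin n) : ℝ :=
  delta N σ (fun q => V q α) p + ∑ ε, V p ε * G p α ε σ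

/-- `V^α_{||c}` -/
def vcovV (K : Phase n → Fin n → Fin n → Fin n → ℝ) (V : Phase n → Fin n → ℝ)
    (p : Phase n) (α c : Fin n) : ℝ :=
  dy c (fun q => V q α) p + ∑ ε, V p ε * K p α ε c

/-- `T_{μν|σ}` -/
def hcov02 (G : Phase n → Fin n → Fin n → Fin n → ℝ) (T : Phase n → Fin n → Fin n → ℝ)
    (p : Phase n) (μ ν σ : Fin n) : ℝ :=
  delta N σ (fun q => T q μ ν) p - ∑ ε, T p ε ν * G p ε μ σ - ∑ ε, T p μ ε * G p ε ν σ

/-- `T^{μν}_{|σ}` -/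
def hcov20 (G : Phase n → Fin n → Fin n → Fin n → ℝ) (T : Phase n → Fin n → Fin n → ℝ)
    (p : Phase n) (μ ν σ : Fin n) : ℝ :=
  delta N σ (fun q => T q μ ν) p + ∑ ε, T p ε ν * G p μ ε σ + ∑ ε, T p μ ε * G p ν ε σ

/-- `T^{μν}_{||c}` -/
def vcov20 (K : Phase n → Fin n → Fin n → Fin n → ℝ) (T : Phase n → Fin n → Fin n → ℝ)
    (p : Phase n) (μ ν c : Fin n) : ℝ :=
  dy c (fun q => T q μ ν) p + ∑ ε, T p ε ν * K p μ ε c + ∑ ε, T p μ ε * K p ν ε c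

/-- `T^α_{μν|σ}` -/
def hcov12 (G : Phase n → Fin n → Fin n → Fin n → ℝ)
    (T : Phase n → Fin n → Fin n → Fin n → ℝ) (p : Phase n) (α μ ν σ : Fin n) : ℝ :=
  delta N σ (fun q => T q α μ ν) p + ∑ ε, T p ε μ ν * G p α ε σ
    - ∑ ε, T p α ε ν * G p ε μ σ - ∑ ε, T p α μ ε * G p ε ν σ

/-- `R^α_{βμν}`, from
`R(δ_μ, δ_ν) δ_β = D_{δ_μ} D_{δ_ν} δ_β - D_{δ_ν} D_{δ_μ} δ_β - D_{[δ_μ, δ_ν]} δ_β` and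
`[δ_μ, δ_ν] = R^a_{μν} ∂̇_a`. -/
def hCurv (G K : Phase n → Fin n → Fin n → Fin n → ℝ) (p : Phase n) (α β μ ν : Fin n) : ℝ :=
  hcovV N G (fun q ε => hcovV N G (fun _ => Pi.single β 1) q ε ν) p α μ
    - hcovV N G (fun q ε => hcovV N G (fun _ => Pi.single β 1) q ε μ) p α ν
    - ∑ a, nlCurv N p a μ ν * vcovV K (fun _ => Pi.single β 1) p α a

/-- Horizontal Ricci tensor `R°_{βν} = R°^α_{βνα}` of the natural metric `d`-connection -/
def ricciO (p : Phase n) (β ν : Fin n) : ℝ :=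
  ∑ α, hCurv N (GamO N lam) (CvO lam) p α β ν α

/-! The Lagrangian and its Euler-Lagrange expression. -/

/-- `Λ^α_{μν}` as a function of `λ_{iβ} = l i β`, `λ_{iβ,γ} = u i β γ`, `λ_{iβ;a} = v i β a` and of
the coefficients `N^a_μ = m a μ` -/
def torJet (m l : Fin n → Fin n → ℝ) (u v : Fin n → Fin n → Fin n → ℝ) (α μ ν : Fin n) : ℝ :=
  ∑ i, dual l i α * ((u i μ ν - ∑ a, m a ν * v i μ a) - (u i ν μ - ∑ a, m a μ * v i ν a))

/-- `𝓗 = |λ| g^{μν} (Λ^α_{εμ} Λ^ε_{αν} - C_μ C_ν)`, `|λ| = det (λ_{iβ})`, as a function of the same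
variables -/
def lagrangian (m l : Fin n → Fin n → ℝ) (u v : Fin n → Fin n → Fin n → ℝ) : ℝ :=
  (Matrix.of l).det * ∑ μ, ∑ ν, (∑ i, dual l i μ * dual l i ν) *
    (∑ α, ∑ ε, torJet m l u v α ε μ * torJet m l u v ε α ν
      - (∑ α, torJet m l u v α μ α) * (∑ α, torJet m l u v α ν α))

/-- `λ_{iβ,γ}` -/
def colamX (p : Phase n) (i β γ : Fin n) : ℝ := dx γ (fun q => colam lam q i β) p

/-- `λ_{iβ;a}` -/
def colamY (p : Phase n) (i β a : Fin n) : ℝ := dy a (fun q => colam lam q i β) p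

/-- `δ𝓗/δλ_{jβ} = ∂𝓗/∂λ_{jβ} - ∂/∂x^γ (∂𝓗/∂λ_{jβ,γ}) - ∂/∂y^a (∂𝓗/∂λ_{jβ;a})`; the nonlinear
connection is a given function of `(x, y)` that is not varied. -/
def eulerLagrange (p : Phase n) (j β : Fin n) : ℝ :=
  fderiv ℝ (fun l => lagrangian (N p) l (colamX lam p) (colamY lam p)) (colam lam p)
      (Pi.single j (Pi.single β 1))
    - ∑ γ, dx γ (fun q => fderiv ℝ (fun u => lagrangian (N q) (colam lam q) u (colamY lam q))
        (colamX lam q) (Pi.single j (Pi.single β (Pi.single γ 1)))) p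
    - ∑ a, dy a (fun q => fderiv ℝ (fun v => lagrangian (N q) (colam lam q) (colamX lam q) v)
        (colamY lam q) (Pi.single j (Pi.single β (Pi.single a 1)))) p

/-- `E^β_σ = (1/|λ|) (δ𝓗/δλ_{jβ}) λ_{jσ}` -/
def fieldMixed (p : Phase n) (β σ : Fin n) : ℝ :=
  (1 / (Matrix.of (colam lam p)).det) * ∑ j, eulerLagrange N lam p j β * colam lam p j σ

/-- `E_{μν} = g_{μβ} E^β_ν`; the horizontal field equations are `E_{μν} = 0`. -/
def fieldTensor (p : Phase n) (μ ν : Fin n) : ℝ :=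
  ∑ β, gLow lam p μ β * fieldMixed N lam p β ν

/-- `T_{[μν]} = ½ (T_{μν} - T_{νμ})` -/
def skewPart (T : Fin n → Fin n → ℝ) (μ ν : Fin n) : ℝ := (1 / 2) * (T μ ν - T ν μ)

/-! The tensors that make up the electromagnetic field. -/

/-- `γ_{μν} = C_α γ_{μν}^α` -/
def gammaTwo (p : Phase n) (μ ν : Fin n) : ℝ := ∑ α, basic N lam p α * conUp N lam p α μ ν

/-- `ξ_{μν} = γ_{μν}^α_{|α}` (canonical `d`-connection) -/
def xi (p : Phase n) (μ ν : Fin n) : ℝ :=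
  ∑ α, hcov12 N (Gam N lam) (conUp N lam) p α μ ν α

/-- `η_{μν} = C_β Λ^β_{μν}` -/
def eta (p : Phase n) (μ ν : Fin n) : ℝ := ∑ β, basic N lam p β * Tor N lam p β μ ν

/-- `N^β = g^{βε} N_ε` -/
def nlTraceUp (p : Phase n) (β : Fin n) : ℝ := ∑ ε, gUp lam p β ε * nlTrace N p ε

/-- `M_{μν} = N^β Λ_{μνβ}` -/
def Mten (p : Phase n) (μ ν : Fin n) : ℝ := ∑ β, nlTraceUp N lam p β * TorLow N lam p μ ν β

/-- `Z_{μν} = C_μ N_ν` -/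
def Zten (p : Phase n) (μ ν : Fin n) : ℝ := basic N lam p μ * nlTrace N p ν

/-- `𝔖_{μ,ν,ε} C^ε_{νa} R^a_{εμ}`: the upper `ε` stays, the lower indices are permuted
cyclically; `ε` and `a` are summed. -/
def cycCR (p : Phase n) (μ ν : Fin n) : ℝ :=
  ∑ ε, ∑ a, (Cv lam p ε ν a * nlCurv N p a ε μ + Cv lam p ε ε a * nlCurv N p a μ ν
    + Cv lam p ε μ a * nlCurv N p a ν ε)

/-- `F_{μν} = (γ_{μν} - ξ_{μν} + η_{μν} + N_β Λ^β_{μν}) + (M_{[μν]} - Z_{[μν]})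
  + (3/2) 𝔖_{μ,ν,ε} C^ε_{νa} R^a_{εμ}` -/
def emField (p : Phase n) (μ ν : Fin n) : ℝ :=
  (gammaTwo N lam p μ ν - xi N lam p μ ν + eta N lam p μ ν
      + ∑ β, nlTrace N p β * Tor N lam p β μ ν)
    + (skewPart (Mten N lam p) μ ν - skewPart (Zten N lam p) μ ν)
    + (3 / 2) * cycCR N lam p μ ν

/-- `F^{μν} = g^{μα} g^{νβ} F_{αβ}` -/
def emFieldUp (p : Phase n) (μ ν : Fin n) : ℝ :=
  ∑ α, ∑ β, gUp lam p μ α * gUp lam p ν β * emField N lam p α β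

/-- The current `J^μ = F^{μν}_{|ν}` (natural metric `d`-connection) -/
def current (p : Phase n) (μ : Fin n) : ℝ :=
  ∑ ν, hcov20 N (GamO N lam) (emFieldUp N lam) p μ ν ν

end Local

end EAP

end

/-! Parts 1 to 3 rest on passing to the frame λ_i. The canonical connection makes the λ_i parallel,
and g has components δ_{ij} in this frame. Hence the canonical covariant derivative of a tensor is
the derivative of its frame components. Only a few scalar functions remain: the torsion components
T_{kij}, their traces C_i, the components N_i of `nlTrace`, and the terms coming from the curvature
R of the nonlinear connection, differentiated along e_i = λ_i^μ δ_μ.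

Part 2. The Lagrangian is |λ| times a quadratic form in T (`lagrangian_eq`). For i ≠ j the algebraic
part of the frame component E_{ij} is the derivative of 𝓗 along the shear λ_j ↦ λ_j + tλ_i of the
coframe, which fixes |λ|. The diagonal is irrelevant to a skew part. The divergence terms give the
divergence of the momentum, with C_b from the density and the frame, and N_b because the
coefficients N^a_γ depend on y (`frameField_of_ne`). The part quadratic in T with momentum as one
factor is symmetric (`quadratic_field_comm`), so E_{ij} - E_{ji} retains the derivatives of T and
the terms weighted by C_b and N_b.

Among these derivatives is the divergence e_l T_{lij}. Flatness of the canonical connection gives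
the contracted Bianchi identity e_l T_{lij} = (dC)_{ij} - W_{ij} (`sum_frameDer_frameTor`), where dC
stands for the exterior derivative with the sign convention of the statement. The term W appears
because the bracket [δ_μ, δ_ν] is vertical and not zero. Substitution yields E_{ij} - E_{ji} =
4(F_{ij} - (dC)_{ij}) (`frameField_sub`), hence part 2.

Part 1 is the expression of the contortion through the torsion. Part 3 is d(dC), in which [δ_μ, δ_ν]
= R^a_{μν} ∂̇_a leaves the right-hand side, while the symmetric coefficients of the metric
connection cancel. Part 4 holds for every smooth skew tensor and every connection with smooth
symmetric horizontal coefficients (`sum_hcovV_divergence`): the iterated divergence is a commutator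
of derivatives. -/

noncomputable section

namespace EAP

/-! ### Calculus of the operators ∂_μ, ∂̇_a and δ_μ -/

section Calculus

variable {n : ℕ} {N : Phase n → Fin n → Fin n → ℝ} {U : Set (Phase n)} {p : Phase n}

theorem differentiableAt_of_smooth {f : Phase n → ℝ} (hU : IsOpen U)
    (hf : ContDiffOn ℝ ∞ f U) (hp : p ∈ U) : DifferentiableAt ℝ f p :=
  (hf.contDiffAt (hU.mem_nhds hp)).differentiableAt (by simp)

theorem smooth_fderiv_apply {f : Phase n → ℝ} (hU : IsOpen U) (hf : ContDiffOn ℝ ∞ f U)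
    (v : Phase n) : ContDiffOn ℝ ∞ (fun q => fderiv ℝ f q v) U :=
  (hf.fderiv_of_isOpen hU (by simp)).clm_apply contDiffOn_const

theorem smooth_dx {f : Phase n → ℝ} (hU : IsOpen U) (hf : ContDiffOn ℝ ∞ f U) (μ : Fin n) :
    ContDiffOn ℝ ∞ (dx μ f) U :=
  smooth_fderiv_apply hU hf _

theorem smooth_dy {f : Phase n → ℝ} (hU : IsOpen U) (hf : ContDiffOn ℝ ∞ f U) (a : Fin n) :
    ContDiffOn ℝ ∞ (dy a f) U :=
  smooth_fderiv_apply hU hf _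

theorem smooth_sum {ι : Type*} {s : Finset ι} {f : ι → Phase n → ℝ}
    (hf : ∀ i, ContDiffOn ℝ ∞ (f i) U) : ContDiffOn ℝ ∞ (fun q => ∑ i ∈ s, f i q) U :=
  ContDiffOn.sum fun i _ => hf i

theorem smooth_delta {f : Phase n → ℝ} (hU : IsOpen U)
    (hN : ∀ a μ, ContDiffOn ℝ ∞ (fun q => N q a μ) U) (hf : ContDiffOn ℝ ∞ f U) (μ : Fin n) :
    ContDiffOn ℝ ∞ (delta N μ f) U :=
  (smooth_dx hU hf μ).sub (smooth_sum fun a => (hN a μ).mul (smooth_dy hU hf a))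

/-- `δ_μ` as a tangent vector of the coordinate space. -/
def deltaVec (N : Phase n → Fin n → Fin n → ℝ) (μ : Fin n) (p : Phase n) : Phase n :=
  (Pi.single μ 1, fun a => -N p a μ)

theorem deltaVec_eq (μ : Fin n) :
    deltaVec N μ p = ((Pi.single μ 1, 0) : Phase n)
      - ∑ a, N p a μ • ((0, Pi.single a 1) : Phase n) := by
  ext b
  · simp [deltaVec, Prod.fst_sum]
  · simp [deltaVec, Prod.snd_sum, Finset.sum_apply, Pi.single_apply]

/-- At a fixed point δ_μ is a directional derivative, so its locality, linearity and Leibniz rule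
are inherited from `fderiv`. -/
theorem delta_eq_fderiv (μ : Fin n) (f : Phase n → ℝ) :
    delta N μ f p = fderiv ℝ f p (deltaVec N μ p) := by
  rw [deltaVec_eq, map_sub, map_sum]
  simp only [delta, dx, dy, map_smul, smul_eq_mul]

variable {f g : Phase n → ℝ}

theorem delta_congr {μ : Fin n} (hU : IsOpen U) (hp : p ∈ U) (h : ∀ q ∈ U, f q = g q) :
    delta N μ f p = delta N μ g p := by
  have : f =ᶠ[nhds p] g := Filter.eventually_of_mem (hU.mem_nhds hp) h
  rw [delta_eq_fderiv, delta_eq_fderiv, this.fderiv_eq]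

theorem dx_congr {μ : Fin n} (hU : IsOpen U) (hp : p ∈ U) (h : ∀ q ∈ U, f q = g q) :
    dx μ f p = dx μ g p := by
  have : f =ᶠ[nhds p] g := Filter.eventually_of_mem (hU.mem_nhds hp) h
  rw [dx, dx, this.fderiv_eq]

theorem dy_congr {μ : Fin n} (hU : IsOpen U) (hp : p ∈ U) (h : ∀ q ∈ U, f q = g q) :
    dy μ f p = dy μ g p := by
  have : f =ᶠ[nhds p] g := Filter.eventually_of_mem (hU.mem_nhds hp) h
  rw [dy, dy, this.fderiv_eq]

theorem delta_const (μ : Fin n) (c : ℝ) : delta N μ (fun _ => c) p = 0 := by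
  simp [delta_eq_fderiv]

theorem dy_const (a : Fin n) (c : ℝ) : dy a (fun _ => c) p = 0 := by
  simp [dy]

theorem delta_add (hf : DifferentiableAt ℝ f p) (hg : DifferentiableAt ℝ g p) (μ : Fin n) :
    delta N μ (fun q => f q + g q) p = delta N μ f p + delta N μ g p := by
  simp [delta_eq_fderiv, fderiv_fun_add hf hg]

theorem delta_sub (hf : DifferentiableAt ℝ f p) (hg : DifferentiableAt ℝ g p) (μ : Fin n) :
    delta N μ (fun q => f q - g q) p = delta N μ f p - delta N μ g p := by
  simp [delta_eq_fderiv, fderiv_fun_sub hf hg]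

theorem delta_mul (hf : DifferentiableAt ℝ f p) (hg : DifferentiableAt ℝ g p) (μ : Fin n) :
    delta N μ (fun q => f q * g q) p = delta N μ f p * g p + f p * delta N μ g p := by
  simp [delta_eq_fderiv, fderiv_fun_mul hf hg]
  ring

theorem delta_const_mul (hg : DifferentiableAt ℝ g p) (μ : Fin n) (c : ℝ) :
    delta N μ (fun q => c * g q) p = c * delta N μ g p := by
  simp [delta_eq_fderiv, fderiv_const_mul hg]

theorem delta_sum {ι : Type*} {s : Finset ι} {f : ι → Phase n → ℝ}
    (hf : ∀ i, DifferentiableAt ℝ (f i) p) (μ : Fin n) :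
    delta N μ (fun q => ∑ i ∈ s, f i q) p = ∑ i ∈ s, delta N μ (f i) p := by
  simp [delta_eq_fderiv, fderiv_fun_sum fun i _ => hf i]

theorem dy_mul (hf : DifferentiableAt ℝ f p) (hg : DifferentiableAt ℝ g p) (a : Fin n) :
    dy a (fun q => f q * g q) p = dy a f p * g p + f p * dy a g p := by
  simp [dy, fderiv_fun_mul hf hg]
  ring

theorem dy_sum {ι : Type*} {s : Finset ι} {f : ι → Phase n → ℝ}
    (hf : ∀ i, DifferentiableAt ℝ (f i) p) (a : Fin n) :
    dy a (fun q => ∑ i ∈ s, f i q) p = ∑ i ∈ s, dy a (f i) p := by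
  simp [dy, fderiv_fun_sum fun i _ => hf i]

theorem fderiv_fderiv_comm (hU : IsOpen U) (hf : ContDiffOn ℝ ∞ f U) (hp : p ∈ U)
    (v w : Phase n) :
    fderiv ℝ (fun q => fderiv ℝ f q v) p w = fderiv ℝ (fun q => fderiv ℝ f q w) p v := by
  have h1 : ContDiffAt ℝ ∞ f p := hf.contDiffAt (hU.mem_nhds hp)
  have h2 : DifferentiableAt ℝ (fderiv ℝ f) p :=
    (h1.fderiv_right (m := 1) (by norm_cast)).differentiableAt (by simp)
  have h3 : IsSymmSndFDerivAt ℝ f p := h1.isSymmSndFDerivAt (by simp; norm_cast)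
  rw [fderiv_clm_apply h2 (differentiableAt_const _), fderiv_clm_apply h2 (differentiableAt_const _)]
  simpa using h3.eq w v

theorem delta_delta_comm (hU : IsOpen U) (hN : ∀ a μ, ContDiffOn ℝ ∞ (fun q => N q a μ) U)
    (hf : ContDiffOn ℝ ∞ f U) (hp : p ∈ U) (μ ν : Fin n) :
    delta N μ (delta N ν f) p - delta N ν (delta N μ f) p
      = ∑ a, nlCurv N p a μ ν * dy a f p := by
  -- By symmetry of second derivatives, everything in this expansion is symmetric in μ, ν except the
  -- last sum. That sum alone survives in the commutator and produces R^a_{μν}.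
  have key : ∀ μ ν, delta N μ (delta N ν f) p =
      dx μ (dx ν f) p - ∑ a, N p a μ * dx ν (dy a f) p - ∑ a, N p a ν * dx μ (dy a f) p
        + (∑ b, ∑ a, N p b μ * N p a ν * dy b (dy a f) p)
        - ∑ a, delta N μ (fun q => N q a ν) p * dy a f p := by
    intro μ ν
    have d1 : ∀ a, DifferentiableAt ℝ (fun q => N q a ν) p :=
      fun a => differentiableAt_of_smooth hU (hN a ν) hp
    have d2 : ∀ a, DifferentiableAt ℝ (dy a f) p :=
      fun a => differentiableAt_of_smooth hU (smooth_dy hU hf a) hp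
    have d3 : DifferentiableAt ℝ (dx ν f) p :=
      differentiableAt_of_smooth hU (smooth_dx hU hf ν) hp
    have e1 : delta N ν f = fun q => dx ν f q - ∑ a, N q a ν * dy a f q := rfl
    rw [e1, delta_sub d3 (DifferentiableAt.fun_sum fun a _ => (d1 a).fun_mul (d2 a)),
      delta_sum fun a => (d1 a).fun_mul (d2 a)]
    simp_rw [fun a => delta_mul (N := N) (d1 a) (d2 a) μ]
    have e2 : ∀ a, dy a (dx ν f) p = dx ν (dy a f) p := fun a => fderiv_fderiv_comm hU hf hp _ _
    rw [Finset.sum_add_distrib]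
    have e3 : ∑ a, N p a ν * delta N μ (dy a f) p
        = ∑ a, N p a ν * dx μ (dy a f) p - ∑ b, ∑ a, N p b μ * N p a ν * dy b (dy a f) p := by
      rw [Finset.sum_comm, ← Finset.sum_sub_distrib]
      refine Finset.sum_congr rfl fun a _ => ?_
      rw [delta, mul_sub, Finset.mul_sum]
      congr 1
      exact Finset.sum_congr rfl fun b _ => by ring
    rw [e3, delta]
    simp_rw [e2]
    ring
  rw [key, key]
  have e1 : dx μ (dx ν f) p = dx ν (dx μ f) p := fderiv_fderiv_comm hU hf hp _ _
  have e2 : ∑ b, ∑ a, N p b μ * N p a ν * dy b (dy a f) p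
      = ∑ b, ∑ a, N p b ν * N p a μ * dy b (dy a f) p := by
    rw [Finset.sum_comm]
    refine Finset.sum_congr rfl fun a _ => Finset.sum_congr rfl fun b _ => ?_
    have : dy b (dy a f) p = dy a (dy b f) p := fderiv_fderiv_comm hU hf hp _ _
    rw [this]
    ring
  rw [e1, e2]
  simp only [nlCurv, sub_mul, Finset.sum_sub_distrib]
  ring

end Calculus

/-! ### Cyclic reordering of iterated sums -/

section Sums

variable {n : ℕ}

theorem sum_rot3 (f : Fin n → Fin n → Fin n → ℝ) :
    ∑ a, ∑ b, ∑ c, f a b c = ∑ b, ∑ c, ∑ a, f a b c := by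
  rw [Finset.sum_comm]
  exact Finset.sum_congr rfl fun b _ => Finset.sum_comm

theorem sum_rot4 (f : Fin n → Fin n → Fin n → Fin n → ℝ) :
    ∑ a, ∑ b, ∑ c, ∑ d, f a b c d = ∑ b, ∑ c, ∑ d, ∑ a, f a b c d := by
  rw [Finset.sum_comm]
  exact Finset.sum_congr rfl fun b _ => sum_rot3 _

end Sums

/-! ### Divergence and cyclic identities for symmetric horizontal connections -/

section Current

variable {n : ℕ} {N : Phase n → Fin n → Fin n → ℝ} {U : Set (Phase n)} {p : Phase n}

theorem sum_mul_eq_zero_of_skew_of_symm {f s : Fin n → Fin n → ℝ}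
    (hf : ∀ μ ν, f μ ν = -f ν μ) (hs : ∀ μ ν, s μ ν = s ν μ) :
    ∑ μ, ∑ ν, f μ ν * s μ ν = 0 := by
  have h : ∑ μ, ∑ ν, f μ ν * s μ ν = -∑ μ, ∑ ν, f μ ν * s μ ν := by
    conv_lhs => rw [Finset.sum_comm]
    simp only [← Finset.sum_neg_distrib]
    refine Finset.sum_congr rfl fun μ _ => Finset.sum_congr rfl fun ν _ => ?_
    rw [hf ν μ, hs ν μ]
    ring
  linarith

theorem nlCurv_skew (a μ ν : Fin n) : nlCurv N p a μ ν = -nlCurv N p a ν μ := by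
  simp [nlCurv]

theorem hcovV_const (G : Phase n → Fin n → Fin n → Fin n → ℝ) (β α σ : Fin n) :
    hcovV N G (fun _ => Pi.single β 1) p α σ = G p α β σ := by
  simp [hcovV, delta_const, Pi.single_apply]

theorem vcovV_const (K : Phase n → Fin n → Fin n → Fin n → ℝ) (β α a : Fin n) :
    vcovV K (fun _ => Pi.single β 1) p α a = K p α β a := by
  simp [vcovV, dy_const, Pi.single_apply]

/-- The field δ_β has constant components, so its covariant derivatives are the connection
coefficients themselves. -/
theorem hCurv_eq (G K : Phase n → Fin n → Fin n → Fin n → ℝ) (α β μ ν : Fin n) :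
    hCurv N G K p α β μ ν =
      delta N μ (fun q => G q α β ν) p + ∑ ε, G p ε β ν * G p α ε μ
        - (delta N ν (fun q => G q α β μ) p + ∑ ε, G p ε β μ * G p α ε ν)
        - ∑ a, nlCurv N p a μ ν * K p α β a := by
  simp only [hCurv, vcovV_const, hcovV_const]
  rfl

/-- The divergence of a skew `(2,0)` tensor with respect to a `d`-connection that is symmetric in
its horizontal part. -/
theorem sum_hcov20_of_skew {G : Phase n → Fin n → Fin n → Fin n → ℝ}
    {f : Phase n → Fin n → Fin n → ℝ} (hG : ∀ α μ ν, G p α μ ν = G p α ν μ)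
    (hs : ∀ μ ν, f p μ ν = -f p ν μ) (μ : Fin n) :
    ∑ ν, hcov20 N G f p μ ν ν =
      ∑ ν, (delta N ν (fun q => f q μ ν) p + f p μ ν * ∑ α, G p α ν α) := by
  simp only [hcov20, Finset.sum_add_distrib]
  have h1 : ∑ ν, ∑ ε, f p ε ν * G p μ ε ν = 0 :=
    (Finset.sum_comm).trans (sum_mul_eq_zero_of_skew_of_symm hs fun a b => hG μ a b)
  rw [h1, add_zero]
  congr 1
  rw [Finset.sum_comm]
  simp only [Finset.mul_sum]

/-- Symmetry of G reduces both divergences to the trace T_ν = G^α_{να}. Skewness of f then turns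
δ_μδ_ν f^{μν} into half a commutator, and δ_μ T_ν into half a curl. That curl is the skew part of
the Ricci tensor up to R·K terms, and these are cancelled by the K terms of the vertical derivative
of f. Neither metricity nor any property of K enters. -/
theorem sum_hcovV_divergence (hU : IsOpen U) (hN : ∀ a μ, ContDiffOn ℝ ∞ (fun q => N q a μ) U)
    {G K : Phase n → Fin n → Fin n → Fin n → ℝ} {f : Phase n → Fin n → Fin n → ℝ}
    (hG : ∀ q ∈ U, ∀ α μ ν, G q α μ ν = G q α ν μ)
    (hGs : ∀ α μ ν, ContDiffOn ℝ ∞ (fun q => G q α μ ν) U)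
    (hs : ∀ q ∈ U, ∀ μ ν, f q μ ν = -f q ν μ)
    (hf : ∀ μ ν, ContDiffOn ℝ ∞ (fun q => f q μ ν) U) (hp : p ∈ U) :
    ∑ μ, hcovV N G (fun q μ => ∑ ν, hcov20 N G f q μ ν ν) p μ μ =
      (1 / 2) * ((∑ ε, ∑ μ, f p ε μ *
          (∑ α, hCurv N G K p α μ ε α - ∑ α, hCurv N G K p α ε μ α))
        + ∑ a, ∑ μ, ∑ ν, nlCurv N p a μ ν * vcov20 K f p μ ν a) := by
  set T : Phase n → Fin n → ℝ := fun q ν => ∑ α, G q α ν α with hT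
  have hTs : ∀ ν, ContDiffOn ℝ ∞ (fun q => T q ν) U := fun ν => smooth_sum fun α => hGs α ν α
  have dT : ∀ ν, DifferentiableAt ℝ (fun q => T q ν) p :=
    fun ν => differentiableAt_of_smooth hU (hTs ν) hp
  have df : ∀ μ ν, DifferentiableAt ℝ (fun q => f q μ ν) p :=
    fun μ ν => differentiableAt_of_smooth hU (hf μ ν) hp
  have ddf : ∀ μ ν σ, DifferentiableAt ℝ (delta N σ (fun q => f q μ ν)) p :=
    fun μ ν σ => differentiableAt_of_smooth hU (smooth_delta hU hN (hf μ ν) σ) hp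
  have dskew : ∀ μ ν σ, delta N σ (fun q => f q μ ν) p = -delta N σ (fun q => f q ν μ) p := by
    intro μ ν σ
    rw [delta_congr hU hp (g := fun q => (-1) * f q ν μ) (fun q hq => by rw [hs q hq]; ring),
      delta_const_mul (df ν μ)]
    ring
  have hL : ∑ μ, hcovV N G (fun q μ => ∑ ν, hcov20 N G f q μ ν ν) p μ μ =
      (1 / 2) * (∑ μ, ∑ ν, ∑ a, nlCurv N p a μ ν * dy a (fun q => f q μ ν) p)
        + (1 / 2) * ∑ μ, ∑ ν, f p μ ν * (delta N μ (fun q => T q ν) p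
            - delta N ν (fun q => T q μ) p) := by
    have e1 : ∀ μ, delta N μ (fun q => ∑ ν, hcov20 N G f q μ ν ν) p =
        ∑ ν, (delta N μ (delta N ν (fun q => f q μ ν)) p + (delta N μ (fun q => f q μ ν) p * T p ν
          + f p μ ν * delta N μ (fun q => T q ν) p)) := by
      intro μ
      rw [delta_congr hU hp (fun q hq => sum_hcov20_of_skew (hG q hq) (hs q hq) μ),
        delta_sum fun ν => (ddf μ ν ν).fun_add ((df μ ν).fun_mul (dT ν))]
      refine Finset.sum_congr rfl fun ν _ => ?_
      rw [delta_add (ddf μ ν ν) ((df μ ν).fun_mul (dT ν)), delta_mul (df μ ν) (dT ν)]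
    -- The contribution T_ε T_ν is symmetric and vanishes against f; what is left cancels the term
    -- δ_μ f^{μν} T_ν of the outer derivative.
    have e2 : ∑ μ, ∑ ε, (∑ ν, hcov20 N G f p ε ν ν) * G p μ ε μ
        = ∑ ε, ∑ ν, delta N ν (fun q => f q ε ν) p * T p ε := by
      rw [Finset.sum_comm]
      have : ∀ ε, ∑ μ, (∑ ν, hcov20 N G f p ε ν ν) * G p μ ε μ
          = ∑ ν, delta N ν (fun q => f q ε ν) p * T p ε + ∑ ν, f p ε ν * (T p ε * T p ν) := by
        intro ε
        rw [← Finset.mul_sum, ← Finset.sum_add_distrib, sum_hcov20_of_skew (hG p hp) (hs p hp),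
          Finset.sum_mul]
        exact Finset.sum_congr rfl fun ν _ => by simp only [hT]; ring
      simp only [this, Finset.sum_add_distrib]
      rw [sum_mul_eq_zero_of_skew_of_symm (hs p hp) (fun a b => mul_comm (T p a) (T p b)), add_zero]
    simp only [hcovV, e1, Finset.sum_add_distrib, e2]
    have e3 : ∑ ε, ∑ ν, delta N ν (fun q => f q ε ν) p * T p ε
        = -∑ μ, ∑ ν, delta N μ (fun q => f q μ ν) p * T p ν := by
      rw [Finset.sum_comm]
      simp only [← Finset.sum_neg_distrib]
      refine Finset.sum_congr rfl fun μ _ => Finset.sum_congr rfl fun ν _ => ?_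
      rw [dskew]; ring
    rw [e3]
    -- Exchanging the names of μ and ν and using skewness makes the sum minus the one with the
    -- derivatives in the opposite order, hence half of the commutator.
    have e4 : ∑ μ, ∑ ν, delta N μ (delta N ν (fun q => f q μ ν)) p
        = (1 / 2) * ∑ μ, ∑ ν, ∑ a, nlCurv N p a μ ν * dy a (fun q => f q μ ν) p := by
      have c1 : ∑ μ, ∑ ν, delta N μ (delta N ν (fun q => f q μ ν)) p
          = -∑ μ, ∑ ν, delta N ν (delta N μ (fun q => f q μ ν)) p := by
        rw [Finset.sum_comm]
        simp only [← Finset.sum_neg_distrib]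
        refine Finset.sum_congr rfl fun μ _ => Finset.sum_congr rfl fun ν _ => ?_
        rw [delta_congr hU hp (g := fun q => (-1) * delta N μ (fun q => f q μ ν) q),
          delta_const_mul (ddf μ ν μ)]
        · ring
        · intro q hq
          rw [delta_congr hU hq (g := fun q => (-1) * f q μ ν)
            (fun q hq => by rw [hs q hq]; ring),
            delta_const_mul (differentiableAt_of_smooth hU (hf μ ν) hq)]
      have c2 : ∑ μ, ∑ ν, ∑ a, nlCurv N p a μ ν * dy a (fun q => f q μ ν) p
          = ∑ μ, ∑ ν, delta N μ (delta N ν (fun q => f q μ ν)) p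
            - ∑ μ, ∑ ν, delta N ν (delta N μ (fun q => f q μ ν)) p := by
        simp only [← Finset.sum_sub_distrib]
        refine Finset.sum_congr rfl fun μ _ => Finset.sum_congr rfl fun ν _ => ?_
        exact (delta_delta_comm hU hN (hf μ ν) hp μ ν).symm
      linarith
    have e5 : ∑ μ, ∑ ν, f p μ ν * delta N μ (fun q => T q ν) p
        = (1 / 2) * ∑ μ, ∑ ν, f p μ ν * (delta N μ (fun q => T q ν) p
            - delta N ν (fun q => T q μ) p) := by
      have c1 : ∑ μ, ∑ ν, f p μ ν * delta N ν (fun q => T q μ) p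
          = -∑ μ, ∑ ν, f p μ ν * delta N μ (fun q => T q ν) p := by
        rw [Finset.sum_comm]
        simp only [← Finset.sum_neg_distrib]
        refine Finset.sum_congr rfl fun μ _ => Finset.sum_congr rfl fun ν _ => ?_
        rw [hs p hp]; ring
      simp only [mul_sub, Finset.sum_sub_distrib]
      linarith
    rw [e4, e5]
    ring
  -- With G symmetric, the terms quadratic in G and the divergence of G are symmetric in μ, ε. The
  -- skew part of the Ricci tensor is therefore the curl of the trace T, together with the
  -- contribution of the vertical bracket.
  have hR : ∀ μ ε, ∑ α, hCurv N G K p α μ ε α - ∑ α, hCurv N G K p α ε μ α =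
      (delta N ε (fun q => T q μ) p - delta N μ (fun q => T q ε) p)
        + (∑ α, ∑ a, nlCurv N p a μ α * K p α ε a - ∑ α, ∑ a, nlCurv N p a ε α * K p α μ a) := by
    have h1 : ∀ μ ε, ∑ α, hCurv N G K p α μ ε α = delta N ε (fun q => T q μ) p
        + ∑ α, ∑ β, G p β μ α * G p α β ε
        - (∑ α, delta N α (fun q => G q α μ ε) p + ∑ α, ∑ β, G p β μ ε * G p α β α)
        - ∑ α, ∑ a, nlCurv N p a ε α * K p α μ a := by
      intro μ ε
      have : delta N ε (fun q => T q μ) p = ∑ α, delta N ε (fun q => G q α μ α) p :=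
        delta_sum (fun α => differentiableAt_of_smooth hU (hGs α μ α) hp) ε
      rw [this]
      simp only [hCurv_eq, Finset.sum_sub_distrib, Finset.sum_add_distrib]
    intro μ ε
    rw [h1, h1]
    have h2 : ∑ α, ∑ β, G p β μ α * G p α β ε = ∑ α, ∑ β, G p β ε α * G p α β μ := by
      rw [Finset.sum_comm]
      refine Finset.sum_congr rfl fun α _ => Finset.sum_congr rfl fun β _ => ?_
      rw [hG p hp α μ β, hG p hp β α ε]; ring
    have h3 : ∑ α, ∑ β, G p β μ ε * G p α β α = ∑ α, ∑ β, G p β ε μ * G p α β α := by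
      simp only [fun β => hG p hp β μ ε]
    have h4 : ∑ α, delta N α (fun q => G q α μ ε) p = ∑ α, delta N α (fun q => G q α ε μ) p :=
      Finset.sum_congr rfl fun α _ => delta_congr hU hp fun q hq => hG q hq _ _ _
    rw [h2, h3, h4]
    ring
  -- The contraction of R with K that occurs both in the Ricci tensor and in the vertical derivative
  -- of f; the two occurrences cancel at the end.
  set X : Fin n → Fin n → ℝ := fun ε μ => ∑ α, ∑ a, nlCurv N p a α μ * K p α ε a with hX
  have hX' : ∀ ε μ, ∑ α, ∑ a, nlCurv N p a μ α * K p α ε a = -X ε μ := by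
    intro ε μ
    simp only [hX, ← Finset.sum_neg_distrib]
    exact Finset.sum_congr rfl fun α _ => Finset.sum_congr rfl fun a _ => by
      rw [nlCurv_skew a μ α, neg_mul]
  have hV : ∑ a, ∑ μ, ∑ ν, nlCurv N p a μ ν * vcov20 K f p μ ν a
      = ∑ μ, ∑ ν, ∑ a, nlCurv N p a μ ν * dy a (fun q => f q μ ν) p
        + 2 * ∑ ε, ∑ μ, f p ε μ * X ε μ := by
    have c0 : ∑ a, ∑ μ, ∑ ν, nlCurv N p a μ ν * vcov20 K f p μ ν a
        = ∑ μ, ∑ ν, ∑ a, nlCurv N p a μ ν * vcov20 K f p μ ν a := sum_rot3 _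
    have c1 : ∑ μ, ∑ ν, ∑ a, ∑ ε, nlCurv N p a μ ν * (f p ε ν * K p μ ε a)
        = ∑ ε, ∑ μ, f p ε μ * X ε μ := by
      rw [sum_rot4]
      refine (Finset.sum_congr rfl fun ν _ => (sum_rot3 _)).trans ?_
      rw [Finset.sum_comm]
      simp only [hX, Finset.mul_sum]
      refine Finset.sum_congr rfl fun ε _ => Finset.sum_congr rfl fun μ _ =>
        Finset.sum_congr rfl fun α _ => Finset.sum_congr rfl fun a _ => by ring
    have c2 : ∑ μ, ∑ ν, ∑ a, ∑ ε, nlCurv N p a μ ν * (f p μ ε * K p ν ε a)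
        = ∑ ε, ∑ μ, f p ε μ * X ε μ := by
      refine (Finset.sum_congr rfl fun ν _ => (sum_rot3 _).trans (sum_rot3 _)).trans ?_
      rw [Finset.sum_comm]
      simp only [hX, Finset.mul_sum]
      refine Finset.sum_congr rfl fun ε _ => Finset.sum_congr rfl fun μ _ =>
        Finset.sum_congr rfl fun α _ => Finset.sum_congr rfl fun a _ => ?_
      rw [hs p hp ε μ, nlCurv_skew a α μ]
      ring
    rw [c0, two_mul]
    simp only [vcov20, mul_add, Finset.sum_add_distrib, Finset.mul_sum]
    rw [c1, c2]
    ring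
  rw [hL, hV]
  simp only [hR, hX']
  have c3 : ∑ ε, ∑ μ, f p ε μ * (delta N ε (fun q => T q μ) p - delta N μ (fun q => T q ε) p
      + (-X ε μ - -X μ ε)) = ∑ ε, ∑ μ, f p ε μ * (delta N ε (fun q => T q μ) p
        - delta N μ (fun q => T q ε) p) - 2 * ∑ ε, ∑ μ, f p ε μ * X ε μ := by
    have c4 : ∑ ε, ∑ μ, f p ε μ * X μ ε = -∑ ε, ∑ μ, f p ε μ * X ε μ := by
      rw [Finset.sum_comm]
      simp only [← Finset.sum_neg_distrib]
      refine Finset.sum_congr rfl fun μ _ => Finset.sum_congr rfl fun ν _ => ?_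
      rw [hs p hp]; ring
    simp only [mul_add, mul_sub, Finset.sum_add_distrib, Finset.sum_sub_distrib, mul_neg,
      Finset.sum_neg_distrib, c4]
    ring
  rw [c3]
  ring

/-- The cyclic identity for the exterior derivative of a horizontal form. -/
theorem cyclic_hcov02_of_eq_exterior (hU : IsOpen U)
    (hN : ∀ a μ, ContDiffOn ℝ ∞ (fun q => N q a μ) U)
    {G : Phase n → Fin n → Fin n → Fin n → ℝ} (hG : ∀ α μ ν, G p α μ ν = G p α ν μ)
    {C : Phase n → Fin n → ℝ} (hC : ∀ μ, ContDiffOn ℝ ∞ (fun q => C q μ) U)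
    {F : Phase n → Fin n → Fin n → ℝ}
    (hF : ∀ q ∈ U, ∀ μ ν, F q μ ν
      = delta N ν (fun q => C q μ) q - delta N μ (fun q => C q ν) q) (hp : p ∈ U)
    (μ ν σ : Fin n) :
    hcov02 N G F p μ ν σ + hcov02 N G F p ν σ μ + hcov02 N G F p σ μ ν
      = -∑ a, (nlCurv N p a μ ν * dy a (fun q => C q σ) p
          + nlCurv N p a ν σ * dy a (fun q => C q μ) p
          + nlCurv N p a σ μ * dy a (fun q => C q ν) p) := by
  have hs : ∀ α β, F p α β = -F p β α := fun α β => by rw [hF p hp, hF p hp]; ring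
  have hd : ∀ μ ν, DifferentiableAt ℝ (delta N ν (fun q => C q μ)) p := fun μ ν =>
    differentiableAt_of_smooth hU (smooth_delta hU hN (hC μ) ν) hp
  have hδ : ∀ μ ν σ, delta N σ (fun q => F q μ ν) p =
      delta N σ (delta N ν (fun q => C q μ)) p - delta N σ (delta N μ (fun q => C q ν)) p := by
    intro μ ν σ
    rw [delta_congr hU hp (fun q hq => hF q hq μ ν), delta_sub (hd _ _) (hd _ _)]
  have k1 := delta_delta_comm hU hN (hC σ) hp μ ν
  have k2 := delta_delta_comm hU hN (hC μ) hp ν σ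
  have k3 := delta_delta_comm hU hN (hC ν) hp σ μ
  -- Skewness of F and symmetry of G make the six connection terms of the cyclic sum cancel in
  -- pairs; the second derivatives of C group into three commutators.
  have g : ∀ μ ν σ, ∑ ε, F p μ ε * G p ε ν σ = -∑ ε, F p ε μ * G p ε σ ν := by
    intro μ ν σ
    rw [← Finset.sum_neg_distrib]
    exact Finset.sum_congr rfl fun ε _ => by rw [hs, hG]; ring
  rw [Finset.sum_add_distrib, Finset.sum_add_distrib, ← k1, ← k2, ← k3]
  simp only [hcov02, hδ, g]
  ring

end Current

/-! ### Dual frames and smoothness of the inverse -/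

section Dual

variable {n : ℕ} {l : Fin n → Fin n → ℝ}

theorem isUnit_det_transpose (h : (Matrix.of l).det ≠ 0) :
    IsUnit (Matrix.of l).transpose.det := by
  rw [Matrix.det_transpose]
  exact isUnit_iff_ne_zero.mpr h

theorem sum_mul_dual_left (h : (Matrix.of l).det ≠ 0) (i j : Fin n) :
    ∑ α, l i α * dual l j α = if i = j then 1 else 0 := by
  have e := congr_fun (congr_fun (Matrix.nonsing_inv_mul _ (isUnit_det_transpose h)) j) i
  rw [Matrix.mul_apply, Matrix.one_apply] at e
  simp only [eq_comm (a := i)]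
  rw [← e]
  exact Finset.sum_congr rfl fun α _ => mul_comm _ _

theorem sum_mul_dual_right (h : (Matrix.of l).det ≠ 0) (α β : Fin n) :
    ∑ i, l i α * dual l i β = if α = β then 1 else 0 := by
  have e := congr_fun (congr_fun (Matrix.mul_nonsing_inv _ (isUnit_det_transpose h)) α) β
  rwa [Matrix.mul_apply, Matrix.one_apply] at e

theorem det_dual_ne_zero (h : (Matrix.of l).det ≠ 0) : (Matrix.of (dual l)).det ≠ 0 := by
  have e : Matrix.of (dual l) = (Matrix.of l).transpose⁻¹ := rfl
  rw [e, Matrix.det_nonsing_inv]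
  exact (IsUnit.ringInverse (isUnit_det_transpose h)).ne_zero

/-- `dual l` is characterised by the duality relations. -/
theorem eq_dual_of_sum_mul {m : Fin n → Fin n → ℝ}
    (h : ∀ i j, ∑ α, l i α * m j α = if i = j then 1 else 0) : m = dual l := by
  have e : (Matrix.of m) * (Matrix.of l).transpose = 1 := by
    ext j i
    rw [Matrix.mul_apply, Matrix.one_apply]
    simp only [eq_comm (a := j), ← h]
    exact Finset.sum_congr rfl fun α _ => mul_comm _ _
  have := Matrix.inv_eq_left_inv e
  funext i j
  rw [dual, this, Matrix.of_apply]

theorem dual_dual (h : (Matrix.of l).det ≠ 0) : dual (dual l) = l :=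
  (eq_dual_of_sum_mul fun i j => by
    simp only [eq_comm (a := i), ← sum_mul_dual_left h j i]
    exact Finset.sum_congr rfl fun α _ => mul_comm _ _).symm

theorem contDiffOn_det {E : Type*} [NormedAddCommGroup E] [NormedSpace ℝ E] {U : Set E}
    {A : E → Matrix (Fin n) (Fin n) ℝ} (hA : ∀ i j, ContDiffOn ℝ ∞ (fun q => A q i j) U) :
    ContDiffOn ℝ ∞ (fun q => (A q).det) U := by
  simp only [Matrix.det_apply]
  exact ContDiffOn.sum fun σ _ => (contDiffOn_prod fun i _ => hA _ _).const_smul _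

/-- By Cramer's rule each entry is a determinant of smooth entries divided by a determinant that
does not vanish. -/
theorem contDiffOn_dual {E : Type*} [NormedAddCommGroup E] [NormedSpace ℝ E] {U : Set E}
    {A : E → Fin n → Fin n → ℝ} (hA : ∀ i j, ContDiffOn ℝ ∞ (fun q => A q i j) U)
    (hd : ∀ q ∈ U, (Matrix.of (A q)).det ≠ 0) (i α : Fin n) :
    ContDiffOn ℝ ∞ (fun q => dual (A q) i α) U := by
  have e : ∀ q, dual (A q) i α = ((Matrix.of (A q)).det)⁻¹
      * ((Matrix.of (A q)).transpose.updateRow α (Pi.single i 1)).det := by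
    intro q
    rw [dual, Matrix.inv_def, Matrix.smul_apply, Matrix.det_transpose, Matrix.adjugate_apply]
    simp
  simp only [e]
  refine (contDiffOn_det (A := fun q => Matrix.of (A q)) hA).inv hd |>.mul (contDiffOn_det ?_)
  intro a b
  by_cases h : a = α
  · subst h
    simp only [Matrix.updateRow_self]
    exact contDiffOn_const
  · simp only [Matrix.updateRow_ne h]
    exact hA b a

end Dual

/-! ### Passing between coordinate and frame indices -/

section Contraction

variable {n : ℕ}

/-- The components `X_{ij} c_{iμ} c_{jν}`. -/
def lower2 (c X : Fin n → Fin n → ℝ) (μ ν : Fin n) : ℝ := ∑ i, ∑ j, X i j * (c i μ * c j ν)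

variable {l c : Fin n → Fin n → ℝ}

/-- This converts the contraction of a coordinate index into the contraction of a frame index. The
arrays `l` and `c` are kept general because frame and coframe are used in both roles. -/
theorem sum_pairing (h : ∀ i j, ∑ α, l i α * c j α = if i = j then 1 else 0)
    (x y : Fin n → ℝ) :
    ∑ α, (∑ i, x i * l i α) * (∑ j, y j * c j α) = ∑ i, x i * y i := by
  have e : ∀ α, (∑ i, x i * l i α) * (∑ j, y j * c j α)
      = ∑ i, ∑ j, x i * y j * (l i α * c j α) := by
    intro α
    rw [Finset.sum_mul_sum]
    exact Finset.sum_congr rfl fun i _ => Finset.sum_congr rfl fun j _ => by ring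
  simp only [e]
  rw [sum_rot3]
  simp [← Finset.mul_sum, h]

theorem sum_pairing_single (h : ∀ i j, ∑ α, l i α * c j α = if i = j then 1 else 0)
    (x : Fin n → ℝ) (j : Fin n) :
    ∑ α, (∑ i, x i * l i α) * c j α = x j := by
  have := sum_pairing h x (Pi.single j 1)
  simpa [Pi.single_apply] using this

theorem sum_expand (h : ∀ α β, ∑ i, l i α * c i β = if α = β then 1 else 0)
    (x : Fin n → ℝ) (β : Fin n) :
    ∑ i, (∑ α, l i α * x α) * c i β = x β := by
  simp only [Finset.sum_mul]
  rw [Finset.sum_comm]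
  have e : ∀ α, ∑ i, l i α * x α * c i β = x α * ∑ i, l i α * c i β := by
    intro α
    rw [Finset.mul_sum]
    exact Finset.sum_congr rfl fun i _ => by ring
  simp [e, h]

theorem lower2_expand (h : ∀ α β, ∑ i, l i α * c i β = if α = β then 1 else 0)
    (X : Fin n → Fin n → ℝ) (μ ν : Fin n) :
    lower2 c (fun i j => ∑ α, l i α * ∑ β, l j β * X α β) μ ν = X μ ν := by
  have e : lower2 c (fun i j => ∑ α, l i α * ∑ β, l j β * X α β) μ ν
      = ∑ j, (∑ i, (∑ α, l i α * ∑ β, l j β * X α β) * c i μ) * c j ν := by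
    rw [lower2, Finset.sum_comm]
    simp only [Finset.sum_mul]
    exact Finset.sum_congr rfl fun i _ => Finset.sum_congr rfl fun j _ =>
      Finset.sum_congr rfl fun k _ => by ring
  rw [e]
  simp only [sum_expand h]

theorem sum_mul_lower2 (x : Fin n → ℝ) (X : Fin n → Fin n → Fin n → ℝ) (μ ν : Fin n) :
    ∑ k, x k * lower2 c (X k) μ ν = lower2 c (fun i j => ∑ k, x k * X k i j) μ ν := by
  simp only [lower2, Finset.mul_sum, Finset.sum_mul]
  rw [sum_rot3]
  exact Finset.sum_congr rfl fun i _ => Finset.sum_congr rfl fun j _ =>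
      Finset.sum_congr rfl fun k _ => by ring

theorem lower2_swap (X : Fin n → Fin n → ℝ) (μ ν : Fin n) :
    lower2 c X ν μ = lower2 c (fun i j => X j i) μ ν := by
  rw [lower2, lower2, Finset.sum_comm]
  exact Finset.sum_congr rfl fun i _ => Finset.sum_congr rfl fun j _ => by ring

theorem lower2_add (X Y : Fin n → Fin n → ℝ) (μ ν : Fin n) :
    lower2 c (fun i j => X i j + Y i j) μ ν = lower2 c X μ ν + lower2 c Y μ ν := by
  simp only [lower2, add_mul, Finset.sum_add_distrib]

theorem lower2_sub (X Y : Fin n → Fin n → ℝ) (μ ν : Fin n) :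
    lower2 c (fun i j => X i j - Y i j) μ ν = lower2 c X μ ν - lower2 c Y μ ν := by
  simp only [lower2, sub_mul, Finset.sum_sub_distrib]

theorem lower2_const_mul (a : ℝ) (X : Fin n → Fin n → ℝ) (μ ν : Fin n) :
    lower2 c (fun i j => a * X i j) μ ν = a * lower2 c X μ ν := by
  simp only [lower2, mul_assoc, Finset.mul_sum]

theorem lower2_eq_iterated (X : Fin n → Fin n → ℝ) (μ ν : Fin n) :
    lower2 c X μ ν = ∑ i, (∑ j, X i j * c j ν) * c i μ := by
  simp only [lower2, Finset.sum_mul]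
  exact Finset.sum_congr rfl fun i _ => Finset.sum_congr rfl fun j _ => by ring

end Contraction

/-- The local data of an extended absolute parallelism space over an open set `U`. -/
structure LocalFrame {n : ℕ} (N lam : Phase n → Fin n → Fin n → ℝ) (U : Set (Phase n)) : Prop where
  isOpen : IsOpen U
  smooth_N : ∀ a μ, ContDiffOn ℝ ∞ (fun q => N q a μ) U
  smooth_lam : ∀ i α, ContDiffOn ℝ ∞ (fun q => lam q i α) U
  det_ne_zero : ∀ q ∈ U, (Matrix.of (lam q)).det ≠ 0

/-! ### Frame derivatives, flatness and the Bianchi identity -/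

section Frame

variable {n : ℕ} (N lam : Phase n → Fin n → Fin n → ℝ)

/-- `e_l f = λ_l^γ δ_γ f` -/
def frameDer (l : Fin n) (f : Phase n → ℝ) (p : Phase n) : ℝ := ∑ γ, lam p l γ * delta N γ f p

/-- `G_{kij} = λ_i^μ e_j λ_{kμ}`, frame components of the canonical connection -/
def frameGam (k i j : Fin n) (p : Phase n) : ℝ :=
  ∑ μ, lam p i μ * frameDer N lam j (fun q => colam lam q k μ) p

/-- `T_{kij} = G_{kij} - G_{kji}`, frame components of the torsion -/
def frameTor (k i j : Fin n) (p : Phase n) : ℝ := frameGam N lam k i j p - frameGam N lam k j i p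

/-- frame components of the basic form -/
def frameBasic (i : Fin n) (p : Phase n) : ℝ := ∑ k, frameTor N lam k i k p

/-- frame components of the contortion -/
def frameCon (i j k : Fin n) (p : Phase n) : ℝ :=
  (1 / 2) * (frameTor N lam i j k p + frameTor N lam k j i p + frameTor N lam j k i p)

/-- frame components of the vertical canonical coefficients -/
def frameCv (k i a : Fin n) (p : Phase n) : ℝ :=
  ∑ μ, lam p i μ * dy a (fun q => colam lam q k μ) p

/-- frame components of the curvature of the nonlinear connection -/
def frameCurv (a i j : Fin n) (p : Phase n) : ℝ :=
  ∑ μ, lam p i μ * ∑ ν, lam p j ν * nlCurv N p a μ ν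

variable {N lam} {U : Set (Phase n)} {p : Phase n}

theorem frameCurv_skew (a i j : Fin n) : frameCurv N lam a i j p = -frameCurv N lam a j i p := by
  simp only [frameCurv, Finset.mul_sum, ← Finset.sum_neg_distrib]
  rw [Finset.sum_comm]
  exact Finset.sum_congr rfl fun μ _ => Finset.sum_congr rfl fun ν _ => by
    rw [nlCurv_skew a ν μ]; ring

namespace LocalFrame

theorem diff_lam (h : LocalFrame N lam U) (hp : p ∈ U) (i α : Fin n) :
    DifferentiableAt ℝ (fun q => lam q i α) p :=
  differentiableAt_of_smooth h.isOpen (h.smooth_lam i α) hp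

theorem smooth_colam (h : LocalFrame N lam U) (i α : Fin n) :
    ContDiffOn ℝ ∞ (fun q => colam lam q i α) U :=
  contDiffOn_dual h.smooth_lam h.det_ne_zero i α

theorem diff_colam (h : LocalFrame N lam U) (hp : p ∈ U) (i α : Fin n) :
    DifferentiableAt ℝ (fun q => colam lam q i α) p :=
  differentiableAt_of_smooth h.isOpen (h.smooth_colam i α) hp

theorem lam_colam (h : LocalFrame N lam U) (hp : p ∈ U) (i j : Fin n) :
    ∑ α, lam p i α * colam lam p j α = if i = j then 1 else 0 :=
  sum_mul_dual_left (h.det_ne_zero p hp) i j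

theorem colam_lam (h : LocalFrame N lam U) (hp : p ∈ U) (i j : Fin n) :
    ∑ α, colam lam p i α * lam p j α = if i = j then 1 else 0 := by
  simp only [eq_comm (a := i), ← h.lam_colam hp j i]
  exact Finset.sum_congr rfl fun α _ => mul_comm _ _

theorem lam_colam' (h : LocalFrame N lam U) (hp : p ∈ U) (α β : Fin n) :
    ∑ i, lam p i α * colam lam p i β = if α = β then 1 else 0 :=
  sum_mul_dual_right (h.det_ne_zero p hp) α β

theorem colam_lam' (h : LocalFrame N lam U) (hp : p ∈ U) (α β : Fin n) :
    ∑ i, colam lam p i α * lam p i β = if α = β then 1 else 0 := by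
  simp only [eq_comm (a := α), ← h.lam_colam' hp β α]
  exact Finset.sum_congr rfl fun i _ => mul_comm _ _

theorem smooth_frameDer (h : LocalFrame N lam U) {f : Phase n → ℝ} (hf : ContDiffOn ℝ ∞ f U)
    (i : Fin n) : ContDiffOn ℝ ∞ (frameDer N lam i f) U :=
  smooth_sum fun γ => (h.smooth_lam i γ).mul (smooth_delta h.isOpen h.smooth_N hf γ)

theorem smooth_frameGam (h : LocalFrame N lam U) (k i j : Fin n) :
    ContDiffOn ℝ ∞ (frameGam N lam k i j) U :=
  smooth_sum fun μ => (h.smooth_lam i μ).mul (h.smooth_frameDer (h.smooth_colam k μ) j)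

theorem smooth_frameTor (h : LocalFrame N lam U) (k i j : Fin n) :
    ContDiffOn ℝ ∞ (frameTor N lam k i j) U :=
  (h.smooth_frameGam k i j).sub (h.smooth_frameGam k j i)

theorem smooth_frameBasic (h : LocalFrame N lam U) (i : Fin n) :
    ContDiffOn ℝ ∞ (frameBasic N lam i) U :=
  smooth_sum fun k => h.smooth_frameTor k i k

theorem smooth_frameCon (h : LocalFrame N lam U) (i j k : Fin n) :
    ContDiffOn ℝ ∞ (frameCon N lam i j k) U :=
  contDiffOn_const.mul
    (((h.smooth_frameTor i j k).add (h.smooth_frameTor k j i)).add (h.smooth_frameTor j k i))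

theorem diffAt (h : LocalFrame N lam U) (hp : p ∈ U) {f : Phase n → ℝ}
    (hf : ContDiffOn ℝ ∞ f U) : DifferentiableAt ℝ f p :=
  differentiableAt_of_smooth h.isOpen hf hp

end LocalFrame

variable {f g : Phase n → ℝ}

theorem frameDer_eq_fderiv (i : Fin n) :
    frameDer N lam i f p = fderiv ℝ f p (∑ γ, lam p i γ • deltaVec N γ p) := by
  simp only [frameDer, delta_eq_fderiv, map_sum, map_smul, smul_eq_mul]

theorem frameDer_sub (hf : DifferentiableAt ℝ f p) (hg : DifferentiableAt ℝ g p) (i : Fin n) :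
    frameDer N lam i (fun q => f q - g q) p = frameDer N lam i f p - frameDer N lam i g p := by
  simp only [frameDer_eq_fderiv, fderiv_fun_sub hf hg, _root_.sub_apply]

theorem frameDer_mul (hf : DifferentiableAt ℝ f p) (hg : DifferentiableAt ℝ g p) (i : Fin n) :
    frameDer N lam i (fun q => f q * g q) p
      = frameDer N lam i f p * g p + f p * frameDer N lam i g p := by
  simp only [frameDer_eq_fderiv, fderiv_fun_mul hf hg, _root_.add_apply,
    _root_.smul_apply, smul_eq_mul]
  ring

theorem frameDer_sum {ι : Type*} {s : Finset ι} {f : ι → Phase n → ℝ}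
    (hf : ∀ i, DifferentiableAt ℝ (f i) p) (i : Fin n) :
    frameDer N lam i (fun q => ∑ j ∈ s, f j q) p = ∑ j ∈ s, frameDer N lam i (f j) p := by
  simp only [frameDer_eq_fderiv, fderiv_fun_sum fun j _ => hf j, _root_.sum_apply]

theorem frameDer_congr (hU : IsOpen U) (hp : p ∈ U) (h : ∀ q ∈ U, f q = g q) (i : Fin n) :
    frameDer N lam i f p = frameDer N lam i g p :=
  Finset.sum_congr rfl fun γ _ => by rw [delta_congr hU hp h]

theorem frameDer_const (i : Fin n) (c : ℝ) : frameDer N lam i (fun _ => c) p = 0 := by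
  simp [frameDer, delta_const]

namespace LocalFrame

theorem delta_eq (h : LocalFrame N lam U) (hp : p ∈ U) (ν : Fin n) :
    delta N ν f p = ∑ j, frameDer N lam j f p * colam lam p j ν :=
  (sum_expand (h.lam_colam' hp) (fun γ => delta N γ f p) ν).symm

theorem frameDer_colam (h : LocalFrame N lam U) (hp : p ∈ U) (j k μ : Fin n) :
    frameDer N lam j (fun q => colam lam q k μ) p
      = ∑ i, frameGam N lam k i j p * colam lam p i μ :=
  (sum_expand (h.lam_colam' hp) (fun μ => frameDer N lam j (fun q => colam lam q k μ) p) μ).symm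

theorem frameDer_lam (h : LocalFrame N lam U) (hp : p ∈ U) (j k μ : Fin n) :
    frameDer N lam j (fun q => lam q k μ) p = -∑ i, frameGam N lam i k j p * lam p i μ := by
  have e : ∀ i, ∑ α, colam lam p i α * frameDer N lam j (fun q => lam q k α) p
      = -frameGam N lam i k j p := by
    intro i
    -- Differentiating the duality relation λ_{iα} λ_k^α = δ_{ik} expresses the derivative of the
    -- frame through that of the coframe.
    have h0 : frameDer N lam j (fun q => ∑ α, colam lam q i α * lam q k α) p = 0 := by
      rw [frameDer_congr h.isOpen hp fun q hq => h.colam_lam hq i k, frameDer_const]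
    rw [frameDer_sum fun α => (h.diff_colam hp i α).fun_mul (h.diff_lam hp k α)] at h0
    simp only [fun α => frameDer_mul (N := N) (lam := lam) (h.diff_colam hp i α)
      (h.diff_lam hp k α) j, Finset.sum_add_distrib] at h0
    have h1 : ∑ α, frameDer N lam j (fun q => colam lam q i α) p * lam p k α
        = frameGam N lam i k j p := Finset.sum_congr rfl fun α _ => mul_comm _ _
    linarith
  rw [← sum_expand (h.colam_lam' hp) (fun μ => frameDer N lam j (fun q => lam q k μ) p) μ]
  simp only [e, neg_mul, Finset.sum_neg_distrib]

theorem delta_colam (h : LocalFrame N lam U) (hp : p ∈ U) (k μ ν : Fin n) :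
    delta N ν (fun q => colam lam q k μ) p
      = lower2 (colam lam p) (fun i j => frameGam N lam k i j p) μ ν := by
  rw [h.delta_eq hp]
  simp only [h.frameDer_colam hp, lower2, Finset.sum_mul]
  rw [Finset.sum_comm]
  exact Finset.sum_congr rfl fun i _ => Finset.sum_congr rfl fun j _ => by ring

theorem dy_colam (h : LocalFrame N lam U) (hp : p ∈ U) (a k μ : Fin n) :
    dy a (fun q => colam lam q k μ) p = ∑ i, frameCv lam k i a p * colam lam p i μ :=
  (sum_expand (h.lam_colam' hp) (fun μ => dy a (fun q => colam lam q k μ) p) μ).symm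

theorem nlCurv_eq (h : LocalFrame N lam U) (hp : p ∈ U) (a μ ν : Fin n) :
    nlCurv N p a μ ν = lower2 (colam lam p) (fun i j => frameCurv N lam a i j p) μ ν :=
  (lower2_expand (h.lam_colam' hp) (fun μ ν => nlCurv N p a μ ν) μ ν).symm

/-- The horizontal part of [e_l, e_j] comes from differentiating the coefficients λ_j^ν, λ_l^ν and
is the torsion because the frame is parallel; the vertical part comes from [δ_μ, δ_ν]. -/
theorem frameDer_comm (h : LocalFrame N lam U) (hp : p ∈ U) (hf : ContDiffOn ℝ ∞ f U)
    (l j : Fin n) :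
    frameDer N lam l (frameDer N lam j f) p - frameDer N lam j (frameDer N lam l f) p
      = ∑ m, frameTor N lam m l j p * frameDer N lam m f p
        + ∑ a, frameCurv N lam a l j p * dy a f p := by
  have key : ∀ l j, frameDer N lam l (frameDer N lam j f) p =
      -(∑ m, frameGam N lam m j l p * frameDer N lam m f p)
        + ∑ μ, ∑ ν, lam p l μ * lam p j ν * delta N μ (delta N ν f) p := by
    intro l j
    have d1 : ∀ ν, DifferentiableAt ℝ (delta N ν f) p := fun ν =>
      h.diffAt hp (smooth_delta h.isOpen h.smooth_N hf ν)
    have e1 : frameDer N lam j f = fun q => ∑ ν, lam q j ν * delta N ν f q := rfl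
    rw [e1, frameDer_sum fun ν => (h.diff_lam hp j ν).fun_mul (d1 ν)]
    simp only [fun ν => frameDer_mul (N := N) (lam := lam) (h.diff_lam hp j ν) (d1 ν) l,
      Finset.sum_add_distrib, h.frameDer_lam hp]
    congr 1
    · simp only [frameDer, Finset.mul_sum, ← Finset.sum_neg_distrib, Finset.sum_mul]
      rw [Finset.sum_comm]
      exact Finset.sum_congr rfl fun i _ => Finset.sum_congr rfl fun j _ => by ring
    · simp only [frameDer, Finset.mul_sum]
      rw [Finset.sum_comm]
      exact Finset.sum_congr rfl fun i _ => Finset.sum_congr rfl fun j _ => by ring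
  rw [key, key]
  have e2 : ∑ μ, ∑ ν, lam p j μ * lam p l ν * delta N μ (delta N ν f) p
      = ∑ μ, ∑ ν, lam p l μ * lam p j ν * delta N ν (delta N μ f) p := by
    rw [Finset.sum_comm]
    exact Finset.sum_congr rfl fun i _ => Finset.sum_congr rfl fun j _ => by ring
  have e3 : ∑ μ, ∑ ν, lam p l μ * lam p j ν * delta N μ (delta N ν f) p
      - ∑ μ, ∑ ν, lam p l μ * lam p j ν * delta N ν (delta N μ f) p
      = ∑ a, frameCurv N lam a l j p * dy a f p := by
    simp only [← Finset.sum_sub_distrib, ← mul_sub, delta_delta_comm h.isOpen h.smooth_N hf hp,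
      frameCurv, Finset.mul_sum, Finset.sum_mul]
    rw [← sum_rot3]
    exact Finset.sum_congr rfl fun i _ => Finset.sum_congr rfl fun j _ =>
      Finset.sum_congr rfl fun k _ => by ring
  rw [e2]
  simp only [frameTor, sub_mul, Finset.sum_sub_distrib]
  linarith

/-- Flatness of the canonical connection. -/
theorem frameDer_frameGam (h : LocalFrame N lam U) (hp : p ∈ U) (k i l j : Fin n) :
    frameDer N lam l (frameGam N lam k i j) p - frameDer N lam j (frameGam N lam k i l) p
      = ∑ m, (-(frameGam N lam m i l p * frameGam N lam k m j p)
          + frameGam N lam m i j p * frameGam N lam k m l p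
          + frameTor N lam m l j p * frameGam N lam k i m p)
        + ∑ a, frameCurv N lam a l j p * frameCv lam k i a p := by
  have key : ∀ l j, frameDer N lam l (frameGam N lam k i j) p =
      -(∑ m, frameGam N lam m i l p * frameGam N lam k m j p)
        + ∑ μ, lam p i μ
          * frameDer N lam l (frameDer N lam j (fun q => colam lam q k μ)) p := by
    intro l j
    have d1 : ∀ μ, DifferentiableAt ℝ (frameDer N lam j (fun q => colam lam q k μ)) p := fun μ =>
      h.diffAt hp (h.smooth_frameDer (h.smooth_colam k μ) j)
    have e1 : frameGam N lam k i j
      = fun q => ∑ μ, lam q i μ * frameDer N lam j (fun q => colam lam q k μ) q := rfl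
    rw [e1, frameDer_sum fun μ => (h.diff_lam hp i μ).fun_mul (d1 μ)]
    simp only [fun μ => frameDer_mul (N := N) (lam := lam) (h.diff_lam hp i μ) (d1 μ) l,
      Finset.sum_add_distrib, h.frameDer_lam hp]
    congr 1
    simp only [h.frameDer_colam hp, neg_mul, Finset.sum_neg_distrib,
      sum_pairing (h.lam_colam hp)]
  rw [key, key]
  -- Flatness is the commutator of frame derivatives applied to the functions λ_{kμ}. Its vertical
  -- part differentiates the coframe along y and thereby introduces the vertical canonical
  -- coefficients.
  have e2 : ∑ μ, lam p i μ * frameDer N lam l (frameDer N lam j (fun q => colam lam q k μ)) p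
      - ∑ μ, lam p i μ * frameDer N lam j (frameDer N lam l (fun q => colam lam q k μ)) p
      = ∑ m, frameTor N lam m l j p * frameGam N lam k i m p
        + ∑ a, frameCurv N lam a l j p * frameCv lam k i a p := by
    simp only [← Finset.sum_sub_distrib, ← mul_sub, h.frameDer_comm hp (h.smooth_colam k _),
      mul_add, Finset.sum_add_distrib, frameGam, frameCv, Finset.mul_sum]
    congr 1
    · rw [Finset.sum_comm]
      exact Finset.sum_congr rfl fun i _ => Finset.sum_congr rfl fun j _ => by ring
    · rw [Finset.sum_comm]
      exact Finset.sum_congr rfl fun i _ => Finset.sum_congr rfl fun j _ => by ring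
  simp only [Finset.sum_add_distrib, Finset.sum_neg_distrib]
  linarith

/-- The contracted first Bianchi identity of the canonical connection, in the frame. -/
theorem sum_frameDer_frameTor (h : LocalFrame N lam U) (hp : p ∈ U) (i j : Fin n) :
    ∑ l, frameDer N lam l (frameTor N lam l i j) p
      = frameDer N lam j (frameBasic N lam i) p - frameDer N lam i (frameBasic N lam j) p
        + ∑ m, frameBasic N lam m p * frameTor N lam m i j p
        - ∑ l, ∑ a, (frameCv lam l j a p * frameCurv N lam a l i p
            + frameCv lam l l a p * frameCurv N lam a i j p
            + frameCv lam l i a p * frameCurv N lam a j l p) := by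
  have dG : ∀ k i j, DifferentiableAt ℝ (frameGam N lam k i j) p := fun k i j =>
    h.diffAt hp (h.smooth_frameGam k i j)
  have dT : ∀ k i j, DifferentiableAt ℝ (frameTor N lam k i j) p := fun k i j =>
    h.diffAt hp (h.smooth_frameTor k i j)
  have eT : ∀ l k i j, frameDer N lam l (frameTor N lam k i j) p
      = frameDer N lam l (frameGam N lam k i j) p - frameDer N lam l (frameGam N lam k j i) p :=
    fun l k i j => frameDer_sub (dG k i j) (dG k j i) l
  have eC : ∀ l i, frameDer N lam l (frameBasic N lam i) p
      = ∑ k, frameDer N lam l (frameTor N lam k i k) p :=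
    fun l i => frameDer_sum (fun k => dT k i k) l
  -- In the combination f1 - f2 - f3, summed over l, the derivatives of G assemble into e_l T_{lij}
  -- - e_j C_i + e_i C_j.
  have f1 := fun l => h.frameDer_frameGam hp l i l j
  have f2 := fun l => h.frameDer_frameGam hp l j l i
  have f3 := fun l => h.frameDer_frameGam hp l l i j
  have hq : ∑ l, ∑ m, (((-(frameGam N lam m i l p * frameGam N lam l m j p)
          + frameGam N lam m i j p * frameGam N lam l m l p
          + frameTor N lam m l j p * frameGam N lam l i m p)
        - (-(frameGam N lam m j l p * frameGam N lam l m i p)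
          + frameGam N lam m j i p * frameGam N lam l m l p
          + frameTor N lam m l i p * frameGam N lam l j m p)
        - (-(frameGam N lam m l i p * frameGam N lam l m j p)
          + frameGam N lam m l j p * frameGam N lam l m i p
          + frameTor N lam m i j p * frameGam N lam l l m p))
        - frameTor N lam l m l p * frameTor N lam m i j p) = 0 := by
    -- Once T is expanded in G, the summand equals E l m - E m l, so the double sum vanishes on
    -- exchanging l and m.
    set E : Fin n → Fin n → ℝ := fun l m =>
      frameGam N lam m l j p * frameGam N lam l i m p
        + frameGam N lam m i l p * frameGam N lam l j m p
        - frameGam N lam l j m p * frameGam N lam m l i p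
        + frameGam N lam m l i p * frameGam N lam l m j p with hE
    have e0 : ∑ l, ∑ m, (E l m - E m l) = 0 := by
      simp only [Finset.sum_sub_distrib]
      rw [Finset.sum_comm]
      exact sub_self _
    rw [← e0]
    refine Finset.sum_congr rfl fun l _ => Finset.sum_congr rfl fun m _ => ?_
    simp only [hE, frameTor]
    ring
  have hb : ∑ m, frameBasic N lam m p * frameTor N lam m i j p
      = ∑ l, ∑ m, frameTor N lam l m l p * frameTor N lam m i j p := by
    simp only [frameBasic, Finset.sum_mul]
    exact Finset.sum_comm
  have hsum := Finset.sum_congr (rfl : (Finset.univ : Finset (Fin n)) = Finset.univ)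
    fun l _ => congr_arg₂ (· - ·) (congr_arg₂ (· - ·) (f1 l) (f2 l)) (f3 l)
  have hw : ∑ l, ∑ a, (frameCv lam l j a p * frameCurv N lam a l i p
            + frameCv lam l l a p * frameCurv N lam a i j p
            + frameCv lam l i a p * frameCurv N lam a j l p)
      = -∑ l, (∑ a, frameCurv N lam a l j p * frameCv lam l i a p
          - ∑ a, frameCurv N lam a l i p * frameCv lam l j a p
          - ∑ a, frameCurv N lam a i j p * frameCv lam l l a p) := by
    simp only [← Finset.sum_sub_distrib, ← Finset.sum_neg_distrib]
    refine Finset.sum_congr rfl fun l _ => Finset.sum_congr rfl fun a _ => ?_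
    rw [frameCurv_skew a j l]; ring
  rw [hb, hw]
  simp only [eC, eT]
  simp only [Finset.sum_sub_distrib, Finset.sum_add_distrib, Finset.sum_neg_distrib] at hsum hq ⊢
  linarith

end LocalFrame

end Frame

/-! ### Frame components of the tensors in the electromagnetic field -/

section Coordinates

variable {n : ℕ} {N lam : Phase n → Fin n → Fin n → ℝ} {U : Set (Phase n)} {p : Phase n}

namespace LocalFrame

theorem Gam_eq (h : LocalFrame N lam U) (hp : p ∈ U) (α μ ν : Fin n) :
    Gam N lam p α μ ν
      = ∑ k, lower2 (colam lam p) (fun i j => frameGam N lam k i j p) μ ν * lam p k α :=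
  Finset.sum_congr rfl fun k _ => by rw [h.delta_colam hp, mul_comm]

theorem Tor_eq (h : LocalFrame N lam U) (hp : p ∈ U) (α μ ν : Fin n) :
    Tor N lam p α μ ν
      = ∑ k, lower2 (colam lam p) (fun i j => frameTor N lam k i j p) μ ν * lam p k α := by
  simp only [Tor, h.Gam_eq hp, frameTor, lower2_sub, ← Finset.sum_sub_distrib, ← sub_mul]
  simp only [lower2_swap _ ν μ]

theorem basic_eq (h : LocalFrame N lam U) (hp : p ∈ U) (μ : Fin n) :
    basic N lam p μ = ∑ i, frameBasic N lam i p * colam lam p i μ := by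
  have e : ∀ k, ∑ α, lower2 (colam lam p) (fun i j => frameTor N lam k i j p) μ α * lam p k α
      = ∑ i, frameTor N lam k i k p * colam lam p i μ := by
    intro k
    have e1 : ∀ α, lower2 (colam lam p) (fun i j => frameTor N lam k i j p) μ α
        = ∑ j, (∑ i, frameTor N lam k i j p * colam lam p i μ) * colam lam p j α := by
      intro α
      rw [lower2_swap, lower2_eq_iterated]
    simp only [e1]
    exact sum_pairing_single (h.colam_lam hp) _ k
  simp only [basic, h.Tor_eq hp]
  rw [Finset.sum_comm]
  simp only [e, frameBasic, Finset.sum_mul]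
  exact Finset.sum_comm

theorem gLow_mul_gUp (h : LocalFrame N lam U) (hp : p ∈ U) (α β : Fin n) :
    ∑ ε, gLow lam p α ε * gUp lam p ε β = if α = β then 1 else 0 := by
  rw [← h.colam_lam' hp α β]
  simp only [gLow, gUp]
  have e : ∀ ε, (∑ i, colam lam p i α * colam lam p i ε) * (∑ i, lam p i ε * lam p i β)
    = (∑ i, colam lam p i α * colam lam p i ε) * (∑ i, lam p i β * lam p i ε) := fun ε => by
    simp only [fun i => mul_comm (lam p i ε)]
  simp only [e]
  exact sum_pairing (h.colam_lam hp) _ _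

theorem sum_gLow_mul (h : LocalFrame N lam U) (hp : p ∈ U) (y : Fin n → ℝ) (α : Fin n) :
    ∑ ε, gLow lam p α ε * ∑ k, y k * lam p k ε = ∑ k, y k * colam lam p k α := by
  simp only [gLow]
  rw [sum_pairing (h.colam_lam hp)]
  exact Finset.sum_congr rfl fun k _ => mul_comm _ _

theorem sum_gUp_mul (h : LocalFrame N lam U) (hp : p ∈ U) (y : Fin n → ℝ) (α : Fin n) :
    ∑ ε, gUp lam p α ε * ∑ k, y k * colam lam p k ε = ∑ k, y k * lam p k α := by
  simp only [gUp]
  rw [sum_pairing (h.lam_colam hp)]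
  exact Finset.sum_congr rfl fun k _ => mul_comm _ _

theorem TorLow_eq (h : LocalFrame N lam U) (hp : p ∈ U) (α μ ν : Fin n) :
    TorLow N lam p α μ ν
      = ∑ k, lower2 (colam lam p) (fun i j => frameTor N lam k i j p) μ ν * colam lam p k α := by
  simp only [TorLow, h.Tor_eq hp, h.sum_gLow_mul hp]

theorem smooth_gLow (h : LocalFrame N lam U) (μ ν : Fin n) :
    ContDiffOn ℝ ∞ (fun q => gLow lam q μ ν) U :=
  smooth_sum fun i => (h.smooth_colam i μ).mul (h.smooth_colam i ν)

theorem smooth_gUp (h : LocalFrame N lam U) (μ ν : Fin n) :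
    ContDiffOn ℝ ∞ (fun q => gUp lam q μ ν) U :=
  smooth_sum fun i => (h.smooth_lam i μ).mul (h.smooth_lam i ν)

theorem gLow_comm (q : Phase n) (μ ν : Fin n) : gLow lam q μ ν = gLow lam q ν μ :=
  Finset.sum_congr rfl fun _ _ => mul_comm _ _

theorem GamO_comm (q : Phase n) (α μ ν : Fin n) : GamO N lam q α μ ν = GamO N lam q α ν μ := by
  have e : (fun r => gLow lam r μ ν) = fun r => gLow lam r ν μ :=
    funext fun r => gLow_comm r μ ν
  simp only [GamO]
  congr 1
  refine Finset.sum_congr rfl fun ε _ => ?_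
  rw [e]
  ring

theorem smooth_GamO (h : LocalFrame N lam U) (α μ ν : Fin n) :
    ContDiffOn ℝ ∞ (fun q => GamO N lam q α μ ν) U :=
  contDiffOn_const.mul <| smooth_sum fun ε => (h.smooth_gUp α ε).mul
    (((smooth_delta h.isOpen h.smooth_N (h.smooth_gLow ε ν) μ).add
      (smooth_delta h.isOpen h.smooth_N (h.smooth_gLow ε μ) ν)).sub
      (smooth_delta h.isOpen h.smooth_N (h.smooth_gLow μ ν) ε))

/-- The contortion in terms of the torsion. -/
theorem conLow_eq_TorLow (h : LocalFrame N lam U) (hp : p ∈ U) (α μ ν : Fin n) :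
    conLow N lam p α μ ν
      = (1 / 2) * (TorLow N lam p α μ ν + TorLow N lam p ν α μ * (-1) + TorLow N lam p μ ν α) := by
  -- This is Γ_{αμν}. The canonical connection is metric, so δ_σ g_{μν} is a sum of two of its
  -- values, and the Christoffel formula becomes linear in A.
  set A : Fin n → Fin n → Fin n → ℝ := fun α μ ν =>
    ∑ k, colam lam p k α * delta N ν (fun q => colam lam q k μ) p with hA
  have e1 : ∀ α μ ν, ∑ ε, gLow lam p α ε * Gam N lam p ε μ ν = A α μ ν := by
    intro α μ ν
    simp only [Gam, fun k x => mul_comm (lam p k x), h.sum_gLow_mul hp]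
    exact Finset.sum_congr rfl fun k _ => mul_comm _ _
  have e2 : ∀ α μ ν, TorLow N lam p α μ ν = A α μ ν - A α ν μ := by
    intro α μ ν
    simp only [TorLow, Tor, mul_sub, Finset.sum_sub_distrib, e1]
  have e3 : ∀ σ μ ν, delta N σ (fun q => gLow lam q μ ν) p = A μ ν σ + A ν μ σ := by
    intro σ μ ν
    simp only [gLow]
    rw [delta_sum fun i => (h.diff_colam hp i μ).fun_mul (h.diff_colam hp i ν)]
    simp only [fun i => delta_mul (N := N) (h.diff_colam hp i μ) (h.diff_colam hp i ν) σ, hA,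
      ← Finset.sum_add_distrib]
    exact Finset.sum_congr rfl fun k _ => by ring
  have e4 : ∑ ε, gLow lam p α ε * GamO N lam p ε μ ν
      = (1 / 2) * (A α ν μ + A ν α μ + (A α μ ν + A μ α ν) - (A μ ν α + A ν μ α)) := by
    simp only [GamO, e3]
    set B : Fin n → ℝ := fun β =>
      A β ν μ + A ν β μ + (A β μ ν + A μ β ν) - (A μ ν β + A ν μ β) with hB
    have : ∀ ε, gLow lam p α ε * ((1 / 2) * ∑ β, gUp lam p ε β * B β)
        = (1 / 2) * ∑ β, gLow lam p α ε * gUp lam p ε β * B β := by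
      intro ε
      rw [Finset.mul_sum, Finset.mul_sum, Finset.mul_sum]
      exact Finset.sum_congr rfl fun β _ => by ring
    change ∑ ε, gLow lam p α ε * ((1 / 2) * ∑ β, gUp lam p ε β * B β) = _
    simp only [this]
    rw [← Finset.mul_sum, Finset.sum_comm]
    simp only [← Finset.sum_mul, h.gLow_mul_gUp hp]
    simp [hB]
  simp only [conLow, con, mul_sub, Finset.sum_sub_distrib, e1, e2, e4]
  ring

/-- The third index is kept outside `lower2` because it is the one raised in γ_{μν}^α and later
contracted with C_α, with N^α or with a derivative. -/
theorem conLow_eq (h : LocalFrame N lam U) (hp : p ∈ U) (α μ ν : Fin n) :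
    conLow N lam p α μ ν
      = ∑ k, lower2 (colam lam p) (fun i j => frameCon N lam i j k p) α μ * colam lam p k ν := by
  rw [h.conLow_eq_TorLow hp, h.TorLow_eq hp, h.TorLow_eq hp, h.TorLow_eq hp]
  have hs : ∀ k i j, frameTor N lam k i j p = -frameTor N lam k j i p := by
    intro k i j
    simp only [frameTor]; ring
  set c := colam lam p
  have e1 : ∑ k, lower2 c (fun i j => frameTor N lam k i j p) μ ν * c k α
      = ∑ k, ∑ i, ∑ j, frameTor N lam i j k p * (c i α * c j μ * c k ν) := by
    simp only [lower2, Finset.sum_mul]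
    rw [← sum_rot3]
    exact Finset.sum_congr rfl fun i _ => Finset.sum_congr rfl fun j _ =>
      Finset.sum_congr rfl fun k _ => by ring
  have e2 : ∑ k, lower2 c (fun i j => frameTor N lam k i j p) α μ * c k ν
      = ∑ k, ∑ i, ∑ j, frameTor N lam k i j p * (c i α * c j μ * c k ν) := by
    simp only [lower2, Finset.sum_mul]
    exact Finset.sum_congr rfl fun i _ => Finset.sum_congr rfl fun j _ =>
      Finset.sum_congr rfl fun k _ => by ring
  have e3 : ∑ k, lower2 c (fun i j => frameTor N lam k i j p) ν α * c k μ
      = ∑ k, ∑ i, ∑ j, frameTor N lam j k i p * (c i α * c j μ * c k ν) := by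
    simp only [lower2, Finset.sum_mul]
    rw [sum_rot3]
    exact Finset.sum_congr rfl fun i _ => Finset.sum_congr rfl fun j _ =>
      Finset.sum_congr rfl fun k _ => by ring
  rw [e1, e2, e3]
  simp only [lower2, frameCon, Finset.sum_mul, Finset.mul_sum, ← Finset.sum_add_distrib]
  refine Finset.sum_congr rfl fun i _ => Finset.sum_congr rfl fun j _ =>
      Finset.sum_congr rfl fun k _ => ?_
  rw [hs i k j]
  ring

theorem conUp_eq (h : LocalFrame N lam U) (hp : p ∈ U) (α μ ν : Fin n) :
    conUp N lam p α μ ν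
      = ∑ k, lower2 (colam lam p) (fun i j => frameCon N lam i j k p) μ ν * lam p k α := by
  simp only [conUp, h.conLow_eq hp, h.sum_gUp_mul hp]

theorem gammaTwo_eq (h : LocalFrame N lam U) (hp : p ∈ U) (μ ν : Fin n) :
    gammaTwo N lam p μ ν
      = lower2 (colam lam p) (fun i j => ∑ k, frameBasic N lam k p * frameCon N lam i j k p) μ ν := by
  simp only [gammaTwo, h.basic_eq hp, h.conUp_eq hp]
  rw [sum_pairing (h.colam_lam hp)]
  exact sum_mul_lower2 _ _ _ _

theorem eta_eq (h : LocalFrame N lam U) (hp : p ∈ U) (μ ν : Fin n) :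
    eta N lam p μ ν
      = lower2 (colam lam p) (fun i j => ∑ k, frameBasic N lam k p * frameTor N lam k i j p) μ ν := by
  simp only [eta, h.basic_eq hp, h.Tor_eq hp]
  rw [sum_pairing (h.colam_lam hp)]
  exact sum_mul_lower2 _ _ _ _

/-- The canonical connection is compatible with the coframe. -/
theorem delta_colam_eq (h : LocalFrame N lam U) (hp : p ∈ U) (k μ σ : Fin n) :
    delta N σ (fun q => colam lam q k μ) p = ∑ ε, colam lam p k ε * Gam N lam p ε μ σ := by
  simp only [Gam, fun i x => mul_comm (lam p i x), fun i ε x => mul_comm (colam lam p i ε) x]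
  exact (sum_pairing_single (h.lam_colam hp)
    (fun i => delta N σ (fun q => colam lam q i μ) p) k).symm

/-- The canonical connection is compatible with the frame. -/
theorem delta_lam_eq (h : LocalFrame N lam U) (hp : p ∈ U) (k α σ : Fin n) :
    delta N σ (fun q => lam q k α) p = -∑ ε, lam p k ε * Gam N lam p α ε σ := by
  rw [h.delta_eq hp]
  simp only [h.frameDer_lam hp, h.Gam_eq hp]
  have e : ∀ ε, lam p k ε * ∑ i, lower2 (colam lam p) (fun i_1 j => frameGam N lam i i_1 j p) ε σ
        * lam p i α
      = (∑ m, (∑ i, (∑ j, frameGam N lam i m j p * colam lam p j σ) * lam p i α)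
          * colam lam p m ε) * lam p k ε := by
    intro ε
    rw [mul_comm]
    congr 1
    simp only [lower2_eq_iterated, Finset.sum_mul]
    rw [Finset.sum_comm]
    exact Finset.sum_congr rfl fun i _ => Finset.sum_congr rfl fun j _ =>
      Finset.sum_congr rfl fun k _ => by ring
  simp only [e]
  rw [sum_pairing_single (h.colam_lam hp)]
  simp only [neg_mul, Finset.sum_neg_distrib, Finset.sum_mul]
  rw [Finset.sum_comm]
  congr 1
  exact Finset.sum_congr rfl fun i _ => Finset.sum_congr rfl fun j _ => by ring

theorem diff_lower2 (h : LocalFrame N lam U) (hp : p ∈ U) {X : Fin n → Fin n → Phase n → ℝ}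
    (hX : ∀ i j, DifferentiableAt ℝ (X i j) p) (μ ν : Fin n) :
    DifferentiableAt ℝ (fun q => lower2 (colam lam q) (fun i j => X i j q) μ ν) p :=
  DifferentiableAt.fun_sum fun i _ => DifferentiableAt.fun_sum fun j _ =>
    (hX i j).fun_mul ((h.diff_colam hp i μ).fun_mul (h.diff_colam hp j ν))

/-- The coframe is parallel for the canonical connection: by `delta_colam_eq` the two coefficient
terms cancel the derivatives of the coframe, and only the scalar components are differentiated. -/
theorem hcov02_lower2 (h : LocalFrame N lam U) (hp : p ∈ U) {X : Fin n → Fin n → Phase n → ℝ}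
    (hX : ∀ i j, DifferentiableAt ℝ (X i j) p) (μ ν σ : Fin n) :
    hcov02 N (Gam N lam) (fun q => lower2 (colam lam q) (fun i j => X i j q)) p μ ν σ
      = lower2 (colam lam p) (fun i j => delta N σ (X i j) p) μ ν := by
  have d := fun i μ => h.diff_colam hp i μ
  simp only [hcov02, lower2]
  rw [delta_sum fun i => DifferentiableAt.fun_sum fun j _ =>
    (hX i j).fun_mul ((d i μ).fun_mul (d j ν))]
  simp only [fun i => delta_sum (N := N) (s := Finset.univ) (fun j =>
    (hX i j).fun_mul ((d i μ).fun_mul (d j ν))) σ,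
    fun i j => delta_mul (N := N) (hX i j) ((d i μ).fun_mul (d j ν)) σ,
    fun i j => delta_mul (N := N) (d i μ) (d j ν) σ, h.delta_colam_eq hp,
    mul_add, Finset.sum_add_distrib]
  have e1 : ∑ ε, (∑ i, ∑ j, X i j p * (colam lam p i ε * colam lam p j ν)) * Gam N lam p ε μ σ
      = ∑ i, ∑ j, X i j p * ((∑ ε, colam lam p i ε * Gam N lam p ε μ σ) * colam lam p j ν) := by
    simp only [Finset.sum_mul, Finset.mul_sum]
    rw [sum_rot3]
    exact Finset.sum_congr rfl fun i _ => Finset.sum_congr rfl fun j _ =>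
      Finset.sum_congr rfl fun k _ => by ring
  have e2 : ∑ ε, (∑ i, ∑ j, X i j p * (colam lam p i μ * colam lam p j ε)) * Gam N lam p ε ν σ
      = ∑ i, ∑ j, X i j p * (colam lam p i μ * ∑ ε, colam lam p j ε * Gam N lam p ε ν σ) := by
    simp only [Finset.sum_mul, Finset.mul_sum]
    rw [sum_rot3]
    exact Finset.sum_congr rfl fun i _ => Finset.sum_congr rfl fun j _ =>
      Finset.sum_congr rfl fun k _ => by ring
  rw [e1, e2]
  ring

/-- Parallelism of the frame removes the upper index from the covariant derivative, which leaves the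
case of two lower indices. -/
theorem hcov12_frame (h : LocalFrame N lam U) (hp : p ∈ U)
    {Y : Fin n → Phase n → Fin n → Fin n → ℝ}
    (hY : ∀ k μ ν, DifferentiableAt ℝ (fun q => Y k q μ ν) p) (α μ ν σ : Fin n) :
    hcov12 N (Gam N lam) (fun q α μ ν => ∑ k, Y k q μ ν * lam q k α) p α μ ν σ
      = ∑ k, hcov02 N (Gam N lam) (Y k) p μ ν σ * lam p k α := by
  have d := fun k α => h.diff_lam hp k α
  simp only [hcov12, hcov02]
  rw [delta_sum fun k => (hY k μ ν).fun_mul (d k α)]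
  simp only [fun k => delta_mul (N := N) (hY k μ ν) (d k α) σ, h.delta_lam_eq hp,
    Finset.sum_add_distrib, sub_mul, Finset.sum_sub_distrib, mul_neg, Finset.sum_neg_distrib]
  have e1 : ∑ ε, (∑ k, Y k p μ ν * lam p k ε) * Gam N lam p α ε σ
      = ∑ k, Y k p μ ν * ∑ ε, lam p k ε * Gam N lam p α ε σ := by
    simp only [Finset.sum_mul, Finset.mul_sum]
    rw [Finset.sum_comm]
    exact Finset.sum_congr rfl fun i _ => Finset.sum_congr rfl fun j _ => by ring
  have e2 : ∑ ε, (∑ k, Y k p ε ν * lam p k α) * Gam N lam p ε μ σ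
      = ∑ k, (∑ ε, Y k p ε ν * Gam N lam p ε μ σ) * lam p k α := by
    simp only [Finset.sum_mul]
    rw [Finset.sum_comm]
    exact Finset.sum_congr rfl fun i _ => Finset.sum_congr rfl fun j _ => by ring
  have e3 : ∑ ε, (∑ k, Y k p μ ε * lam p k α) * Gam N lam p ε ν σ
      = ∑ k, (∑ ε, Y k p μ ε * Gam N lam p ε ν σ) * lam p k α := by
    simp only [Finset.sum_mul]
    rw [Finset.sum_comm]
    exact Finset.sum_congr rfl fun i _ => Finset.sum_congr rfl fun j _ => by ring
  rw [e1, e2, e3]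
  ring

theorem hcov12_congr (hU : IsOpen U) (hp : p ∈ U) {G T S : Phase n → Fin n → Fin n → Fin n → ℝ}
    (hTS : ∀ q ∈ U, ∀ α μ ν, T q α μ ν = S q α μ ν) (α μ ν σ : Fin n) :
    hcov12 N G T p α μ ν σ = hcov12 N G S p α μ ν σ := by
  rw [hcov12, hcov12, delta_congr hU hp fun q hq => hTS q hq α μ ν]
  simp only [hTS p hp]

/-- Contracting the upper index, carried by λ_k^α, with the index of differentiation turns δ_α into
the frame derivative e_k. -/
theorem xi_eq (h : LocalFrame N lam U) (hp : p ∈ U) (μ ν : Fin n) :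
    xi N lam p μ ν = lower2 (colam lam p)
      (fun i j => ∑ k, frameDer N lam k (frameCon N lam i j k) p) μ ν := by
  have d : ∀ i j k, DifferentiableAt ℝ (frameCon N lam i j k) p := fun i j k =>
    h.diffAt hp (h.smooth_frameCon i j k)
  have e : ∀ α, hcov12 N (Gam N lam) (conUp N lam) p α μ ν α
      = ∑ k, lam p k α
        * lower2 (colam lam p) (fun i j => delta N α (frameCon N lam i j k) p) μ ν := by
    intro α
    rw [hcov12_congr h.isOpen hp fun q hq => h.conUp_eq hq,
      h.hcov12_frame hp (Y := fun k q => lower2 (colam lam q) fun i j => frameCon N lam i j k q)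
        fun k μ ν => h.diff_lower2 hp (fun i j => d i j k) μ ν]
    refine Finset.sum_congr rfl fun k _ => ?_
    rw [h.hcov02_lower2 hp fun i j => d i j k, mul_comm]
  simp only [xi, e]
  rw [Finset.sum_comm]
  simp only [sum_mul_lower2]
  simp only [lower2, Finset.sum_mul, frameDer]
  rw [sum_rot3]

/-- The exterior derivative of the basic form. -/
theorem exterior_basic_eq (h : LocalFrame N lam U) (hp : p ∈ U) (μ ν : Fin n) :
    delta N ν (fun q => basic N lam q μ) p - delta N μ (fun q => basic N lam q ν) p
      = lower2 (colam lam p) (fun i j => frameDer N lam j (frameBasic N lam i) p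
          - frameDer N lam i (frameBasic N lam j) p
          + ∑ k, frameBasic N lam k p * frameTor N lam k i j p) μ ν := by
  have key : ∀ μ ν, delta N ν (fun q => basic N lam q μ) p
      = lower2 (colam lam p) (fun i j => frameDer N lam j (frameBasic N lam i) p) μ ν
        + lower2 (colam lam p)
          (fun i j => ∑ k, frameBasic N lam k p * frameGam N lam k i j p) μ ν := by
    intro μ ν
    have d : ∀ i, DifferentiableAt ℝ (frameBasic N lam i) p := fun i =>
      h.diffAt hp (h.smooth_frameBasic i)
    rw [delta_congr h.isOpen hp fun q hq => h.basic_eq hq μ,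
      delta_sum fun i => (d i).fun_mul (h.diff_colam hp i μ)]
    simp only [fun i => delta_mul (N := N) (d i) (h.diff_colam hp i μ) ν, Finset.sum_add_distrib]
    congr 1
    · simp only [lower2_eq_iterated, h.delta_eq hp (f := frameBasic N lam _)]
    · simp only [h.delta_colam hp, sum_mul_lower2]
  rw [key μ ν, key ν μ, lower2_add, lower2_sub]
  simp only [lower2_swap _ μ ν, frameTor, mul_sub, Finset.sum_sub_distrib, lower2_sub]
  ring

theorem smooth_basic (h : LocalFrame N lam U) (μ : Fin n) :
    ContDiffOn ℝ ∞ (fun q => basic N lam q μ) U :=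
  (smooth_sum fun i => (h.smooth_frameBasic i).mul (h.smooth_colam i μ)).congr
    fun _ hq => h.basic_eq hq μ

theorem Cv_eq (h : LocalFrame N lam U) (hp : p ∈ U) (α μ a : Fin n) :
    Cv lam p α μ a = ∑ k, (∑ i, frameCv lam k i a p * colam lam p i μ) * lam p k α :=
  Finset.sum_congr rfl fun k _ => by rw [h.dy_colam hp, mul_comm]

theorem cycCR_eq (h : LocalFrame N lam U) (hp : p ∈ U) (μ ν : Fin n) :
    cycCR N lam p μ ν = lower2 (colam lam p) (fun i j =>
      ∑ l, ∑ a, (frameCv lam l j a p * frameCurv N lam a l i p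
            + frameCv lam l l a p * frameCurv N lam a i j p
            + frameCv lam l i a p * frameCurv N lam a j l p)) μ ν := by
  set c := colam lam p with hc
  have e1 : ∀ a μ ν, ∑ ε, Cv lam p ε ν a * nlCurv N p a ε μ
      = lower2 c (fun i j => ∑ l, frameCv lam l j a p * frameCurv N lam a l i p) μ ν := by
    intro a μ ν
    simp only [h.Cv_eq hp, h.nlCurv_eq hp, lower2_eq_iterated, ← hc]
    rw [sum_pairing (h.lam_colam hp)]
    simp only [Finset.sum_mul, Finset.mul_sum]
    rw [sum_rot3]
    exact Finset.sum_congr rfl fun i _ => Finset.sum_congr rfl fun j _ =>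
      Finset.sum_congr rfl fun k _ => by ring
  have e2 : ∀ a, ∑ ε, Cv lam p ε ε a = ∑ l, frameCv lam l l a p := by
    intro a
    simp only [h.Cv_eq hp, ← hc]
    rw [Finset.sum_comm]
    refine Finset.sum_congr rfl fun k _ => ?_
    exact sum_pairing_single (h.colam_lam hp) (fun i => frameCv lam k i a p) k
  have e3 : ∀ a, ∑ ε, Cv lam p ε μ a * nlCurv N p a ν ε
      = lower2 c (fun i j => ∑ l, frameCv lam l i a p * frameCurv N lam a j l p) μ ν := by
    intro a
    have e4 : ∀ i j, ∑ l, frameCv lam l i a p * frameCurv N lam a j l p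
        = (-1) * ∑ l, frameCv lam l i a p * frameCurv N lam a l j p := by
      intro i j
      rw [Finset.mul_sum]
      exact Finset.sum_congr rfl fun l _ => by rw [frameCurv_skew a j l]; ring
    simp only [e4]
    rw [lower2_const_mul, ← lower2_swap (c := c)
      (fun j i => ∑ l, frameCv lam l i a p * frameCurv N lam a l j p), ← e1 a ν μ, Finset.mul_sum]
    exact Finset.sum_congr rfl fun l _ => by rw [nlCurv_skew a ν l]; ring
  have e5 : cycCR N lam p μ ν = ∑ a, (∑ ε, Cv lam p ε ν a * nlCurv N p a ε μ
      + (∑ ε, Cv lam p ε ε a) * nlCurv N p a μ ν + ∑ ε, Cv lam p ε μ a * nlCurv N p a ν ε) := by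
    rw [cycCR, Finset.sum_comm]
    simp only [Finset.sum_add_distrib, Finset.sum_mul]
  rw [e5]
  simp only [e1, e2, e3]
  simp only [h.nlCurv_eq hp, ← hc]
  have e6 : ∀ i j, ∑ l, ∑ a, (frameCv lam l j a p * frameCurv N lam a l i p
            + frameCv lam l l a p * frameCurv N lam a i j p
            + frameCv lam l i a p * frameCurv N lam a j l p)
      = ∑ a, 1 * (∑ l, frameCv lam l j a p * frameCurv N lam a l i p
          + (∑ l, frameCv lam l l a p) * frameCurv N lam a i j p
          + ∑ l, frameCv lam l i a p * frameCurv N lam a j l p) := by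
    intro i j
    rw [Finset.sum_comm]
    simp only [Finset.sum_add_distrib, Finset.sum_mul, one_mul]
  simp only [e6]
  rw [← sum_mul_lower2]
  simp only [lower2_add, lower2_const_mul, one_mul]

end LocalFrame

end Coordinates

/-! ### Derivative of the determinant -/

section Jacobi

variable {n : ℕ}

/-- The determinant as a continuous multilinear map of the rows. -/
def detRows (n : ℕ) : ContinuousMultilinearMap ℝ (fun _ : Fin n => Fin n → ℝ) ℝ where
  toMultilinearMap := (Matrix.detRowAlternating (n := Fin n) (R := ℝ)).toMultilinearMap
  cont := by
    change Continuous fun M : Fin n → Fin n → ℝ => (Matrix.of M).det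
    exact Continuous.matrix_det (continuous_id)

/-- Jacobi's formula, when the derivatives of the rows are expanded in the rows. -/
theorem fderiv_det_of_rows {E : Type*} [NormedAddCommGroup E] [NormedSpace ℝ E]
    {A : E → Fin n → Fin n → ℝ} {p : E} (hA : ∀ i j, DifferentiableAt ℝ (fun q => A q i j) p)
    {v : E} {a : Fin n → Fin n → ℝ}
    (ha : ∀ i j, fderiv ℝ (fun q => A q i j) p v = ∑ k, a i k * A p k j) :
    fderiv ℝ (fun q => (Matrix.of (A q)).det) p v = (Matrix.of (A p)).det * ∑ i, a i i := by
  have hA' : HasFDerivAt A (ContinuousLinearMap.pi fun i => ContinuousLinearMap.pi fun j =>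
      fderiv ℝ (fun q => A q i j) p) p :=
    hasFDerivAt_pi.mpr fun i => hasFDerivAt_pi.mpr fun j => (hA i j).hasFDerivAt
  have h := ((detRows n).hasFDerivAt (A p)).comp p hA'
  have e : (fun q => (Matrix.of (A q)).det) = (detRows n) ∘ A := rfl
  rw [e, h.fderiv]
  rw [ContinuousLinearMap.comp_apply, ContinuousMultilinearMap.linearDeriv_apply, Finset.mul_sum]
  refine Finset.sum_congr rfl fun i _ => ?_
  have e2 : (ContinuousLinearMap.pi fun i => ContinuousLinearMap.pi fun j =>
      fderiv ℝ (fun q => A q i j) p) v i = ∑ k, a i k • (Matrix.of (A p)) k := by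
    funext j
    simp [ha, Finset.sum_apply]
  rw [e2]
  have e3 := Matrix.det_updateRow_sum (Matrix.of (A p)) i (a i)
  rw [smul_eq_mul, mul_comm] at e3
  rw [← e3]
  rfl

end Jacobi

/-! ### The Lagrangian as a quadratic form in the torsion -/

section Jets

variable {n : ℕ}

/-- `D_{kμν} = λ_{kμ,ν} - N^a_ν λ_{kμ;a}` -/
def jetDelta (m : Fin n → Fin n → ℝ) (u v : Fin n → Fin n → Fin n → ℝ) (k μ ν : Fin n) : ℝ :=
  u k μ ν - ∑ a, m a ν * v k μ a

/-- `d_a^μ d_b^ν (D_{kμν} - D_{kνμ})` -/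
def jetTor (d : Fin n → Fin n → ℝ) (D : Fin n → Fin n → Fin n → ℝ) (k a b : Fin n) : ℝ :=
  ∑ μ, d a μ * ∑ ν, d b ν * (D k μ ν - D k ν μ)

/-- The trace `T_{kak}` -/
def trTor (T : Fin n → Fin n → Fin n → ℝ) (a : Fin n) : ℝ := ∑ k, T k a k

/-- The quadratic form `T_{kla} T_{lka} - c_a c_a` -/
def quadTor (T : Fin n → Fin n → Fin n → ℝ) : ℝ :=
  ∑ a, (∑ l, ∑ k, T k l a * T l k a - trTor T a * trTor T a)

/-- Half the polar form of `quadTor`. -/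
def polarTor (T S : Fin n → Fin n → Fin n → ℝ) : ℝ :=
  ∑ a, (∑ l, ∑ k, T l k a * S k l a - trTor T a * trTor S a)

/-- `2 (T_{ajb} - T_{bja} - c_a δ_{jb} + c_b δ_{ja})` -/
def momentum (T : Fin n → Fin n → Fin n → ℝ) (j a b : Fin n) : ℝ :=
  2 * (T a j b - T b j a - trTor T a * (if j = b then 1 else 0)
    + trTor T b * (if j = a then 1 else 0))

theorem quadTor_add (T S : Fin n → Fin n → Fin n → ℝ) (t : ℝ) :
    quadTor (fun k a b => T k a b + t * S k a b)
      = quadTor T + t * (2 * polarTor T S) + t ^ 2 * quadTor S := by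
  have e1 : ∀ a, trTor (fun k a b => T k a b + t * S k a b) a = trTor T a + t * trTor S a := by
    intro a
    simp only [trTor, Finset.sum_add_distrib, Finset.mul_sum]
  have e2 : ∀ a, ∑ l, ∑ k, (T k l a + t * S k l a) * (T l k a + t * S l k a)
      = ∑ l, ∑ k, T k l a * T l k a + t * (2 * ∑ l, ∑ k, T l k a * S k l a)
        + t ^ 2 * ∑ l, ∑ k, S k l a * S l k a := by
    intro a
    have e3 : 2 * ∑ l, ∑ k, T l k a * S k l a
        = ∑ l, ∑ k, T l k a * S k l a + ∑ l, ∑ k, T k l a * S l k a := by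
      rw [two_mul]
      congr 1
      exact Finset.sum_comm
    rw [e3]
    simp only [Finset.mul_sum, mul_add, ← Finset.sum_add_distrib]
    exact Finset.sum_congr rfl fun l _ => Finset.sum_congr rfl fun k _ => by ring
  simp only [quadTor, polarTor, e1, e2]
  rw [Finset.mul_sum, Finset.mul_sum, Finset.mul_sum, ← Finset.sum_add_distrib,
    ← Finset.sum_add_distrib]
  exact Finset.sum_congr rfl fun a _ => by ring

/-- This justifies the definition of `momentum`: it is the gradient of `quadTor` when T is varied by
the antisymmetrisation of an arbitrary array Q. -/
theorem two_mul_polarTor (T Q : Fin n → Fin n → Fin n → ℝ) :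
    2 * polarTor T (fun k a b => Q k a b - Q k b a) = ∑ k, ∑ a, ∑ b, momentum T k a b * Q k a b := by
  have e1 : ∑ k, ∑ a, ∑ b, momentum T k a b * Q k a b
      = 2 * (∑ k, ∑ a, ∑ b, T a k b * Q k a b - ∑ k, ∑ a, ∑ b, T b k a * Q k a b
        - ∑ k, ∑ a, trTor T a * Q k a k + ∑ k, ∑ b, trTor T b * Q k k b) := by
    have e2 : ∀ k a, ∑ b, trTor T a * (if k = b then 1 else 0) * Q k a b = trTor T a * Q k a k := by
      intro k a
      simp [Finset.sum_ite_eq]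
    have e3 : ∀ k, ∑ a, ∑ b, trTor T b * (if k = a then 1 else 0) * Q k a b
        = ∑ b, trTor T b * Q k k b := by
      intro k
      rw [Finset.sum_comm]
      simp [Finset.sum_ite_eq]
    simp only [← e2, ← e3, momentum, Finset.mul_sum, ← Finset.sum_add_distrib,
      ← Finset.sum_sub_distrib]
    exact Finset.sum_congr rfl fun k _ => Finset.sum_congr rfl fun a _ =>
      Finset.sum_congr rfl fun b _ => by ring
  have e4 : ∑ a, ∑ l, ∑ k, T l k a * (Q k l a - Q k a l)
      = ∑ k, ∑ a, ∑ b, T a k b * Q k a b - ∑ k, ∑ a, ∑ b, T b k a * Q k a b := by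
    simp only [mul_sub, Finset.sum_sub_distrib]
    congr 1
    · rw [sum_rot3, Finset.sum_comm]
    · rw [sum_rot3, sum_rot3]
  have e5 : ∑ a, trTor T a * trTor (fun k a b => Q k a b - Q k b a) a
      = ∑ k, ∑ a, trTor T a * Q k a k - ∑ k, ∑ b, trTor T b * Q k k b := by
    have e6 : ∀ a, trTor (fun k a b => Q k a b - Q k b a) a = ∑ k, Q k a k - ∑ k, Q k k a :=
      fun a => Finset.sum_sub_distrib _ _
    simp only [e6, Finset.sum_sub_distrib, mul_sub, Finset.mul_sum]
    congr 1 <;> exact Finset.sum_comm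
  rw [e1, polarTor, Finset.sum_sub_distrib, e4, e5]
  ring

/-- Written with coordinate indices, so that the coefficient of W is the derivative of the quadratic
form with respect to D_{kμν}. -/
theorem polarTor_jetTor (T : Fin n → Fin n → Fin n → ℝ) (d : Fin n → Fin n → ℝ)
    (W : Fin n → Fin n → Fin n → ℝ) :
    2 * polarTor T (jetTor d W)
      = ∑ k, ∑ μ, ∑ ν, W k μ ν * ∑ a, ∑ b, momentum T k a b * (d a μ * d b ν) := by
  have e1 : jetTor d W = fun k a b => (∑ μ, ∑ ν, W k μ ν * (d a μ * d b ν))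
      - ∑ μ, ∑ ν, W k μ ν * (d b μ * d a ν) := by
    funext k a b
    have e2 : ∑ μ, ∑ ν, W k μ ν * (d b μ * d a ν) = ∑ μ, ∑ ν, W k ν μ * (d b ν * d a μ) :=
      Finset.sum_comm
    rw [e2]
    simp only [jetTor, Finset.mul_sum, ← Finset.sum_sub_distrib]
    exact Finset.sum_congr rfl fun μ _ => Finset.sum_congr rfl fun ν _ => by ring
  rw [e1, two_mul_polarTor T fun k a b => ∑ μ, ∑ ν, W k μ ν * (d a μ * d b ν)]
  refine Finset.sum_congr rfl fun k _ => ?_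
  simp only [Finset.mul_sum]
  rw [sum_rot4, sum_rot4]
  exact Finset.sum_congr rfl fun i _ => Finset.sum_congr rfl fun j _ =>
    Finset.sum_congr rfl fun a _ => Finset.sum_congr rfl fun b _ => by ring

/-- The Lagrangian in terms of the frame components of the torsion. -/
theorem lagrangian_eq {m l : Fin n → Fin n → ℝ} (h : (Matrix.of l).det ≠ 0)
    (u v : Fin n → Fin n → Fin n → ℝ) :
    lagrangian m l u v = (Matrix.of l).det * quadTor (jetTor (dual l) (jetDelta m u v)) := by
  set d := dual l with hd
  set T := jetTor d (jetDelta m u v) with hT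
  have h1 : ∀ i j, ∑ α, d i α * l j α = if i = j then 1 else 0 := by
    intro i j
    simp only [eq_comm (a := i), ← sum_mul_dual_left h j i]
    exact Finset.sum_congr rfl fun α _ => mul_comm _ _
  have h2 : ∀ i j, ∑ α, l i α * d j α = if i = j then 1 else 0 := sum_mul_dual_left h
  have h3 : ∀ α β, ∑ i, d i α * l i β = if α = β then 1 else 0 := by
    intro α β
    simp only [eq_comm (a := α), ← sum_mul_dual_right h β α]
    exact Finset.sum_congr rfl fun i _ => mul_comm _ _
  have tor : ∀ α μ ν, torJet m l u v α μ ν = ∑ k, lower2 l (T k) μ ν * d k α := by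
    intro α μ ν
    refine Finset.sum_congr rfl fun k _ => ?_
    rw [mul_comm]
    congr 1
    exact (lower2_expand h3 (fun μ ν => jetDelta m u v k μ ν - jetDelta m u v k ν μ) μ ν).symm
  have c1 : ∀ α ε i, ∑ μ, torJet m l u v α ε μ * d i μ
      = ∑ e, (∑ k, T k e i * d k α) * l e ε := by
    intro α ε i
    have e1 : ∀ μ, torJet m l u v α ε μ
        = ∑ b, (∑ k, (∑ e, T k e b * l e ε) * d k α) * l b μ := by
      intro μ
      simp only [tor, lower2_swap _ μ ε, lower2_eq_iterated, Finset.sum_mul]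
      rw [Finset.sum_comm]
      exact Finset.sum_congr rfl fun b _ => Finset.sum_congr rfl fun k _ =>
        Finset.sum_congr rfl fun e _ => by ring
    simp only [e1]
    rw [sum_pairing_single h2]
    simp only [Finset.sum_mul]
    rw [Finset.sum_comm]
    exact Finset.sum_congr rfl fun b _ => Finset.sum_congr rfl fun k _ => by ring
  have c2 : ∀ μ, ∑ α, torJet m l u v α μ α = ∑ b, trTor T b * l b μ := by
    intro μ
    have e0 : ∀ α k, lower2 l (T k) μ α = ∑ b, (∑ i, T k i b * l i μ) * l b α := by
      intro α k
      rw [lower2_swap, lower2_eq_iterated]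
    simp only [tor, e0]
    rw [Finset.sum_comm]
    have e1 : ∀ k, ∑ α, (∑ b, (∑ i, T k i b * l i μ) * l b α) * d k α = ∑ i, T k i k * l i μ :=
      fun k => sum_pairing_single h2 _ k
    refine (Finset.sum_congr rfl fun k _ => e1 k).trans ?_
    simp only [trTor, Finset.sum_mul]
    exact Finset.sum_comm
  have c3 : ∀ i, ∑ μ, (∑ α, torJet m l u v α μ α) * d i μ = trTor T i := by
    intro i
    simp only [c2]
    exact sum_pairing_single h2 _ _
  have c4 : ∀ i, ∑ α, ∑ ε, (∑ μ, torJet m l u v α ε μ * d i μ)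
        * (∑ ν, torJet m l u v ε α ν * d i ν) = ∑ e, ∑ k, T k e i * T e k i := by
    intro i
    have e1 : ∀ α ε, ∑ ν, torJet m l u v ε α ν * d i ν
        = ∑ k, (∑ f, T k f i * l f α) * d k ε := by
      intro α ε
      rw [c1]
      simp only [Finset.sum_mul]
      rw [Finset.sum_comm]
      exact Finset.sum_congr rfl fun b _ => Finset.sum_congr rfl fun k _ => by ring
    have e2 : ∀ α, ∑ ε, (∑ μ, torJet m l u v α ε μ * d i μ)
        * (∑ ν, torJet m l u v ε α ν * d i ν)
        = ∑ e, (∑ k, T k e i * d k α) * (∑ f, T e f i * l f α) := by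
      intro α
      exact (Finset.sum_congr rfl fun ε _ =>
        congr_arg₂ (· * ·) (c1 α ε i) (e1 α ε)).trans (sum_pairing h2 _ _)
    simp only [e2]
    rw [Finset.sum_comm]
    exact Finset.sum_congr rfl fun e _ => sum_pairing h1 _ _
  rw [lagrangian, quadTor]
  congr 1
  -- Splitting g^{μν} into d_i^μ d_i^ν gives each torsion factor its own frame vector, after which
  -- c3 and c4 evaluate the contractions.
  have e1 : ∀ μ ν, (∑ i, d i μ * d i ν) *
      (∑ α, ∑ ε, torJet m l u v α ε μ * torJet m l u v ε α ν
      - (∑ α, torJet m l u v α μ α) * (∑ α, torJet m l u v α ν α))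
      = ∑ i, (∑ α, ∑ ε, (torJet m l u v α ε μ * d i μ) * (torJet m l u v ε α ν * d i ν)
        - ((∑ α, torJet m l u v α μ α) * d i μ) * ((∑ α, torJet m l u v α ν α) * d i ν)) := by
    intro μ ν
    rw [Finset.sum_mul]
    refine Finset.sum_congr rfl fun i _ => ?_
    rw [mul_sub, Finset.mul_sum]
    congr 1
    · simp only [Finset.mul_sum]
      exact Finset.sum_congr rfl fun b _ => Finset.sum_congr rfl fun k _ => by ring
    · ring
  simp only [← hd, e1]
  rw [← sum_rot3]
  refine Finset.sum_congr rfl fun i _ => ?_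
  simp only [Finset.sum_sub_distrib]
  rw [← c3, ← c4, Finset.sum_mul_sum]
  congr 1
  rw [sum_rot4, sum_rot4]
  simp only [Finset.sum_mul_sum]

end Jets

/-! ### Partial derivatives of the Lagrangian -/

section JetDerivatives

variable {n : ℕ} {m l : Fin n → Fin n → ℝ}

/-- A function that is quadratic along a line has the expected directional derivative. -/
theorem fderiv_eq_of_quadratic {E : Type*} [NormedAddCommGroup E] [NormedSpace ℝ E]
    {L : E → ℝ} {x w : E} {A B C : ℝ} (hd : DifferentiableAt ℝ L x)
    (h : ∀ t : ℝ, L (x + t • w) = A + t * B + t ^ 2 * C) : fderiv ℝ L x w = B := by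
  rw [← hd.lineDeriv_eq_fderiv, lineDeriv]
  simp only [h]
  have h1 : HasDerivAt (fun t : ℝ => A + t * B + t ^ 2 * C) (1 * B + (2 * 0) * C) 0 := by
    have h2 := ((hasDerivAt_id' (0 : ℝ)).mul_const B).const_add A
    have h3 := (hasDerivAt_pow 2 (0 : ℝ)).mul_const C
    simpa using h2.fun_add h3
  rw [h1.deriv]
  ring

theorem jetTor_add_smul (d : Fin n → Fin n → ℝ) (D W : Fin n → Fin n → Fin n → ℝ) (t : ℝ) :
    jetTor d (fun k μ ν => D k μ ν + t * W k μ ν)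
      = fun k a b => jetTor d D k a b + t * jetTor d W k a b := by
  funext k a b
  simp only [jetTor, Finset.mul_sum, ← Finset.sum_add_distrib]
  exact Finset.sum_congr rfl fun μ _ => Finset.sum_congr rfl fun ν _ => by ring

/-- The momentum `∂𝓗/∂λ_{jβ,γ}`. -/
def lagMomentum (l : Fin n → Fin n → ℝ) (T : Fin n → Fin n → Fin n → ℝ) (j β γ : Fin n) : ℝ :=
  (Matrix.of l).det * ∑ a, ∑ b, momentum T j a b * (dual l a β * dual l b γ)

/-- For fixed `l`, both `u` and `v` enter only through `jetDelta`, and quadratically. One expansion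
therefore serves both kinds of momenta, which are read off as the coefficient of t. -/
theorem lagrangian_add_smul (h : (Matrix.of l).det ≠ 0) {u v u' v' : Fin n → Fin n → Fin n → ℝ}
    {W : Fin n → Fin n → Fin n → ℝ} {t : ℝ}
    (hW : ∀ k μ ν, jetDelta m u' v' k μ ν = jetDelta m u v k μ ν + t * W k μ ν) :
    lagrangian m l u' v' = lagrangian m l u v
      + t * (∑ k, ∑ μ, ∑ ν, W k μ ν * lagMomentum l (jetTor (dual l) (jetDelta m u v)) k μ ν)
      + t ^ 2 * ((Matrix.of l).det * quadTor (jetTor (dual l) W)) := by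
  have e : jetDelta m u' v' = fun k μ ν => jetDelta m u v k μ ν + t * W k μ ν := by
    funext k μ ν
    exact hW k μ ν
  rw [lagrangian_eq h, lagrangian_eq h, e, jetTor_add_smul, quadTor_add, polarTor_jetTor]
  have e2 : ∑ k, ∑ μ, ∑ ν, W k μ ν * lagMomentum l (jetTor (dual l) (jetDelta m u v)) k μ ν
      = (Matrix.of l).det * ∑ k, ∑ μ, ∑ ν, W k μ ν * ∑ a, ∑ b,
        momentum (jetTor (dual l) (jetDelta m u v)) k a b * (dual l a μ * dual l b ν) := by
    simp only [lagMomentum]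
    rw [Finset.mul_sum]
    refine Finset.sum_congr rfl fun k _ => ?_
    rw [Finset.mul_sum]
    refine Finset.sum_congr rfl fun μ _ => ?_
    rw [Finset.mul_sum]
    exact Finset.sum_congr rfl fun ν _ => by ring
  rw [e2]
  ring

theorem fderiv_lagrangian_u (h : (Matrix.of l).det ≠ 0) (u v : Fin n → Fin n → Fin n → ℝ)
    (j β γ : Fin n) :
    fderiv ℝ (fun u => lagrangian m l u v) u (Pi.single j (Pi.single β (Pi.single γ 1)))
      = lagMomentum l (jetTor (dual l) (jetDelta m u v)) j β γ := by
  have hd : DifferentiableAt ℝ (fun u => lagrangian m l u v) u := by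
    unfold lagrangian torJet
    fun_prop
  set w : Fin n → Fin n → Fin n → ℝ := Pi.single j (Pi.single β (Pi.single γ 1)) with hw
  have hq : ∀ t : ℝ, lagrangian m l (u + t • w) v = _ := fun t =>
    lagrangian_add_smul (m := m) (u := u) (v := v) (W := w) (t := t) h fun k μ ν => by
      simp only [jetDelta, Pi.add_apply, Pi.smul_apply, smul_eq_mul]
      ring
  rw [fderiv_eq_of_quadratic hd hq]
  simp [hw, Pi.single_apply, ite_apply]

/-- A variation w of `v` changes D_{kμν} by -m_{bν} w_{kμb}, so no independent vertical momentum
arises. -/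
theorem fderiv_lagrangian_v (h : (Matrix.of l).det ≠ 0) (u v : Fin n → Fin n → Fin n → ℝ)
    (j β a : Fin n) :
    fderiv ℝ (fun v => lagrangian m l u v) v (Pi.single j (Pi.single β (Pi.single a 1)))
      = -∑ γ, m a γ * lagMomentum l (jetTor (dual l) (jetDelta m u v)) j β γ := by
  have hd : DifferentiableAt ℝ (fun v => lagrangian m l u v) v := by
    unfold lagrangian torJet
    fun_prop
  set w : Fin n → Fin n → Fin n → ℝ := Pi.single j (Pi.single β (Pi.single a 1)) with hw
  have hq : ∀ t : ℝ, lagrangian m l u (v + t • w) = _ := fun t =>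
    lagrangian_add_smul (m := m) (u := u) (v := v) (W := fun k μ ν => -∑ b, m b ν * w k μ b)
      (t := t) h fun k μ ν => by
      simp only [jetDelta, Pi.add_apply, Pi.smul_apply, smul_eq_mul, mul_add, mul_neg,
        Finset.sum_add_distrib, Finset.mul_sum]
      rw [Finset.sum_congr rfl fun b _ => mul_left_comm (m b ν) t (w k μ b)]
      ring
  rw [fderiv_eq_of_quadratic hd hq]
  simp [hw, Pi.single_apply, ite_apply]

theorem isOpen_det_ne_zero :
    IsOpen {l : Fin n → Fin n → ℝ | (Matrix.of l).det ≠ 0} :=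
  isOpen_ne.preimage (f := fun l : Fin n → Fin n → ℝ => (Matrix.of l).det)
    (Continuous.matrix_det continuous_id)

theorem differentiableAt_lagrangian (h : (Matrix.of l).det ≠ 0)
    (u v : Fin n → Fin n → Fin n → ℝ) :
    DifferentiableAt ℝ (fun l => lagrangian m l u v) l := by
  have h1 : ∀ i α, DifferentiableAt ℝ (fun l : Fin n → Fin n → ℝ => dual l i α) l := fun i α =>
    ((contDiffOn_dual (A := fun l : Fin n → Fin n → ℝ => l)
      (U := {l : Fin n → Fin n → ℝ | (Matrix.of l).det ≠ 0})
      (fun i j => by fun_prop) (fun _ hq => hq) i α).contDiffAt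
        (isOpen_det_ne_zero.mem_nhds h)).differentiableAt (by simp)
  have h2 : DifferentiableAt ℝ (fun l : Fin n → Fin n → ℝ => (Matrix.of l).det) l :=
    ((contDiffOn_det (A := fun l : Fin n → Fin n → ℝ => Matrix.of l) (U := Set.univ)
      (fun i j => by simp only [Matrix.of_apply]; fun_prop)).contDiffAt
        Filter.univ_mem).differentiableAt (by simp)
  unfold lagrangian torJet
  fun_prop

/-- The derivative of the Lagrangian along an infinitesimal shear `λ_j ↦ λ_j + t λ_i`. -/
theorem fderiv_lagrangian_l (h : (Matrix.of l).det ≠ 0) (u v : Fin n → Fin n → Fin n → ℝ)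
    {i j : Fin n} (hij : i ≠ j) :
    fderiv ℝ (fun l => lagrangian m l u v) l (Pi.single j (l i))
      = -(Matrix.of l).det * ∑ k, ∑ b, momentum (jetTor (dual l) (jetDelta m u v)) k i b
          * jetTor (dual l) (jetDelta m u v) k j b := by
  set D := jetDelta m u v with hD
  set T := jetTor (dual l) D with hT
  have hTs : ∀ k a b, T k a b = -T k b a := by
    intro k a b
    simp only [hT, jetTor, Finset.mul_sum, ← Finset.sum_neg_distrib]
    rw [Finset.sum_comm]
    exact Finset.sum_congr rfl fun μ _ => Finset.sum_congr rfl fun ν _ => by ring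
  -- Under the shear of row j, the dual row d_i becomes d_i - t d_j and the other dual rows are
  -- unchanged. The first-order change of T is then Q antisymmetrised in its last two indices.
  set Q : Fin n → Fin n → Fin n → ℝ := fun k a b => if a = i then -T k j b else 0 with hQ
  set W : Fin n → Fin n → ℝ := Pi.single j (l i) with hW
  -- Here i ≠ j is essential: adding a multiple of another row leaves the determinant unchanged, so
  -- 𝓗 varies only through T.
  have hdet : ∀ t : ℝ, (Matrix.of (l + t • W)).det = (Matrix.of l).det := by
    intro t
    rw [← Matrix.det_updateRow_add_smul_self (Matrix.of l) hij.symm t]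
    congr 1
    ext a μ
    by_cases ha : a = j
    · subst ha
      simp [hW]
    · simp [hW, ha]
  have hdual : ∀ t : ℝ, dual (l + t • W)
      = fun a μ => dual l a μ - t * (if a = i then dual l j μ else 0) := by
    intro t
    refine (eq_dual_of_sum_mul fun a b => ?_).symm
    have e : ∀ a b, ∑ α, l a α * dual l b α = if a = b then 1 else 0 := sum_mul_dual_left h
    have e1 : ∀ α, (l + t • W) a α
        = l a α + t * (if a = j then l i α else 0) := by
      intro α
      simp only [hW, Pi.add_apply, Pi.smul_apply, smul_eq_mul, Pi.single_apply, ite_apply,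
        Pi.zero_apply]
    simp only [e1]
    by_cases ha : a = j <;> by_cases hb : b = i
    · subst ha hb
      simp only [if_true, mul_sub, add_mul, Finset.sum_add_distrib, Finset.sum_sub_distrib,
        mul_left_comm _ t, mul_assoc, ← Finset.mul_sum, e]
      simp [hij]
    · simp only [ha, hb, if_true, if_false, mul_zero, sub_zero, add_mul, Finset.sum_add_distrib,
        mul_assoc, ← Finset.mul_sum, e]
      simp [Ne.symm hb]
    · simp only [ha, hb, if_true, if_false, mul_zero, add_zero, mul_sub, Finset.sum_sub_distrib,
        mul_left_comm _ t, ← Finset.mul_sum, e]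
      simp
    · simp only [ha, hb, if_false, mul_zero, sub_zero, add_zero, e]
  have htor : ∀ t : ℝ, jetTor (dual (l + t • W)) D
      = fun k a b => T k a b + t * (Q k a b - Q k b a) := by
    intro t
    funext k a b
    have e1 : ∀ b μ, ∑ ν, (dual l b ν - t * (if b = i then dual l j ν else 0))
          * (D k μ ν - D k ν μ)
        = ∑ ν, dual l b ν * (D k μ ν - D k ν μ)
          - t * (if b = i then ∑ ν, dual l j ν * (D k μ ν - D k ν μ) else 0) := by
      intro b μ
      split_ifs <;> simp [sub_mul, Finset.sum_sub_distrib, Finset.mul_sum, mul_assoc]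
    have e2 : jetTor (dual (l + t • W)) D k a b
        = T k a b - t * (if b = i then T k a j else 0) - t * (if a = i then T k j b else 0)
          + t ^ 2 * (if a = i then (if b = i then T k j j else 0) else 0) := by
      rw [jetTor, hdual]
      simp only [e1 b]
      split_ifs <;>
      simp only [hT, jetTor, sub_mul, mul_sub, mul_zero, sub_zero, add_zero,
        Finset.sum_sub_distrib, Finset.mul_sum, mul_assoc, mul_left_comm _ t, sq] <;> ring
    rw [e2]
    -- Skewness removes the t² term, so T is affine in t along the shear and 𝓗 is a quadratic
    -- polynomial in t.
    have e3 : T k j j = 0 := by linarith [hTs k j j]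
    simp only [hQ, e3, hTs k a j]
    split_ifs <;> ring
  have hq : ∀ t : ℝ, lagrangian m (l + t • W) u v
      = (Matrix.of l).det * quadTor T
        + t * ((Matrix.of l).det * ∑ k, ∑ a, ∑ b, momentum T k a b * Q k a b)
        + t ^ 2 * ((Matrix.of l).det * quadTor (fun k a b => Q k a b - Q k b a)) := by
    intro t
    rw [lagrangian_eq (by rw [hdet]; exact h), hdet, htor,
      quadTor_add T (fun k a b => Q k a b - Q k b a), two_mul_polarTor]
    ring
  rw [fderiv_eq_of_quadratic (differentiableAt_lagrangian h u v) hq, neg_mul, ← mul_neg]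
  congr 1
  rw [← Finset.sum_neg_distrib]
  refine Finset.sum_congr rfl fun k _ => ?_
  rw [Finset.sum_comm, ← Finset.sum_neg_distrib]
  refine Finset.sum_congr rfl fun b _ => ?_
  simp [hQ]

end JetDerivatives

/-! ### Symmetry of the terms quadratic in the torsion -/

section MomentumAlgebra

variable {n : ℕ} {T : Fin n → Fin n → Fin n → ℝ}

theorem momentum_skew (j a b : Fin n) : momentum T j a b = -momentum T j b a := by
  simp only [momentum]
  ring

theorem momentum_of_ne {i j : Fin n} (hij : i ≠ j) (b : Fin n) :
    momentum T j i b = 2 * (T i j b - T b j i - trTor T i * (if j = b then 1 else 0)) := by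
  simp [momentum, Ne.symm hij]

theorem sum_mul_momentum {i j : Fin n} (hij : i ≠ j) (w : Fin n → ℝ) :
    ∑ b, w b * momentum T j i b
      = 2 * (∑ b, w b * T i j b - ∑ b, w b * T b j i - w j * trTor T i) := by
  have e : w j * trTor T i = ∑ b, w b * (trTor T i * (if j = b then 1 else 0)) := by simp
  rw [e, ← Finset.sum_sub_distrib, ← Finset.sum_sub_distrib, Finset.mul_sum]
  exact Finset.sum_congr rfl fun b _ => by rw [momentum_of_ne hij]; ring

/-- The part of the Euler-Lagrange expression that is quadratic in the torsion is symmetric up to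
the terms with the basic form. -/
theorem quadratic_field_eq (hT : ∀ k a b, T k a b = -T k b a) (i j : Fin n) :
    -(∑ k, ∑ b, momentum T k i b * T k j b) + (1 / 2) * ∑ a, ∑ b, momentum T j a b * T i a b
      = 2 * ∑ k, ∑ b, T b k i * T k j b + 2 * (trTor T i * trTor T j) := by
  have e1 : ∑ k, ∑ b, momentum T k i b * T k j b
      = 2 * (∑ k, ∑ b, T i k b * T k j b - ∑ k, ∑ b, T b k i * T k j b
        - trTor T i * trTor T j + ∑ b, trTor T b * T i j b) := by
    have f1 : trTor T i * trTor T j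
        = ∑ k, ∑ b, trTor T i * (if k = b then 1 else 0) * T k j b := by
      simp [trTor, Finset.mul_sum]
    have f2 : ∑ b, trTor T b * T i j b
        = ∑ k, ∑ b, trTor T b * (if k = i then 1 else 0) * T k j b := by
      rw [Finset.sum_comm]
      simp
    rw [f1, f2]
    simp only [momentum, Finset.mul_sum, ← Finset.sum_add_distrib, ← Finset.sum_sub_distrib]
    exact Finset.sum_congr rfl fun k _ => Finset.sum_congr rfl fun b _ => by ring
  have e2 : ∑ a, ∑ b, momentum T j a b * T i a b
      = 2 * (2 * ∑ a, ∑ b, T i a b * T a j b + 2 * ∑ b, trTor T b * T i j b) := by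
    have f1 : ∑ a, ∑ b, T b j a * T i a b = -∑ a, ∑ b, T i a b * T a j b := by
      rw [Finset.sum_comm]
      simp only [← Finset.sum_neg_distrib]
      exact Finset.sum_congr rfl fun k _ => Finset.sum_congr rfl fun b _ => by
        rw [hT i b k]; ring
    have f2 : ∑ a, ∑ b, trTor T a * (if j = b then 1 else 0) * T i a b
        = -∑ b, trTor T b * T i j b := by
      rw [← Finset.sum_neg_distrib]
      refine Finset.sum_congr rfl fun a _ => ?_
      rw [hT i j a]
      simp
    have f3 : ∑ a, ∑ b, trTor T b * (if j = a then 1 else 0) * T i a b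
        = ∑ b, trTor T b * T i j b := by
      rw [Finset.sum_comm]
      simp
    have f4 : ∑ a, ∑ b, momentum T j a b * T i a b
        = 2 * (∑ a, ∑ b, T i a b * T a j b - ∑ a, ∑ b, T b j a * T i a b
          - ∑ a, ∑ b, trTor T a * (if j = b then 1 else 0) * T i a b
          + ∑ a, ∑ b, trTor T b * (if j = a then 1 else 0) * T i a b) := by
      simp only [momentum, Finset.mul_sum, ← Finset.sum_add_distrib, ← Finset.sum_sub_distrib]
      exact Finset.sum_congr rfl fun k _ => Finset.sum_congr rfl fun b _ => by ring
    rw [f4, f1, f2, f3]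
    ring
  rw [e1, e2]
  ring

/-- The closed form of `quadratic_field_eq` is symmetric: in T_{bki} T_{kjb}, renaming b and k and
reversing the last two indices of both factors exchanges i and j. -/
theorem quadratic_field_comm (hT : ∀ k a b, T k a b = -T k b a) (i j : Fin n) :
    -(∑ k, ∑ b, momentum T k i b * T k j b) + (1 / 2) * ∑ a, ∑ b, momentum T j a b * T i a b
      = -(∑ k, ∑ b, momentum T k j b * T k i b)
        + (1 / 2) * ∑ a, ∑ b, momentum T i a b * T j a b := by
  rw [quadratic_field_eq hT, quadratic_field_eq hT]
  have e : ∑ k, ∑ b, T b k i * T k j b = ∑ k, ∑ b, T b k j * T k i b := by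
    rw [Finset.sum_comm]
    exact Finset.sum_congr rfl fun k _ => Finset.sum_congr rfl fun b _ => by
      rw [hT k b i, hT b j k]; ring
  rw [e]
  ring

end MomentumAlgebra

/-! ### The Euler-Lagrange expression in the frame -/

section FieldEquations

variable {n : ℕ} (N lam : Phase n → Fin n → Fin n → ℝ)

/-- frame components of the momentum -/
def frameMomentum (j a b : Fin n) (p : Phase n) : ℝ :=
  momentum (fun k a b => frameTor N lam k a b p) j a b

/-- frame components of `N_β` -/
def frameNlTrace (k : Fin n) (p : Phase n) : ℝ := ∑ β, lam p k β * nlTrace N p β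

/-- frame components of the field tensor -/
def frameField (p : Phase n) (i j : Fin n) : ℝ :=
  (1 / (Matrix.of (colam lam p)).det) * ∑ β, colam lam p i β * eulerLagrange N lam p j β

variable {N lam} {U : Set (Phase n)} {p : Phase n}

theorem frameTor_skew (k a b : Fin n) : frameTor N lam k a b p = -frameTor N lam k b a p := by
  simp only [frameTor]
  ring

namespace LocalFrame

theorem smooth_frameMomentum (h : LocalFrame N lam U) (j a b : Fin n) :
    ContDiffOn ℝ ∞ (frameMomentum N lam j a b) U :=
  contDiffOn_const.mul ((((h.smooth_frameTor a j b).sub (h.smooth_frameTor b j a)).sub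
    ((h.smooth_frameBasic a).mul contDiffOn_const)).add
    ((h.smooth_frameBasic b).mul contDiffOn_const))

theorem dual_colam (h : LocalFrame N lam U) (hp : p ∈ U) : dual (colam lam p) = lam p :=
  dual_dual (h.det_ne_zero p hp)

theorem det_colam (h : LocalFrame N lam U) (hp : p ∈ U) : (Matrix.of (colam lam p)).det ≠ 0 :=
  det_dual_ne_zero (h.det_ne_zero p hp)

theorem jetTor_eq (h : LocalFrame N lam U) (hp : p ∈ U) :
    jetTor (dual (colam lam p)) (jetDelta (N p) (colamX lam p) (colamY lam p))
      = fun k a b => frameTor N lam k a b p := by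
  rw [h.dual_colam hp]
  funext k a b
  have e : ∀ μ ν, jetDelta (N p) (colamX lam p) (colamY lam p) k μ ν
      = delta N ν (fun q => colam lam q k μ) p := fun _ _ => rfl
  simp only [jetTor, e, frameTor, frameGam, frameDer, mul_sub, Finset.sum_sub_distrib,
    Finset.mul_sum]
  congr 1
  rw [Finset.sum_comm]
  exact Finset.sum_congr rfl fun μ _ => Finset.sum_congr rfl fun ν _ => by ring

theorem lagMomentum_eq (h : LocalFrame N lam U) (hp : p ∈ U) (j β γ : Fin n) :
    lagMomentum (colam lam p) (fun k a b => frameTor N lam k a b p) j β γ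
      = ∑ b, (∑ a, ((Matrix.of (colam lam p)).det * frameMomentum N lam j a b p) * lam p a β)
        * lam p b γ := by
  rw [lagMomentum, h.dual_colam hp, Finset.sum_comm]
  simp only [frameMomentum, Finset.mul_sum, Finset.sum_mul]
  exact Finset.sum_congr rfl fun μ _ => Finset.sum_congr rfl fun ν _ => by ring

theorem smooth_det_colam (h : LocalFrame N lam U) :
    ContDiffOn ℝ ∞ (fun q => (Matrix.of (colam lam q)).det) U :=
  contDiffOn_det (A := fun q => Matrix.of (colam lam q)) h.smooth_colam

theorem smooth_lagMomentum (h : LocalFrame N lam U) (j β γ : Fin n) : ContDiffOn ℝ ∞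
    (fun q => lagMomentum (colam lam q) (fun k a b => frameTor N lam k a b q) j β γ) U :=
  (smooth_sum fun b => (smooth_sum fun a => (h.smooth_det_colam.mul
    (h.smooth_frameMomentum j a b)).mul (h.smooth_lam a β)).mul (h.smooth_lam b γ)).congr
    fun _ hq => h.lagMomentum_eq hq j β γ

/-- The vertical momenta are -N^a_γ times the horizontal ones, so the x- and y-divergences combine
into δ_γ. The y-derivative also falls on N^a_γ, and this is how N_γ enters the field equations. -/
theorem eulerLagrange_eq (h : LocalFrame N lam U) (hp : p ∈ U) (j β : Fin n) :
    eulerLagrange N lam p j β =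
      fderiv ℝ (fun l => lagrangian (N p) l (colamX lam p) (colamY lam p)) (colam lam p)
        (Pi.single j (Pi.single β 1))
      - ∑ γ, (delta N γ (fun q => lagMomentum (colam lam q)
          (fun k a b => frameTor N lam k a b q) j β γ) p
        - nlTrace N p γ * lagMomentum (colam lam p) (fun k a b => frameTor N lam k a b p) j β γ)
      := by
  set P : Fin n → Phase n → ℝ := fun γ q =>
    lagMomentum (colam lam q) (fun k a b => frameTor N lam k a b q) j β γ with hP
  have dP : ∀ γ, DifferentiableAt ℝ (P γ) p := fun γ => h.diffAt hp (h.smooth_lagMomentum j β γ)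
  have dN : ∀ a γ, DifferentiableAt ℝ (fun q => N q a γ) p := fun a γ =>
    h.diffAt hp (h.smooth_N a γ)
  have e1 : ∀ γ, dx γ (fun q => fderiv ℝ (fun u => lagrangian (N q) (colam lam q) u (colamY lam q))
        (colamX lam q) (Pi.single j (Pi.single β (Pi.single γ 1)))) p = dx γ (P γ) p := fun γ =>
    dx_congr h.isOpen hp fun q hq => by
      rw [fderiv_lagrangian_u (h.det_colam hq), h.jetTor_eq hq]
  have e2 : ∀ a, dy a (fun q => fderiv ℝ (fun v => lagrangian (N q) (colam lam q) (colamX lam q) v)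
        (colamY lam q) (Pi.single j (Pi.single β (Pi.single a 1)))) p
      = -∑ γ, (dy a (fun q => N q a γ) p * P γ p + N p a γ * dy a (P γ) p) := by
    intro a
    have f1 : dy a (fun q => fderiv ℝ (fun v => lagrangian (N q) (colam lam q) (colamX lam q) v)
        (colamY lam q) (Pi.single j (Pi.single β (Pi.single a 1)))) p
        = dy a (fun q => ∑ γ, ((-1) * N q a γ) * P γ q) p :=
      dy_congr h.isOpen hp fun q hq => by
        rw [fderiv_lagrangian_v (h.det_colam hq), h.jetTor_eq hq, ← Finset.sum_neg_distrib]
        exact Finset.sum_congr rfl fun γ _ => by simp only [hP]; ring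
    rw [f1, dy_sum fun γ => ((dN a γ).const_mul (-1)).fun_mul (dP γ), ← Finset.sum_neg_distrib]
    refine Finset.sum_congr rfl fun γ _ => ?_
    rw [dy_mul ((dN a γ).const_mul (-1)) (dP γ), dy_mul (differentiableAt_const _) (dN a γ),
      dy_const]
    ring
  rw [eulerLagrange]
  simp only [e1, e2]
  have e3 : ∑ γ, (delta N γ (P γ) p - nlTrace N p γ * P γ p)
      = ∑ γ, dx γ (P γ) p + ∑ a, -∑ γ, (dy a (fun q => N q a γ) p * P γ p
        + N p a γ * dy a (P γ) p) := by
    have f1 : ∑ a, -∑ γ, (dy a (fun q => N q a γ) p * P γ p + N p a γ * dy a (P γ) p)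
        = ∑ γ, ∑ a, -(dy a (fun q => N q a γ) p * P γ p + N p a γ * dy a (P γ) p) := by
      simp only [← Finset.sum_neg_distrib]
      exact Finset.sum_comm
    rw [f1, ← Finset.sum_add_distrib]
    refine Finset.sum_congr rfl fun γ _ => ?_
    rw [delta, nlTrace, Finset.sum_mul, sub_sub, ← Finset.sum_add_distrib,
      Finset.sum_neg_distrib, ← sub_eq_add_neg]
    congr 1
    exact Finset.sum_congr rfl fun a _ => add_comm _ _
  rw [e3]
  ring

theorem frameDer_det (h : LocalFrame N lam U) (hp : p ∈ U) (b : Fin n) :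
    frameDer N lam b (fun q => (Matrix.of (colam lam q)).det) p
      = (Matrix.of (colam lam p)).det * ∑ k, frameGam N lam k k b p := by
  rw [frameDer_eq_fderiv]
  refine fderiv_det_of_rows (a := fun i k => frameGam N lam i k b p)
    (fun i j => h.diff_colam hp i j) fun i j => ?_
  rw [← frameDer_eq_fderiv, h.frameDer_colam hp]

theorem sum_delta_lam (h : LocalFrame N lam U) (hp : p ∈ U) (b : Fin n) :
    ∑ γ, delta N γ (fun q => lam q b γ) p = -∑ k, frameGam N lam k b k p := by
  simp only [h.delta_eq hp (f := fun q => lam q b _), h.frameDer_lam hp]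
  rw [Finset.sum_comm, ← Finset.sum_neg_distrib]
  refine Finset.sum_congr rfl fun k _ => ?_
  simp only [neg_mul, Finset.sum_neg_distrib]
  rw [sum_pairing_single (h.lam_colam hp) (fun i => frameGam N lam i b k p) k]

/-- The derivative of |λ| contributes the traces G_{kkb}, and the divergence of λ_b contributes
-G_{kbk}; together they form -C_b. The derivative of the other frame vector gives the term with
G_{iab}. -/
theorem sum_colam_delta_lagMomentum (h : LocalFrame N lam U) (hp : p ∈ U) (i j : Fin n) :
    ∑ β, colam lam p i β * ∑ γ, delta N γ (fun q => lagMomentum (colam lam q)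
          (fun k a b => frameTor N lam k a b q) j β γ) p
      = (Matrix.of (colam lam p)).det * (∑ b, frameDer N lam b (frameMomentum N lam j i b) p
        - ∑ a, ∑ b, frameMomentum N lam j a b p * frameGam N lam i a b p
        - ∑ b, frameBasic N lam b p * frameMomentum N lam j i b p) := by
  set dt : Phase n → ℝ := fun q => (Matrix.of (colam lam q)).det with hdt
  set Y : Fin n → Fin n → Phase n → ℝ := fun a b q => dt q * frameMomentum N lam j a b q with hY
  have ddt : DifferentiableAt ℝ dt p := h.diffAt hp h.smooth_det_colam
  have dm : ∀ a b, DifferentiableAt ℝ (frameMomentum N lam j a b) p := fun a b =>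
    h.diffAt hp (h.smooth_frameMomentum j a b)
  have dY : ∀ a b, DifferentiableAt ℝ (Y a b) p := fun a b => ddt.fun_mul (dm a b)
  have dl : ∀ a β, DifferentiableAt ℝ (fun q => lam q a β) p := fun a β => h.diff_lam hp a β
  have dX : ∀ β b, DifferentiableAt ℝ (fun q => ∑ a, Y a b q * lam q a β) p := fun β b =>
    DifferentiableAt.fun_sum fun a _ => (dY a b).fun_mul (dl a β)
  have e1 : ∀ β, ∑ γ, delta N γ (fun q => lagMomentum (colam lam q)
          (fun k a b => frameTor N lam k a b q) j β γ) p
      = ∑ b, (frameDer N lam b (fun q => ∑ a, Y a b q * lam q a β) p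
        - (∑ k, frameGam N lam k b k p) * ∑ a, Y a b p * lam p a β) := by
    intro β
    have f1 : ∀ γ, delta N γ (fun q => lagMomentum (colam lam q)
          (fun k a b => frameTor N lam k a b q) j β γ) p
        = ∑ b, (delta N γ (fun q => ∑ a, Y a b q * lam q a β) p * lam p b γ
          + (∑ a, Y a b p * lam p a β) * delta N γ (fun q => lam q b γ) p) := by
      intro γ
      rw [delta_congr h.isOpen hp fun q hq => h.lagMomentum_eq hq j β γ,
        delta_sum fun b => (dX β b).fun_mul (dl b γ)]
      exact Finset.sum_congr rfl fun b _ => delta_mul (dX β b) (dl b γ) γ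
    simp only [f1]
    rw [Finset.sum_comm]
    refine Finset.sum_congr rfl fun b _ => ?_
    rw [Finset.sum_add_distrib, ← Finset.mul_sum, h.sum_delta_lam hp, frameDer]
    have f2 : ∑ γ, delta N γ (fun q => ∑ a, Y a b q * lam q a β) p * lam p b γ
        = ∑ γ, lam p b γ * delta N γ (fun q => ∑ a, Y a b q * lam q a β) p :=
      Finset.sum_congr rfl fun γ _ => mul_comm _ _
    rw [f2]
    ring
  have e2 : ∀ b β, frameDer N lam b (fun q => ∑ a, Y a b q * lam q a β) p
      = ∑ a, (frameDer N lam b (Y a b) p - ∑ m, Y m b p * frameGam N lam a m b p) * lam p a β := by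
    intro b β
    rw [frameDer_sum fun a => (dY a b).fun_mul (dl a β)]
    simp only [fun a => frameDer_mul (N := N) (lam := lam) (dY a b) (dl a β) b,
      h.frameDer_lam hp, sub_mul, Finset.sum_sub_distrib, mul_neg, ← sub_eq_add_neg]
    congr 1
    simp only [Finset.mul_sum, Finset.sum_mul]
    rw [Finset.sum_comm]
    exact Finset.sum_congr rfl fun μ _ => Finset.sum_congr rfl fun ν _ => by ring
  have e3 : ∀ b, ∑ β, colam lam p i β * (frameDer N lam b (fun q => ∑ a, Y a b q * lam q a β) p
        - (∑ k, frameGam N lam k b k p) * ∑ a, Y a b p * lam p a β)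
      = frameDer N lam b (Y i b) p - ∑ m, Y m b p * frameGam N lam i m b p
        - (∑ k, frameGam N lam k b k p) * Y i b p := by
    intro b
    have g1 := sum_pairing_single (h.lam_colam hp)
      (fun a => frameDer N lam b (Y a b) p - ∑ m, Y m b p * frameGam N lam a m b p) i
    have g2 := sum_pairing_single (h.lam_colam hp) (fun a => Y a b p) i
    rw [← g1, ← g2, Finset.mul_sum, ← Finset.sum_sub_distrib]
    refine Finset.sum_congr rfl fun β _ => ?_
    rw [e2]
    ring
  have e4 : ∀ b, frameDer N lam b (Y i b) p = dt p * ((∑ k, frameGam N lam k k b p)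
      * frameMomentum N lam j i b p + frameDer N lam b (frameMomentum N lam j i b) p) := by
    intro b
    rw [frameDer_mul ddt (dm i b), h.frameDer_det hp]
    ring
  simp only [e1, Finset.mul_sum]
  rw [Finset.sum_comm]
  simp only [← Finset.mul_sum, e3, e4]
  rw [Finset.sum_comm (f := fun a b => frameMomentum N lam j a b p * frameGam N lam i a b p),
    ← Finset.sum_sub_distrib, ← Finset.sum_sub_distrib, Finset.mul_sum]
  refine Finset.sum_congr rfl fun b _ => ?_
  have e5 : ∑ m, Y m b p * frameGam N lam i m b p
      = dt p * ∑ m, frameMomentum N lam j m b p * frameGam N lam i m b p := by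
    rw [Finset.mul_sum]
    exact Finset.sum_congr rfl fun m _ => by simp only [hY]; ring
  have e6 : frameBasic N lam b p
      = ∑ k, frameGam N lam k b k p - ∑ k, frameGam N lam k k b p := by
    simp only [frameBasic, frameTor, Finset.sum_sub_distrib]
  rw [e5, e6]
  simp only [hY]
  ring

/-- Off-diagonal frame components of the field tensor. -/
theorem frameField_of_ne (h : LocalFrame N lam U) (hp : p ∈ U) {i j : Fin n} (hij : i ≠ j) :
    frameField N lam p i j =
      (-(∑ k, ∑ b, frameMomentum N lam k i b p * frameTor N lam k j b p)
        + (1 / 2) * ∑ a, ∑ b, frameMomentum N lam j a b p * frameTor N lam i a b p)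
      - ∑ b, frameDer N lam b (frameMomentum N lam j i b) p
      + ∑ b, (frameBasic N lam b p + frameNlTrace N lam b p) * frameMomentum N lam j i b p := by
  have hd := h.det_colam hp
  set dt := (Matrix.of (colam lam p)).det with hdt
  -- Contracting the partial derivatives in λ_{jβ} with λ_{iβ} gives the derivative along the shear
  -- of row j by row i.
  have e1 : ∑ β, colam lam p i β *
      fderiv ℝ (fun l => lagrangian (N p) l (colamX lam p) (colamY lam p)) (colam lam p)
        (Pi.single j (Pi.single β 1))
      = -dt * ∑ k, ∑ b, frameMomentum N lam k i b p * frameTor N lam k j b p := by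
    have f1 : (Pi.single j (colam lam p i) : Fin n → Fin n → ℝ)
        = ∑ β, colam lam p i β • Pi.single j (Pi.single β 1) := by
      funext a b
      simp [Finset.sum_apply, Pi.single_apply, ite_apply]
    have f2 := fderiv_lagrangian_l (m := N p) hd (colamX lam p) (colamY lam p) hij
    rw [h.jetTor_eq hp, f1, map_sum] at f2
    simp only [map_smul, smul_eq_mul] at f2
    exact f2
  have e2 : ∑ β, colam lam p i β * ∑ γ, nlTrace N p γ
        * lagMomentum (colam lam p) (fun k a b => frameTor N lam k a b p) j β γ
      = dt * ∑ b, frameNlTrace N lam b p * frameMomentum N lam j i b p := by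
    have f1 : ∀ β, ∑ γ, nlTrace N p γ
        * lagMomentum (colam lam p) (fun k a b => frameTor N lam k a b p) j β γ
        = ∑ a, (∑ b, dt * (frameNlTrace N lam b p * frameMomentum N lam j a b p)) * lam p a β := by
      intro β
      simp only [h.lagMomentum_eq hp, frameNlTrace, Finset.mul_sum, Finset.sum_mul]
      rw [sum_rot3, Finset.sum_comm]
      exact Finset.sum_congr rfl fun a _ => Finset.sum_congr rfl fun b _ =>
        Finset.sum_congr rfl fun γ _ => by ring
    simp only [f1, fun β x => mul_comm (colam lam p i β) x]
    rw [sum_pairing_single (h.lam_colam hp), Finset.mul_sum]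
  -- The momentum is skew in a, b, so it sees only the skew half of G_{iab}, which is T_{iab}/2.
  have e3 : ∑ a, ∑ b, frameMomentum N lam j a b p * frameGam N lam i a b p
      = (1 / 2) * ∑ a, ∑ b, frameMomentum N lam j a b p * frameTor N lam i a b p := by
    have f1 : ∑ a, ∑ b, frameMomentum N lam j a b p * frameGam N lam i a b p
        = -∑ a, ∑ b, frameMomentum N lam j a b p * frameGam N lam i b a p := by
      rw [Finset.sum_comm]
      simp only [← Finset.sum_neg_distrib]
      exact Finset.sum_congr rfl fun a _ => Finset.sum_congr rfl fun b _ => by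
        simp only [frameMomentum]
        rw [momentum_skew j a b]; ring
    simp only [frameTor, mul_sub, Finset.sum_sub_distrib]
    linarith
  have e4 := h.sum_colam_delta_lagMomentum hp i j
  rw [frameField]
  simp only [h.eulerLagrange_eq hp, mul_sub, Finset.sum_sub_distrib]
  rw [e1, e2, e4, e3]
  simp only [add_mul, Finset.sum_add_distrib]
  rw [← hdt]
  field_simp
  ring

theorem fieldTensor_eq (p : Phase n) (μ ν : Fin n) :
    fieldTensor N lam p μ ν = lower2 (colam lam p) (frameField N lam p) μ ν := by
  simp only [fieldTensor, fieldMixed, gLow, lower2, frameField, Finset.mul_sum, Finset.sum_mul]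
  rw [sum_rot3, Finset.sum_comm]
  exact Finset.sum_congr rfl fun i _ => Finset.sum_congr rfl fun j _ =>
    Finset.sum_congr rfl fun β _ => by ring

end LocalFrame
end FieldEquations

/-! ### The electromagnetic field and the skew field equations -/

section Field

variable {n : ℕ} (N lam : Phase n → Fin n → Fin n → ℝ)

/-- frame components of `cycCR` -/
def frameCyc (i j : Fin n) (p : Phase n) : ℝ :=
  ∑ l, ∑ a, (frameCv lam l j a p * frameCurv N lam a l i p
    + frameCv lam l l a p * frameCurv N lam a i j p
    + frameCv lam l i a p * frameCurv N lam a j l p)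

/-- frame components of the electromagnetic field -/
def frameEm (i j : Fin n) (p : Phase n) : ℝ :=
  (∑ k, frameBasic N lam k p * frameCon N lam i j k p
      - ∑ k, frameDer N lam k (frameCon N lam i j k) p
      + ∑ k, frameBasic N lam k p * frameTor N lam k i j p)
    + ∑ k, frameNlTrace N lam k p * (frameCon N lam i j k p + frameTor N lam k i j p)
    + ((1 / 2) * ∑ k, frameNlTrace N lam k p * frameTor N lam k i j p
      - (1 / 2) * (frameBasic N lam i p * frameNlTrace N lam j p
        - frameBasic N lam j p * frameNlTrace N lam i p))
    + (3 / 2) * frameCyc N lam i j p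

/-- frame components of the exterior derivative of the basic form -/
def frameExt (i j : Fin n) (p : Phase n) : ℝ :=
  frameDer N lam j (frameBasic N lam i) p - frameDer N lam i (frameBasic N lam j) p
    + ∑ k, frameBasic N lam k p * frameTor N lam k i j p

variable {N lam} {U : Set (Phase n)} {p : Phase n}

theorem frameCon_skew (i j k : Fin n) : frameCon N lam i j k p = -frameCon N lam j i k p := by
  simp only [frameCon, frameTor]
  ring

theorem frameCyc_skew (i j : Fin n) : frameCyc N lam i j p = -frameCyc N lam j i p := by
  simp only [frameCyc, ← Finset.sum_neg_distrib]
  refine Finset.sum_congr rfl fun l _ => Finset.sum_congr rfl fun a _ => ?_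
  rw [frameCurv_skew a i j, frameCurv_skew a l i, frameCurv_skew a j l]
  ring

namespace LocalFrame

theorem frameDer_neg_of_skew (h : LocalFrame N lam U) (hp : p ∈ U) {f g : Phase n → ℝ}
    (hg : ContDiffOn ℝ ∞ g U) (hfg : ∀ q ∈ U, f q = -g q) (k : Fin n) :
    frameDer N lam k f p = -frameDer N lam k g p := by
  rw [frameDer_congr (g := fun q => (-1) * g q) h.isOpen hp fun q hq => by rw [hfg q hq]; ring,
    frameDer_mul (differentiableAt_const _) (h.diffAt hp hg), frameDer_const]
  ring

theorem frameEm_skew (h : LocalFrame N lam U) (hp : p ∈ U) (i j : Fin n) :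
    frameEm N lam i j p = -frameEm N lam j i p := by
  have e : ∀ k, frameDer N lam k (frameCon N lam i j k) p
      = -frameDer N lam k (frameCon N lam j i k) p := fun k =>
    h.frameDer_neg_of_skew hp (h.smooth_frameCon j i k) (fun _ _ => frameCon_skew i j k) k
  simp only [frameEm, e, fun k => frameCon_skew (N := N) (lam := lam) (p := p) i j k,
    fun k => frameTor_skew (N := N) (lam := lam) (p := p) k i j, frameCyc_skew i j, mul_neg,
    Finset.sum_neg_distrib, ← neg_add]
  ring

/-- In the frame, the skew part of the field tensor is the difference of the electromagnetic field
and the exterior derivative of the basic form. -/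
theorem frameField_sub (h : LocalFrame N lam U) (hp : p ∈ U) (i j : Fin n) :
    frameField N lam p i j - frameField N lam p j i
      = 4 * (frameEm N lam i j p - frameExt N lam i j p) := by
  -- The formula for `frameField` is available off the diagonal only; on the diagonal both sides
  -- vanish by skewness.
  by_cases hij : i = j
  · subst hij
    have e1 := h.frameEm_skew hp i i
    have e2 : frameExt N lam i i p = 0 := by
      have : ∀ k, frameTor N lam k i i p = 0 := fun k => by simp [frameTor]
      simp [frameExt, this]
    rw [e2]
    linarith
  have dT : ∀ k i j, DifferentiableAt ℝ (frameTor N lam k i j) p := fun k i j =>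
    h.diffAt hp (h.smooth_frameTor k i j)
  have dC : ∀ i, DifferentiableAt ℝ (frameBasic N lam i) p := fun i =>
    h.diffAt hp (h.smooth_frameBasic i)
  have sT : ∀ l k i j, frameDer N lam l (frameTor N lam k i j) p
      = -frameDer N lam l (frameTor N lam k j i) p := fun l k i j =>
    h.frameDer_neg_of_skew hp (h.smooth_frameTor k j i) (fun _ _ => frameTor_skew k i j) l
  have hm : ∀ {i j : Fin n}, i ≠ j → ∑ b, frameDer N lam b (frameMomentum N lam j i b) p
      = 2 * (∑ b, frameDer N lam b (frameTor N lam i j b) p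
        + ∑ b, frameDer N lam b (frameTor N lam b i j) p
        - frameDer N lam j (frameBasic N lam i) p) := by
    intro i j hij
    have e1 : ∀ b, frameDer N lam b (frameMomentum N lam j i b) p
        = 2 * (frameDer N lam b (frameTor N lam i j b) p
          + frameDer N lam b (frameTor N lam b i j) p
          - frameDer N lam b (frameBasic N lam i) p * (if j = b then 1 else 0)) := by
      intro b
      have f1 : ∀ q ∈ U, frameMomentum N lam j i b q = 2 * ((frameTor N lam i j b q
          - frameTor N lam b j i q) - frameBasic N lam i q * (if j = b then 1 else 0)) :=
        fun q _ => momentum_of_ne hij b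
      have d1 := (dT i j b).fun_sub (dT b j i)
      have d2 := (dC i).fun_mul (differentiableAt_const (if j = b then (1 : ℝ) else 0))
      rw [frameDer_congr h.isOpen hp f1, frameDer_mul (differentiableAt_const _) (d1.fun_sub d2),
        frameDer_const, frameDer_sub d1 d2, frameDer_sub (dT i j b) (dT b j i),
        frameDer_mul (dC i) (differentiableAt_const _), frameDer_const, sT b b j i]
      ring
    simp only [e1, ← Finset.mul_sum, Finset.sum_sub_distrib, Finset.sum_add_distrib]
    simp
  have hw : ∀ {i j : Fin n}, i ≠ j →
      ∑ b, (frameBasic N lam b p + frameNlTrace N lam b p) * frameMomentum N lam j i b p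
      = 2 * (∑ b, (frameBasic N lam b p + frameNlTrace N lam b p) * frameTor N lam i j b p
        - ∑ b, (frameBasic N lam b p + frameNlTrace N lam b p) * frameTor N lam b j i p
        - (frameBasic N lam j p + frameNlTrace N lam j p) * frameBasic N lam i p) := by
    intro i j hij
    exact sum_mul_momentum hij _
  have hquad := quadratic_field_comm (T := fun k a b => frameTor N lam k a b p)
    (fun k a b => frameTor_skew k a b) i j
  have hcon : ∑ k, frameDer N lam k (frameCon N lam i j k) p
      = (1 / 2) * (∑ k, frameDer N lam k (frameTor N lam i j k) p
        - ∑ k, frameDer N lam k (frameTor N lam k i j) p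
        - ∑ k, frameDer N lam k (frameTor N lam j i k) p) := by
    rw [← Finset.sum_sub_distrib, ← Finset.sum_sub_distrib, Finset.mul_sum]
    refine Finset.sum_congr rfl fun k _ => ?_
    have f1 : ∀ q ∈ U, frameCon N lam i j k q = (1 / 2) * ((frameTor N lam i j k q
        - frameTor N lam k i j q) - frameTor N lam j i k q) := by
      intro q _
      simp only [frameCon, frameTor]
      ring
    have d1 := (dT i j k).fun_sub (dT k i j)
    rw [frameDer_congr h.isOpen hp f1,
      frameDer_mul (differentiableAt_const _) (d1.fun_sub (dT j i k)), frameDer_const,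
      frameDer_sub d1 (dT j i k), frameDer_sub (dT i j k) (dT k i j)]
    ring
  have hcon' : ∀ w : Fin n → ℝ, ∑ k, w k * frameCon N lam i j k p
      = (1 / 2) * (∑ k, w k * frameTor N lam i j k p
        - ∑ k, w k * frameTor N lam k i j p - ∑ k, w k * frameTor N lam j i k p) := by
    intro w
    rw [← Finset.sum_sub_distrib, ← Finset.sum_sub_distrib, Finset.mul_sum]
    refine Finset.sum_congr rfl fun k _ => ?_
    simp only [frameCon, frameTor]
    ring
  have hs : ∀ w : Fin n → ℝ, ∑ k, w k * frameTor N lam k j i p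
      = -∑ k, w k * frameTor N lam k i j p := by
    intro w
    rw [← Finset.sum_neg_distrib]
    exact Finset.sum_congr rfl fun k _ => by rw [frameTor_skew k j i]; ring
  have hs' : ∑ k, frameDer N lam k (frameTor N lam k j i) p
      = -∑ k, frameDer N lam k (frameTor N lam k i j) p := by
    rw [← Finset.sum_neg_distrib]
    exact Finset.sum_congr rfl fun k _ => sT k k j i
  -- Origin of the coefficient 3/2: compared with -4ξ, the difference E_{ij} - E_{ji} contains -6
  -- e_k T_{kij}. By the Bianchi identity this equals -6 (dC)_{ij} + 6 W_{ij}, and 6 = 4 · (3/2).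
  -- The remaining 2(e_j C_i - e_i C_j) and the surplus 2 C_k T_{kij} reduce -6 dC to -4 dC.
  have hB := h.sum_frameDer_frameTor hp i j
  change _ = _ - frameCyc N lam i j p at hB
  rw [h.frameField_of_ne hp hij, h.frameField_of_ne hp (Ne.symm hij), hm hij, hm (Ne.symm hij),
    hw hij, hw (Ne.symm hij), frameEm, frameExt, hcon, hcon', hs', hs]
  simp only [frameMomentum] at hquad ⊢
  rw [hquad]
  simp only [add_mul, mul_add, Finset.sum_add_distrib, hcon'] at hB ⊢
  linarith

theorem nlTrace_eq (h : LocalFrame N lam U) (hp : p ∈ U) (β : Fin n) :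
    nlTrace N p β = ∑ k, frameNlTrace N lam k p * colam lam p k β :=
  (sum_expand (h.lam_colam' hp) (fun β => nlTrace N p β) β).symm

theorem nlTraceUp_eq (β : Fin n) :
    nlTraceUp N lam p β = ∑ k, frameNlTrace N lam k p * lam p k β := by
  simp only [nlTraceUp, gUp, frameNlTrace, Finset.sum_mul]
  rw [Finset.sum_comm]
  exact Finset.sum_congr rfl fun i _ => Finset.sum_congr rfl fun j _ => by ring

theorem sum_nlTraceUp_conLow (h : LocalFrame N lam U) (hp : p ∈ U) (μ ν : Fin n) :
    ∑ β, nlTraceUp N lam p β * conLow N lam p μ ν β = lower2 (colam lam p)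
      (fun i j => ∑ k, frameNlTrace N lam k p * frameCon N lam i j k p) μ ν := by
  simp only [nlTraceUp_eq, h.conLow_eq hp]
  rw [sum_pairing (h.lam_colam hp)]
  exact sum_mul_lower2 _ _ _ _

theorem sum_nlTraceUp_TorLow (h : LocalFrame N lam U) (hp : p ∈ U) (μ ν : Fin n) :
    ∑ β, nlTraceUp N lam p β * TorLow N lam p β μ ν = lower2 (colam lam p)
      (fun i j => ∑ k, frameNlTrace N lam k p * frameTor N lam k i j p) μ ν := by
  simp only [nlTraceUp_eq, h.TorLow_eq hp]
  rw [sum_pairing (h.lam_colam hp)]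
  exact sum_mul_lower2 _ _ _ _

theorem sum_nlTrace_Tor (h : LocalFrame N lam U) (hp : p ∈ U) (μ ν : Fin n) :
    ∑ β, nlTrace N p β * Tor N lam p β μ ν
      = ∑ β, nlTraceUp N lam p β * TorLow N lam p β μ ν := by
  rw [h.sum_nlTraceUp_TorLow hp]
  simp only [h.nlTrace_eq hp, h.Tor_eq hp]
  rw [sum_pairing (h.colam_lam hp)]
  exact sum_mul_lower2 _ _ _ _

theorem TorLow_skew (α μ ν : Fin n) : TorLow N lam p α μ ν = -TorLow N lam p α ν μ := by
  simp only [TorLow, Tor, ← Finset.sum_neg_distrib]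
  exact Finset.sum_congr rfl fun ε _ => by ring

/-- The second expression of the electromagnetic field. -/
theorem emField_eq (h : LocalFrame N lam U) (hp : p ∈ U) (μ ν : Fin n) :
    emField N lam p μ ν =
      (gammaTwo N lam p μ ν - xi N lam p μ ν + eta N lam p μ ν)
        + ∑ β, nlTraceUp N lam p β * (conLow N lam p μ ν β + TorLow N lam p β μ ν)
        + ((1 / 2) * ∑ β, nlTraceUp N lam p β * TorLow N lam p β μ ν
          - skewPart (Zten N lam p) μ ν)
        + (3 / 2) * cycCR N lam p μ ν := by
  -- The contortion formula splits N^β γ_{μνβ} into the skew part of M and a multiple of N^β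
  -- Λ_{βμν}; this is the whole difference between the two expressions of F.
  have e1 : ∑ β, nlTraceUp N lam p β * conLow N lam p μ ν β = skewPart (Mten N lam p) μ ν
      - (1 / 2) * ∑ β, nlTraceUp N lam p β * TorLow N lam p β μ ν := by
    simp only [skewPart, Mten, ← Finset.sum_sub_distrib, Finset.mul_sum]
    refine Finset.sum_congr rfl fun β _ => ?_
    rw [h.conLow_eq_TorLow hp, TorLow_skew ν β μ]
    ring
  rw [emField, h.sum_nlTrace_Tor hp]
  simp only [mul_add, Finset.sum_add_distrib]
  rw [e1]
  ring

theorem emField_eq_lower2 (h : LocalFrame N lam U) (hp : p ∈ U) (μ ν : Fin n) :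
    emField N lam p μ ν = lower2 (colam lam p) (fun i j => frameEm N lam i j p) μ ν := by
  have hZ : ∀ μ ν, Zten N lam p μ ν = lower2 (colam lam p)
      (fun i j => frameBasic N lam i p * frameNlTrace N lam j p) μ ν := by
    intro μ ν
    rw [Zten, h.basic_eq hp, h.nlTrace_eq hp, Finset.sum_mul_sum]
    exact Finset.sum_congr rfl fun i _ => Finset.sum_congr rfl fun j _ => by ring
  have hW : cycCR N lam p μ ν
      = lower2 (colam lam p) (fun i j => frameCyc N lam i j p) μ ν := h.cycCR_eq hp μ ν
  rw [h.emField_eq hp]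
  simp only [mul_add, Finset.sum_add_distrib, skewPart, h.gammaTwo_eq hp, h.xi_eq hp,
    h.eta_eq hp, h.sum_nlTraceUp_conLow hp, h.sum_nlTraceUp_TorLow hp, hZ, hW,
    lower2_swap _ μ ν, frameEm, lower2_add, lower2_sub, lower2_const_mul]

theorem exterior_eq_lower2 (h : LocalFrame N lam U) (hp : p ∈ U) (μ ν : Fin n) :
    delta N ν (fun q => basic N lam q μ) p - delta N μ (fun q => basic N lam q ν) p
      = lower2 (colam lam p) (fun i j => frameExt N lam i j p) μ ν :=
  h.exterior_basic_eq hp μ ν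

theorem emField_skew (h : LocalFrame N lam U) (hp : p ∈ U) (μ ν : Fin n) :
    emField N lam p μ ν = -emField N lam p ν μ := by
  rw [h.emField_eq_lower2 hp, h.emField_eq_lower2 hp, lower2_swap _ μ ν]
  have e : (fun i j => frameEm N lam i j p) = fun i j => (-1) * frameEm N lam j i p := by
    funext i j
    rw [h.frameEm_skew hp]
    ring
  rw [e, lower2_const_mul]
  ring

/-- The skew part of the horizontal field equations. -/
theorem skewPart_fieldTensor (h : LocalFrame N lam U) (hp : p ∈ U) (μ ν : Fin n) :
    skewPart (fieldTensor N lam p) μ ν = 2 * (emField N lam p μ ν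
      - (delta N ν (fun q => basic N lam q μ) p - delta N μ (fun q => basic N lam q ν) p)) := by
  rw [h.exterior_eq_lower2 hp, h.emField_eq_lower2 hp, skewPart, fieldTensor_eq, fieldTensor_eq,
    lower2_swap _ μ ν, ← lower2_sub, ← lower2_sub]
  simp only [h.frameField_sub hp, lower2_const_mul]
  ring

theorem smooth_nlCurv (h : LocalFrame N lam U) (a μ ν : Fin n) :
    ContDiffOn ℝ ∞ (fun q => nlCurv N q a μ ν) U :=
  (smooth_delta h.isOpen h.smooth_N (h.smooth_N a μ) ν).sub
    (smooth_delta h.isOpen h.smooth_N (h.smooth_N a ν) μ)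

theorem smooth_frameNlTrace (h : LocalFrame N lam U) (k : Fin n) :
    ContDiffOn ℝ ∞ (frameNlTrace N lam k) U :=
  smooth_sum fun β => (h.smooth_lam k β).mul <| smooth_sum fun a =>
    smooth_dy h.isOpen (h.smooth_N a β) a

theorem smooth_frameCyc (h : LocalFrame N lam U) (i j : Fin n) :
    ContDiffOn ℝ ∞ (frameCyc N lam i j) U := by
  have h1 : ∀ k i a, ContDiffOn ℝ ∞ (frameCv lam k i a) U := fun k i a =>
    smooth_sum fun μ => (h.smooth_lam i μ).mul (smooth_dy h.isOpen (h.smooth_colam k μ) a)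
  have h2 : ∀ a i j, ContDiffOn ℝ ∞ (frameCurv N lam a i j) U := fun a i j =>
    smooth_sum fun μ => (h.smooth_lam i μ).mul <| smooth_sum fun ν =>
      (h.smooth_lam j ν).mul (h.smooth_nlCurv a μ ν)
  exact smooth_sum fun l => smooth_sum fun a =>
    (((h1 l j a).mul (h2 a l i)).add ((h1 l l a).mul (h2 a i j))).add ((h1 l i a).mul (h2 a j l))

theorem smooth_frameEm (h : LocalFrame N lam U) (i j : Fin n) :
    ContDiffOn ℝ ∞ (frameEm N lam i j) U := by
  have hC := h.smooth_frameBasic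
  have hn := h.smooth_frameNlTrace
  have hT := h.smooth_frameTor
  have hγ := h.smooth_frameCon
  refine ContDiffOn.add (ContDiffOn.add (ContDiffOn.add (ContDiffOn.add (ContDiffOn.sub ?_ ?_) ?_)
    ?_) (ContDiffOn.sub ?_ ?_)) (contDiffOn_const.mul (h.smooth_frameCyc i j))
  · exact smooth_sum fun k => (hC k).mul (hγ i j k)
  · exact smooth_sum fun k => h.smooth_frameDer (hγ i j k) k
  · exact smooth_sum fun k => (hC k).mul (hT k i j)
  · exact smooth_sum fun k => (hn k).mul ((hγ i j k).add (hT k i j))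
  · exact contDiffOn_const.mul (smooth_sum fun k => (hn k).mul (hT k i j))
  · exact contDiffOn_const.mul (((hC i).mul (hn j)).sub ((hC j).mul (hn i)))

/-- F already contains derivatives of the contortion; the frame expression exhibits it as a
polynomial in smooth functions, as the divergence identity requires. -/
theorem smooth_emField (h : LocalFrame N lam U) (μ ν : Fin n) :
    ContDiffOn ℝ ∞ (fun q => emField N lam q μ ν) U :=
  (smooth_sum fun i => smooth_sum fun j => (h.smooth_frameEm i j).mul
    ((h.smooth_colam i μ).mul (h.smooth_colam j ν))).congr fun _ hq => h.emField_eq_lower2 hq μ ν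

theorem smooth_emFieldUp (h : LocalFrame N lam U) (μ ν : Fin n) :
    ContDiffOn ℝ ∞ (fun q => emFieldUp N lam q μ ν) U :=
  smooth_sum fun α => smooth_sum fun β =>
    ((h.smooth_gUp μ α).mul (h.smooth_gUp ν β)).mul (h.smooth_emField α β)

theorem emFieldUp_skew (h : LocalFrame N lam U) (hp : p ∈ U) (μ ν : Fin n) :
    emFieldUp N lam p μ ν = -emFieldUp N lam p ν μ := by
  simp only [emFieldUp, ← Finset.sum_neg_distrib]
  rw [Finset.sum_comm]
  exact Finset.sum_congr rfl fun α _ => Finset.sum_congr rfl fun β _ => by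
    rw [h.emField_skew hp β α]; ring

end LocalFrame

/-- The data of an extended absolute parallelism space in a chart. -/
theorem EAPSpace.localFrame {M : Type*} [TopologicalSpace M] [ChartedSpace (Coord n) M]
    (S : EAPSpace n M) {e : OpenPartialHomeomorph M (Coord n)}
    (he : e ∈ IsManifold.maximalAtlas (modelWithCornersSelf ℝ (Coord n)) ∞ M) :
    LocalFrame (S.N e) (S.lamH e) (S.dom e) where
  isOpen := S.isOpen_dom e he
  smooth_N a μ := contDiffOn_pi.mp (contDiffOn_pi.mp (S.smooth_N e he) a) μ
  smooth_lam i α := contDiffOn_pi.mp (contDiffOn_pi.mp (S.smooth_lamH e he) i) α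
  det_ne_zero := S.det_lamH e he

end Field

end EAP

end

/-! ### The theorem in an arbitrary chart -/

theorem mainTheorem4 {n : ℕ} {M : Type*} [TopologicalSpace M] [ChartedSpace (EAP.Coord n) M]
    [IsManifold (modelWithCornersSelf ℝ (EAP.Coord n)) ∞ M]
    (S : EAP.EAPSpace n M) (e : OpenPartialHomeomorph M (EAP.Coord n))
    (he : e ∈ IsManifold.maximalAtlas (modelWithCornersSelf ℝ (EAP.Coord n)) ∞ M) :
    -- the second expression of `F`
    (∀ p ∈ S.dom e, ∀ μ ν : Fin n,
      EAP.emField (S.N e) (S.lamH e) p μ ν =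
        (EAP.gammaTwo (S.N e) (S.lamH e) p μ ν - EAP.xi (S.N e) (S.lamH e) p μ ν
            + EAP.eta (S.N e) (S.lamH e) p μ ν)
          + ∑ β, EAP.nlTraceUp (S.N e) (S.lamH e) p β *
              (EAP.conLow (S.N e) (S.lamH e) p μ ν β + EAP.TorLow (S.N e) (S.lamH e) p β μ ν)
          + ((1 / 2) * ∑ β, EAP.nlTraceUp (S.N e) (S.lamH e) p β *
                EAP.TorLow (S.N e) (S.lamH e) p β μ ν
              - EAP.skewPart (EAP.Zten (S.N e) (S.lamH e) p) μ ν)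
          + (3 / 2) * EAP.cycCR (S.N e) (S.lamH e) p μ ν) ∧
    -- `F` is skew-symmetric
    (∀ p ∈ S.dom e, ∀ μ ν : Fin n,
      EAP.emField (S.N e) (S.lamH e) p μ ν = -EAP.emField (S.N e) (S.lamH e) p ν μ) ∧
    -- skew part of the field equations, as the generalized Maxwell equations
    (∀ p ∈ S.dom e, ∀ μ ν : Fin n,
      EAP.skewPart (EAP.fieldTensor (S.N e) (S.lamH e) p) μ ν = 0 ↔
        EAP.emField (S.N e) (S.lamH e) p μ ν =
          EAP.delta (S.N e) ν (fun q => EAP.basic (S.N e) (S.lamH e) q μ) p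
            - EAP.delta (S.N e) μ (fun q => EAP.basic (S.N e) (S.lamH e) q ν) p) ∧
    -- the cyclic identity
    ((∀ p ∈ S.dom e, ∀ μ ν : Fin n,
        EAP.skewPart (EAP.fieldTensor (S.N e) (S.lamH e) p) μ ν = 0) →
      ∀ p ∈ S.dom e, ∀ μ ν σ : Fin n,
        EAP.hcov02 (S.N e) (EAP.GamO (S.N e) (S.lamH e)) (EAP.emField (S.N e) (S.lamH e)) p μ ν σ
          + EAP.hcov02 (S.N e) (EAP.GamO (S.N e) (S.lamH e)) (EAP.emField (S.N e) (S.lamH e))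
              p ν σ μ
          + EAP.hcov02 (S.N e) (EAP.GamO (S.N e) (S.lamH e)) (EAP.emField (S.N e) (S.lamH e))
              p σ μ ν
        = -∑ a, (EAP.nlCurv (S.N e) p a μ ν
                * EAP.dy a (fun q => EAP.basic (S.N e) (S.lamH e) q σ) p
              + EAP.nlCurv (S.N e) p a ν σ
                * EAP.dy a (fun q => EAP.basic (S.N e) (S.lamH e) q μ) p
              + EAP.nlCurv (S.N e) p a σ μ
                * EAP.dy a (fun q => EAP.basic (S.N e) (S.lamH e) q ν) p)) ∧
    -- the divergence of the current
    (∀ p ∈ S.dom e,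
      ∑ μ, EAP.hcovV (S.N e) (EAP.GamO (S.N e) (S.lamH e))
          (EAP.current (S.N e) (S.lamH e)) p μ μ =
        (1 / 2) *
          ((∑ ε, ∑ μ, EAP.emFieldUp (S.N e) (S.lamH e) p ε μ *
              (EAP.ricciO (S.N e) (S.lamH e) p μ ε - EAP.ricciO (S.N e) (S.lamH e) p ε μ))
            + ∑ a, ∑ μ, ∑ ν, EAP.nlCurv (S.N e) p a μ ν *
              EAP.vcov20 (EAP.CvO (S.lamH e)) (EAP.emFieldUp (S.N e) (S.lamH e)) p μ ν a)) := by
  have h := S.localFrame he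
  refine ⟨fun p hp μ ν => h.emField_eq hp μ ν, fun p hp μ ν => h.emField_skew hp μ ν,
    fun p hp μ ν => ?_, fun hE p hp μ ν σ => ?_, fun p hp => ?_⟩
  -- The skew part of E is exactly 2(F - dC), so the equivalence holds pointwise and component by
  -- component.
  · rw [h.skewPart_fieldTensor hp]
    constructor <;> intro hq <;> linarith
  -- F is differentiated here, so F = dC is needed on the whole open domain and not only at p.
  · refine EAP.cyclic_hcov02_of_eq_exterior h.isOpen h.smooth_N
      (fun α μ ν => EAP.LocalFrame.GamO_comm p α μ ν) h.smooth_basic (fun q hq μ ν => ?_) hp μ ν σ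
    have := hE q hq μ ν
    rw [h.skewPart_fieldTensor hq] at this
    linarith
  · exact EAP.sum_hcovV_divergence h.isOpen h.smooth_N
      (fun q _ α μ ν => EAP.LocalFrame.GamO_comm q α μ ν) h.smooth_GamO
      (fun q hq => h.emFieldUp_skew hq) h.smooth_emFieldUp hp
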